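/- Let $M$ be a von Neumann algebra with a faithful normal tracial state $\tau$, such that the predual $L^1(M,\tau)$ (the completion of $M$ in the norm $\|a\|_1=\tau(|a|)$) is separable. Write $x\le y$ in $L^1(M,\tau)$ if $\tau((y-x)a)\ge 0$ for all positive $a\in M$, and let $$S=\{x\in L^1(M,\tau): x\ge 0,\ \tau(x)=1\},\qquad S_b=S\cap M .$$ For $x,y\in S$ put $m(x,y)=\max\{\lambda\in\mathbb R:\lambda y\le x\}$ and $d(x,y)=\dfrac{1-m(x,y)m(y,x)}{1+m(x,y)m(y,x)}$. A positive linear map $g$ on $L^1(M,\tau)$ is faithful if $x\ge0$ and $g(x)=0$ imply $x=0$; in that case put $g\cdot x=g(x)/\tau(g(x))$ for $x\in S$ and $$c(g)=\sup_{x,y\in S,\ x\ne y}\frac{d(g\cdot x,g\cdot y)}{d(x,y)}$$ (with $\sup\emptyset=0$), and let $SHC(M)$ be the set of faithful positive linear maps $g$ on $L^1(M,\tau)$ with $c(g)<1$. Let $(\Omega,\mathbb P)$ be a probability space with an ergodic automorphism $T$ (bijective, with $T$ and $T^{-1}$ measurable and measure preserving). Let $\gamma_\omega\colon L^1(M,\tau)\to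 L^1(M,\tau)$, $\omega\in\Omega$, be a random operator, that is, $\omega\mapsto\gamma_\omega(x)$ is strongly measurable for every $x$, and suppose that for almost every $\omega$ the map $\gamma_\omega$ is linear, bounded, positive, faithful and $M$-preserving ($\gamma_\omega(M)\subset M$). Suppose also that for almost every $\omega$ the bounded linear extension to $L^1(M,\tau)$ of the dual map $\gamma_\omega^*\colon M\to M$, $\tau(x\gamma_\omega^*(a))=\tau(\gamma_\omega(x)a)$, is faithful. For integers $n\ge m$ let $$\Gamma_{n,m}(\omega)=\gamma_{T^n\omega}\circ\gamma_{T^{n-1}\omega}\circ\cdots\circ\gamma_{T^m\omega},$$ and suppose that $\mathbb P[\exists\, n,m\in\mathbb Z:\ n\ge m\text{ and }\Gamma_{n,m}\in SHC(M)]>0$. Then there is a constant $C\in[0,1)$ such that $\lim_{n\to+\infty}c(\Gamma_{n,m})^{1/(n-m+1)}=C$ almost surely for every $m\in\mathbb Z$ and $\lim_{m\to-\infty}c(\Gamma_{n,m})^{1/(n-m+1)}=C$ almost surely for every $n\in\mathbb Z$, and there are random variables $X_n,B_m\colon\Omega\to S_b$ ($n,m\in\mathbb Z$) with the following property. For every $\kappa\in(C,1)$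 and every $k\in\mathbb Z$ there is a random variable $E_k\colon\Omega\to[0,\infty)$ such that almost surely, for all integers $n\ge k>m$ and all $a\in M$, $$\left\|\frac{1}{\tau(\Gamma_{n,m}(1))}\Gamma_{n,m}(a)-\tau(B_m a)X_n\right\|_1\le E_k\,\kappa^{\,n-m+1}\,\|a\|_\infty .$$ -/

import Mathlib

open MeasureTheory Set Filter Topology
open scoped ComplexOrder

/-! ### The predual `L¹(A, τ)` -/

section TraceClass

variable {A : Type*} [NormedRing A] [NormedAlgebra ℂ A]

/-- The functional `τ_a = τ(a ·)` attached to an element `a` of the algebra. -/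
noncomputable def traceFunctional (τ : A →L[ℂ] ℂ) : A →L[ℂ] StrongDual ℂ A :=
  (ContinuousLinearMap.compL ℂ A A ℂ τ).comp (ContinuousLinearMap.mul ℂ A)

theorem traceFunctional_apply (τ : A →L[ℂ] ℂ) (a b : A) :
    traceFunctional τ a b = τ (a * b) := rfl

/-- `L¹(A, τ)`: the completion of `A` in the norm `‖a‖₁ = τ(|a|)`. It is realised as the norm
closure of `{τ(a ·) : a ∈ A}` in the dual of `A`, which is complete. That the norm `‖τ(a ·)‖` is
`τ(|a|)` is `norm_traceFunctional` below. -/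
abbrev TraceL1 (τ : A →L[ℂ] ℂ) :=
  ↥(LinearMap.range (traceFunctional τ).toLinearMap).topologicalClosure

namespace TraceL1

variable {τ : A →L[ℂ] ℂ}

/-- The canonical embedding of `A` into `L¹(A, τ)`. -/
noncomputable def of (τ : A →L[ℂ] ℂ) (a : A) : TraceL1 τ :=
  ⟨traceFunctional τ a, Submodule.le_topologicalClosure _ ⟨a, rfl⟩⟩

/-- The pairing `(x, a) ↦ τ(x a)` of `L¹(A, τ)` with `A`. -/
noncomputable def pair (x : TraceL1 τ) (a : A) : ℂ := (x : StrongDual ℂ A) a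

/-- The extension of `τ` to `L¹(A, τ)`. -/
noncomputable def trace (x : TraceL1 τ) : ℂ := x.pair 1

end TraceL1

end TraceClass

section NormFormula

/-- `‖τ(a ·)‖ = τ(|a|)` for a positive tracial functional `τ` on a C⋆-algebra, where the positive
square root `|a|` of `a* a` is written as `c* c`. -/
theorem norm_traceFunctional {A : Type*} [CStarAlgebra A] (τ : A →L[ℂ] ℂ)
    (hpos : ∀ a, 0 ≤ τ (star a * a)) (htr : ∀ a b, τ (a * b) = τ (b * a)) (a c : A)
    (h : star a * a = (star c * c) * (star c * c)) :
    ‖traceFunctional τ a‖ = (τ (star c * c)).re := by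
  let _ : PartialOrder A := CStarAlgebra.spectralOrder A
  have _ : StarOrderedRing A := CStarAlgebra.spectralOrderedRing A
  let f : A →ₚ[ℂ] ℂ := PositiveLinearMap.mk₀ (τ : A →ₗ[ℂ] ℂ) (by
    intro x hx
    obtain ⟨y, rfl⟩ := CStarAlgebra.nonneg_iff_eq_star_mul_self.mp hx
    exact hpos y)
  have hf : ∀ x, f x = τ x := fun _ => rfl
  set b := star c * c with hb
  have hb0 : 0 ≤ b := star_mul_self_nonneg c
  have hbsa : star b = b := by simp [hb]
  have hτb : ((τ b).re : ℂ) = τ b := by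
    have := (Complex.nonneg_iff.mp (hpos c)).2
    apply Complex.ext
    · simp
    · simpa [hb] using this
  have hτb0 : 0 ≤ (τ b).re := (Complex.nonneg_iff.mp (hpos c)).1
  -- approximate polar decomposition
  have key : ∀ ε : ℝ, 0 < ε → ∃ u : A, ‖u‖ ≤ 1 ∧ a = u * b + (ε : ℂ) • u ∧
      (τ b).re - ε * ‖τ‖ ≤ ‖τ (a * star u)‖ := by
    intro ε hε
    set e : A := algebraMap ℂ A (ε : ℂ) with he
    have he0 : 0 ≤ e := by
      rw [he]
      exact algebraMap_nonneg A (by exact_mod_cast hε.le)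
    have hesa : star e = e := (IsSelfAdjoint.of_nonneg he0)
    have heb : Commute e b := Algebra.commutes _ _
    have hunit : IsUnit (b + e) := by
      have h1 : -(ε : ℂ) ∉ spectrum ℂ b := by
        intro hmem
        have := spectrum_nonneg_of_nonneg hb0 hmem
        rw [Complex.nonneg_iff] at this
        simp at this
        linarith
      have h2 := spectrum.notMem_iff.mp h1
      have : b + e = -(algebraMap ℂ A (-(ε : ℂ)) - b) := by
        rw [map_neg, he]; abel
      rw [this]
      exact h2.neg
    obtain ⟨w, hw⟩ := hunit
    have hwsa : star (w : A) = w := by rw [hw, star_add, hbsa, hesa]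
    set r : A := (↑w⁻¹ : A) with hr
    have hrw : r * (b + e) = 1 := by rw [← hw]; exact w.inv_mul
    have hwr : (b + e) * r = 1 := by rw [← hw]; exact w.mul_inv
    have hrsa : star r = r := by
      have h1 : star r * (b + e) = 1 := by
        rw [← hw, ← hwsa, ← star_mul]
        rw [hw, hwr, star_one]
      calc star r = star r * ((b + e) * r) := by rw [hwr, mul_one]
        _ = r := by rw [← mul_assoc, h1, one_mul]
    refine ⟨a * r, ?_, ?_, ?_⟩
    · have h1 : star (a * r) * (a * r) = star r * (b * b) * r := by
        rw [star_mul, mul_assoc, ← mul_assoc (star a), h]; noncomm_ring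
      have h2 : b * b ≤ (b + e) * (b + e) := by
        have : (b + e) * (b + e) - b * b = e * b + b * e + e * e := by noncomm_ring
        rw [← sub_nonneg, this, ← heb.eq]
        have h3 : 0 ≤ e * b := heb.mul_nonneg he0 hb0
        have h4 : 0 ≤ e * e := (Commute.refl e).mul_nonneg he0 he0
        exact add_nonneg (add_nonneg h3 h3) h4
      have h3 : star (a * r) * (a * r) ≤ 1 := by
        rw [h1]
        refine (star_left_conjugate_le_conjugate h2 r).trans_eq ?_
        rw [hrsa, ← mul_assoc, hrw, one_mul, hwr]
      have h4 : ‖star (a * r) * (a * r)‖ ≤ 1 :=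
        (CStarAlgebra.norm_le_one_iff_of_nonneg _ (star_mul_self_nonneg _)).mpr h3
      rw [CStarRing.norm_star_mul_self] at h4
      nlinarith [norm_nonneg (a * r)]
    · have : (ε : ℂ) • (a * r) = (a * r) * e := by
        rw [he, Algebra.smul_def, Algebra.commutes]
      rw [this, ← mul_add, mul_assoc, hrw, mul_one]
    · have h1 : τ (a * star (a * r)) = τ (r * (b * b)) := by
        rw [htr, star_mul, hrsa, mul_assoc, h]
      have h2 : r * (b * b) = b - (ε : ℂ) • (r * b) := by
        have : (ε : ℂ) • (r * b) = r * e * b := by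
          rw [he, mul_assoc, ← Algebra.smul_def, mul_smul_comm]
        rw [this]
        have : r * (b * b) = r * (b + e) * b - r * e * b := by noncomm_ring
        rw [this, hrw, one_mul]
      have h3 : ‖r * b‖ ≤ 1 := by
        have h1 : star (b * r) * (b * r) = star r * (b * b) * r := by
          rw [star_mul, hbsa]; noncomm_ring
        have h2 : b * b ≤ (b + e) * (b + e) := by
          have : (b + e) * (b + e) - b * b = e * b + b * e + e * e := by noncomm_ring
          rw [← sub_nonneg, this, ← heb.eq]
          have h3 : 0 ≤ e * b := heb.mul_nonneg he0 hb0
          have h4 : 0 ≤ e * e := (Commute.refl e).mul_nonneg he0 he0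
          exact add_nonneg (add_nonneg h3 h3) h4
        have h3 : star (b * r) * (b * r) ≤ 1 := by
          rw [h1]
          refine (star_left_conjugate_le_conjugate h2 r).trans_eq ?_
          rw [hrsa, ← mul_assoc, hrw, one_mul, hwr]
        have h4 : ‖star (b * r) * (b * r)‖ ≤ 1 :=
          (CStarAlgebra.norm_le_one_iff_of_nonneg _ (star_mul_self_nonneg _)).mpr h3
        rw [CStarRing.norm_star_mul_self] at h4
        have h5 : ‖b * r‖ ≤ 1 := by nlinarith [norm_nonneg (b * r)]
        have h6 : star (b * r) = r * b := by rw [star_mul, hrsa, hbsa]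
        rw [← h6, norm_star]; exact h5
      rw [h1, h2, map_sub, map_smul]
      have h4 : ‖(ε : ℂ) • τ (r * b)‖ ≤ ε * ‖τ‖ := by
        rw [norm_smul, Complex.norm_real, Real.norm_of_nonneg hε.le]
        refine mul_le_mul_of_nonneg_left ?_ hε.le
        refine (τ.le_opNorm _).trans ?_
        nlinarith [norm_nonneg τ]
      have h5 : ‖τ b‖ = (τ b).re := by
        rw [← hτb, Complex.norm_real, Real.norm_of_nonneg hτb0, Complex.ofReal_re]
      have h6 := norm_sub_norm_le (τ b) ((ε : ℂ) • τ (r * b))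
      linarith
  apply le_antisymm
  · refine ContinuousLinearMap.opNorm_le_bound _ hτb0 fun d => ?_
    rw [traceFunctional_apply]
    refine le_of_forall_pos_le_add fun δ hδ => ?_
    set ε : ℝ := δ / (‖τ‖ * ‖d‖ + 1) with hε
    have hden : 0 < ‖τ‖ * ‖d‖ + 1 := by positivity
    obtain ⟨u, hu, ha, -⟩ := key ε (by positivity)
    have h1 : τ (u * b * d) = τ (c * (d * u * star c)) := by
      rw [hb, ← mul_assoc u, mul_assoc (u * star c), htr (u * star c)]
      simp only [mul_assoc]
    have h2 : ‖τ (c * (d * u * star c))‖ ≤ (τ b).re * ‖d‖ := by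
      have h3 := norm_inner_le_norm (𝕜 := ℂ) (f.toPreGNS (star c))
        (f.leftMulMapPreGNS (d * u) (f.toPreGNS (star c)))
      rw [PositiveLinearMap.preGNS_inner_def] at h3
      simp only [PositiveLinearMap.leftMulMapPreGNS_apply, PositiveLinearMap.ofPreGNS_toPreGNS,
        star_star] at h3
      have h4 : ‖f.leftMulMapPreGNS (d * u)‖ ≤ ‖d * u‖ :=
        LinearMap.mkContinuous_norm_le _ (norm_nonneg _) _
      have h5 := (f.leftMulMapPreGNS (d * u)).le_opNorm (f.toPreGNS (star c))
      have h6 : ‖f.toPreGNS (star c)‖ ^ 2 = (τ b).re := by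
        have := f.preGNS_norm_sq (f.toPreGNS (star c))
        simp only [PositiveLinearMap.ofPreGNS_toPreGNS, star_star, hf] at this
        rw [htr, ← hb, ← hτb] at this
        exact_mod_cast this
      have h7 : ‖d * u‖ ≤ ‖d‖ := (norm_mul_le _ _).trans (by nlinarith [norm_nonneg d])
      refine h3.trans ?_
      rw [← h6]
      have h8 : ‖f.leftMulMapPreGNS (d * u) (f.toPreGNS (star c))‖
          ≤ ‖d‖ * ‖f.toPreGNS (star c)‖ :=
        h5.trans (mul_le_mul_of_nonneg_right (h4.trans h7) (norm_nonneg _))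
      calc _ ≤ ‖f.toPreGNS (star c)‖ * (‖d‖ * ‖f.toPreGNS (star c)‖) :=
            mul_le_mul_of_nonneg_left h8 (norm_nonneg _)
        _ = _ := by ring
    rw [ha, add_mul, map_add, h1, smul_mul_assoc, map_smul]
    refine (norm_add_le _ _).trans (add_le_add h2 ?_)
    rw [norm_smul, Complex.norm_real, Real.norm_of_nonneg (by positivity)]
    have h3 : ‖τ (u * d)‖ ≤ ‖τ‖ * ‖d‖ := by
      refine (τ.le_opNorm _).trans (mul_le_mul_of_nonneg_left ?_ (norm_nonneg _))
      exact (norm_mul_le _ _).trans (by nlinarith [norm_nonneg d])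
    calc ε * ‖τ (u * d)‖ ≤ ε * (‖τ‖ * ‖d‖ + 1) :=
          mul_le_mul_of_nonneg_left (by linarith) (by positivity)
      _ = δ := by rw [hε]; field_simp
  · refine le_of_forall_pos_le_add fun δ hδ => ?_
    obtain ⟨u, hu, -, h1⟩ := key (δ / (‖τ‖ + 1)) (by positivity)
    have h2 : ‖τ (a * star u)‖ ≤ ‖traceFunctional τ a‖ := by
      rw [← traceFunctional_apply]
      refine ((traceFunctional τ a).le_opNorm _).trans ?_
      rw [norm_star]
      nlinarith [norm_nonneg (traceFunctional τ a)]
    have h3 : δ / (‖τ‖ + 1) * ‖τ‖ ≤ δ := by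
      have := norm_nonneg τ
      rw [div_mul_eq_mul_div, div_le_iff₀ (by positivity)]
      nlinarith
    linarith

end NormFormula

/-! ### Tracial von Neumann algebras -/

section VonNeumann

variable {H : Type*} [NormedAddCommGroup H] [InnerProductSpace ℂ H] [CompleteSpace H]

/-- `τ` is a faithful normal tracial state on the von Neumann algebra `M`. The order on `M` is the
order of operators on `H`. -/
structure IsFaithfulNormalTracialState (M : VonNeumannAlgebra H)
    (τ : M.toStarSubalgebra →L[ℂ] ℂ) : Prop where
  map_one : τ 1 = 1
  nonneg : ∀ a, 0 ≤ τ (star a * a)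
  trace : ∀ a b, τ (a * b) = τ (b * a)
  faithful : ∀ a, τ (star a * a) = 0 → a = 0
  normal : ∀ (D : Set M.toStarSubalgebra) (s : M.toStarSubalgebra), D.Nonempty →
    (∀ a ∈ D, 0 ≤ a) → DirectedOn (· ≤ ·) D → IsLUB D s →
    IsLUB ((fun a => (τ a).re) '' D) (τ s).re

/-- The norm of `L¹(M, τ)` restricted to `M` is `a ↦ τ(|a|)`. -/
theorem IsFaithfulNormalTracialState.norm_of {M : VonNeumannAlgebra H}
    {τ : M.toStarSubalgebra →L[ℂ] ℂ} (hτ : IsFaithfulNormalTracialState M τ)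
    (a c : M.toStarSubalgebra) (h : star a * a = (star c * c) * (star c * c)) :
    ‖TraceL1.of τ a‖ = (τ (star c * c)).re := by
  have hcl : IsClosed (M.toStarSubalgebra : Set (H →L[ℂ] H)) := by
    have h1 := Set.isClosed_centralizer (Set.centralizer (M : Set (H →L[ℂ] H)))
    rwa [M.centralizer_centralizer] at h1
  let _ : CStarAlgebra M.toStarSubalgebra :=
    StarSubalgebra.cstarAlgebra M.toStarSubalgebra (h_closed := hcl)
  exact norm_traceFunctional τ hτ.nonneg hτ.trace a c h

end VonNeumann

/-! ### States, Hennion's metric and strict Hennion contractions -/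

namespace TraceL1

variable {A : Type*} [NormedRing A] [NormedAlgebra ℂ A] [StarRing A] {τ : A →L[ℂ] ℂ}

/-- The positive cone of `L¹(A, τ)`: those `x` with `τ(x a) ≥ 0` for all positive `a = b* b`. -/
def IsPos (x : TraceL1 τ) : Prop := ∀ b : A, 0 ≤ x.pair (star b * b)

variable (τ) in
/-- The set `S` of normal states. -/
def states : Set (TraceL1 τ) := {x | x.IsPos ∧ x.trace = 1}

variable (τ) in
/-- The set `S_b = S ∩ A` of bounded normal states. -/
def boundedStates : Set (TraceL1 τ) := states τ ∩ range (of τ)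

/-- `m(x, y) = max {t ∈ ℝ : t y ≤ x}`. -/
noncomputable def mQuantity (x y : TraceL1 τ) : ℝ := sSup {t : ℝ | (x - (t : ℂ) • y).IsPos}

/-- Hennion's metric. -/
noncomputable def hennionDist (x y : TraceL1 τ) : ℝ :=
  (1 - mQuantity x y * mQuantity y x) / (1 + mQuantity x y * mQuantity y x)

/-- A map that sends positive elements to positive elements. -/
def PositiveMap (g : TraceL1 τ → TraceL1 τ) : Prop := ∀ x, x.IsPos → (g x).IsPos

/-- A map that annihilates no non-zero positive element. -/
def FaithfulMap (g : TraceL1 τ → TraceL1 τ) : Prop := ∀ x, x.IsPos → g x = 0 → x = 0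

/-- A map of `L¹(A, τ)` that sends `A` into `A`. -/
def PreservesAlgebra (g : TraceL1 τ → TraceL1 τ) : Prop := ∀ a : A, g (of τ a) ∈ range (of τ)

/-- The projective action `g · x = g(x) / τ(g(x))`. -/
noncomputable def projAction (g : TraceL1 τ → TraceL1 τ) (x : TraceL1 τ) : TraceL1 τ :=
  (g x).trace⁻¹ • g x

/-- The Hennion contraction constant `c(g)`. -/
noncomputable def contractionConst (g : TraceL1 τ → TraceL1 τ) : ℝ :=
  sSup {r | ∃ x ∈ states τ, ∃ y ∈ states τ, x ≠ y ∧
    r = hennionDist (projAction g x) (projAction g y) / hennionDist x y}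

/-- Strict Hennion contractions: faithful positive linear maps `g` with `c(g) < 1`. -/
def IsSHC (g : TraceL1 τ → TraceL1 τ) : Prop :=
  IsLinearMap ℂ g ∧ PositiveMap g ∧ FaithfulMap g ∧ contractionConst g < 1

/-- `h` is the dual map `g* : A → A` of `g`, that is `τ(x h(a)) = τ(g(x) a)`. -/
def IsDualMap (g : TraceL1 τ → TraceL1 τ) (h : A → A) : Prop :=
  ∀ (x : TraceL1 τ) (a : A), x.pair (h a) = (g x).pair a

/-- `e` is the bounded linear extension to `L¹(A, τ)` of the dual map `g*` of `g`. -/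
def IsDualExtension (g e : TraceL1 τ → TraceL1 τ) : Prop :=
  IsBoundedLinearMap ℂ e ∧ ∃ h : A → A, IsDualMap g h ∧ ∀ a, e (of τ a) = of τ (h a)

end TraceL1

/-! ### Random linear operators and quantum processes -/

section Random

/-- A bounded random linear operator on a Banach space `E`: each `ω ↦ γ_ω(x)` is a random variable
(an almost sure limit of simple functions), and `γ_ω` is almost surely linear and bounded. -/
structure IsBoundedRandomOperator {Ω E : Type*} [MeasurableSpace Ω] [NormedAddCommGroup E]
    [NormedSpace ℂ E] (P : Measure Ω) (γ : Ω → E → E) : Prop where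
  measurable : ∀ x, AEStronglyMeasurable (fun ω => γ ω x) P
  bounded : ∀ᵐ ω ∂P, IsBoundedLinearMap ℂ (γ ω)

/-- `γ_{T^{m+j} ω} ∘ ⋯ ∘ γ_{T^m ω}`. -/
def processAux {Ω E : Type*} (T : Equiv.Perm Ω) (γ : Ω → E → E) (m : ℤ) (ω : Ω) : ℕ → E → E
  | 0 => γ ((T ^ m) ω)
  | j + 1 => γ ((T ^ (m + (j + 1 : ℕ))) ω) ∘ processAux T γ m ω j

/-- The interval quantum process `Γ_{n,m}(ω) = γ_{T^n ω} ∘ ⋯ ∘ γ_{T^m ω}` for `n ≥ m`. -/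
def quantumProcess {Ω E : Type*} (T : Equiv.Perm Ω) (γ : Ω → E → E) (n m : ℤ) (ω : Ω) : E → E :=
  processAux T γ m ω (n - m).toNat

end Random

/-! ### Positive functionals on C⋆-algebras -/

section PositiveFunctional

variable {A : Type*} [CStarAlgebra A] [PartialOrder A] [StarOrderedRing A]

/-! The argument is a projective contraction in the spirit of Birkhoff and Hennion. On states, `d`
never exceeds 1 and controls the norm: `‖x - y‖ ≤ 4 d(x, y)` (`norm_sub_le_hennionDist`). A faithful
positive map whose image has `d`-diameter at most `D` contracts `d` by the factor `D`
(`hennionDist_projAction_le`): distinct states `x`, `y` are combinations of the positive elements `x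
- m(x,y) y` and `y - m(y,x) x`, and comparing the images of these two elements improves the
comparison of `x` with `y`. Hence `c(g)` is the diameter of the image, `c ≤ 1`, and `c` is
submultiplicative.

So `-log c` of the products is a superadditive process with values in `[0, ∞]`. The ergodic theorem
for such processes needs no integrability (`IsSuperadditive.tendsto_growthRate`) and gives almost
sure convergence of the averages to the supremum of the mean values. That rate is positive, because
some product has `c < 1` with positive probability, and `C = exp(-rate)`, with `C = 0` for an
infinite rate. Time reversal does not change the expectations, so both directions have the same `C`.

With `n` fixed and `m → -∞` the new factors enter on the right, the images of the set of states are
nested, and they shrink to a point `X_n` (`exists_limit_state`). With `m` fixed and `n → ∞` the new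
factors enter on the left; once `c ≤ 1/2`, they change the functional `a ↦ τ(Γ(a)) / τ(Γ(1))` on
positive `a` only by a factor within `4c` of 1, so that it converges to `τ(B_m ·)`
(`exists_limit_functional`). Together this puts the normalised product within `32 c(Γ_{n,m}) ‖a‖` of
a rank one operator (`norm_sub_rank_one_le`). Splitting the product at `k` bounds `c(Γ_{n,m})` by
`c(Γ_{n,k}) c(Γ_{k-1,m})`, and each factor is at most a random constant depending on `k` and `κ`
times a power of `κ`.

The limits lie in `M` because both are dominated by a multiple of `τ`, and such functionals have
densities in `M` (`hasBoundedDensities`). The density is a weak limit of near-minimisers of `τ(a²) -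
2φ(a)`; normality of `τ` enters through the fact that `τ` respects bounded weak limits.
Measurability of `c` rests on closedness of the relation `d ≤ D` between states, which allows
testing on countably many states. -/

/-- A functional is positive if it is nonnegative on all `b* b`. -/
def IsPosFunctional (φ : A →L[ℂ] ℂ) : Prop := ∀ b, 0 ≤ φ (star b * b)

theorem IsPosFunctional.nonneg {φ : A →L[ℂ] ℂ} (hφ : IsPosFunctional φ) {a : A} (ha : 0 ≤ a) :
    0 ≤ φ a := by
  obtain ⟨b, rfl⟩ := CStarAlgebra.nonneg_iff_eq_star_mul_self.mp ha
  exact hφ b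

theorem isPosFunctional_iff {φ : A →L[ℂ] ℂ} :
    IsPosFunctional φ ↔ ∀ a : A, 0 ≤ a → 0 ≤ φ a :=
  ⟨fun h _ ha => h.nonneg ha, fun h b => h _ (star_mul_self_nonneg b)⟩

theorem IsPosFunctional.re_mono {φ : A →L[ℂ] ℂ} (hφ : IsPosFunctional φ) {a b : A} (h : a ≤ b) :
    (φ a).re ≤ (φ b).re := by
  have := (Complex.nonneg_iff.mp (hφ.nonneg (sub_nonneg.mpr h))).1
  rw [map_sub, Complex.sub_re] at this
  linarith

theorem IsPosFunctional.eq_re {φ : A →L[ℂ] ℂ} (hφ : IsPosFunctional φ) {a : A}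
    (ha : 0 ≤ a) : φ a = ((φ a).re : ℂ) :=
  Complex.ext (by simp) (by simpa using (Complex.nonneg_iff.mp (hφ.nonneg ha)).2.symm)

/-- The Cauchy–Schwarz inequality for positive functionals. -/
theorem IsPosFunctional.cauchySchwarz {φ : A →L[ℂ] ℂ} (hφ : IsPosFunctional φ) (a b : A) :
    ‖φ (star a * b)‖ ^ 2 ≤ (φ (star a * a)).re * (φ (star b * b)).re := by
  let f : A →ₚ[ℂ] ℂ := PositiveLinearMap.mk₀ (φ : A →ₗ[ℂ] ℂ) fun x hx => hφ.nonneg hx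
  have hf : ∀ x, f x = φ x := fun _ => rfl
  have h1 := norm_inner_le_norm (𝕜 := ℂ) (f.toPreGNS a) (f.toPreGNS b)
  have h2 : ∀ c, ‖f.toPreGNS c‖ ^ 2 = (φ (star c * c)).re := fun c => by
    have := f.preGNS_norm_sq (f.toPreGNS c)
    simp only [PositiveLinearMap.ofPreGNS_toPreGNS, hf] at this
    rw [hφ.eq_re (star_mul_self_nonneg c)] at this
    exact_mod_cast this
  rw [PositiveLinearMap.preGNS_inner_def] at h1
  simp only [PositiveLinearMap.ofPreGNS_toPreGNS, hf] at h1
  rw [← h2, ← h2, ← mul_pow]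
  exact pow_le_pow_left₀ (norm_nonneg _) h1 2

theorem IsPosFunctional.re_apply_le {φ : A →L[ℂ] ℂ} (hφ : IsPosFunctional φ) {a : A}
    (ha : 0 ≤ a) : (φ a).re ≤ ‖a‖ * (φ 1).re := by
  have h1 : a ≤ algebraMap ℝ A ‖a‖ := IsSelfAdjoint.le_algebraMap_norm_self (.of_nonneg ha)
  have h2 := hφ.re_mono h1
  rwa [Algebra.algebraMap_eq_smul_one, ← Complex.coe_smul, map_smul, smul_eq_mul,
    Complex.re_ofReal_mul] at h2

/-- Cauchy–Schwarz against `1` combined with `a* a ≤ ‖a‖²`. No constant is lost, which is why the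
norm of a positive element of `L¹` is exactly its trace. -/
theorem IsPosFunctional.norm_apply_le {φ : A →L[ℂ] ℂ} (hφ : IsPosFunctional φ) (a : A) :
    ‖φ a‖ ≤ (φ 1).re * ‖a‖ := by
  have h0 : 0 ≤ (φ 1).re := (Complex.nonneg_iff.mp (hφ.nonneg zero_le_one)).1
  have h1 := hφ.cauchySchwarz 1 a
  simp only [star_one, one_mul] at h1
  have h2 := hφ.re_apply_le (star_mul_self_nonneg a)
  rw [CStarRing.norm_star_mul_self] at h2
  refine abs_le_of_sq_le_sq' ?_ (by positivity) |>.2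
  nlinarith

theorem IsPosFunctional.norm_eq {φ : A →L[ℂ] ℂ} (hφ : IsPosFunctional φ) :
    ‖φ‖ = (φ 1).re := by
  have h0 : 0 ≤ (φ 1).re := (Complex.nonneg_iff.mp (hφ.nonneg zero_le_one)).1
  refine le_antisymm (φ.opNorm_le_bound h0 hφ.norm_apply_le) ?_
  rcases subsingleton_or_nontrivial A with hA | hA
  · rw [Subsingleton.elim (1 : A) 0, map_zero]
    exact norm_nonneg φ
  have := φ.le_opNorm 1
  rw [norm_one, mul_one] at this
  exact (Complex.re_le_norm _).trans this

/-- A linear map that is bounded on positive elements is bounded with four times the constant. -/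
theorem norm_le_four_mul_of_nonneg {E : Type*} [SeminormedAddCommGroup E] [NormedSpace ℂ E]
    (f : A →ₗ[ℂ] E) {C : ℝ} (hC : 0 ≤ C) (h : ∀ a, 0 ≤ a → ‖f a‖ ≤ C * ‖a‖) (a : A) :
    ‖f a‖ ≤ 4 * C * ‖a‖ := by
  obtain ⟨x, hx0, hx1, hx⟩ := CStarAlgebra.exists_sum_four_nonneg a
  conv_lhs => rw [hx]
  rw [map_sum]
  refine (norm_sum_le _ _).trans ?_
  refine (Finset.sum_le_sum (g := fun _ => C * ‖a‖) fun i _ => ?_).trans_eq ?_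
  · rw [map_smul, norm_smul, norm_pow, Complex.norm_I, one_pow, one_mul]
    exact (h _ (hx0 i)).trans (mul_le_mul_of_nonneg_left (hx1 i) hC)
  · simp [mul_assoc]

theorem ext_of_nonneg {E : Type*} [AddCommGroup E] [Module ℂ E]
    {f g : A →ₗ[ℂ] E} (h : ∀ a, 0 ≤ a → f a = g a) : f = g := by
  ext a
  obtain ⟨x, hx0, -, hx⟩ := CStarAlgebra.exists_sum_four_nonneg a
  rw [hx, map_sum, map_sum]
  exact Finset.sum_congr rfl fun i _ => by rw [map_smul, map_smul, h _ (hx0 i)]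

/-- A faithful tracial state on a C⋆-algebra. -/
structure IsFaithfulTracialState (τ : A →L[ℂ] ℂ) : Prop where
  map_one : τ 1 = 1
  pos : IsPosFunctional τ
  trace : ∀ a b, τ (a * b) = τ (b * a)
  faithful : ∀ a, τ (star a * a) = 0 → a = 0

theorem IsFaithfulTracialState.re_pos {τ : A →L[ℂ] ℂ} (hτ : IsFaithfulTracialState τ) {a : A}
    (ha : 0 ≤ a) (h : a ≠ 0) : 0 < (τ a).re := by
  refine lt_of_le_of_ne (Complex.nonneg_iff.mp (hτ.pos.nonneg ha)).1 fun h0 => h ?_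
  obtain ⟨b, rfl⟩ := CStarAlgebra.nonneg_iff_eq_star_mul_self.mp ha
  rw [hτ.faithful b, mul_zero]
  rw [hτ.pos.eq_re ha, ← h0, Complex.ofReal_zero]

/-- Traciality turns `τ(c* c b* b)` into `τ(d* d)` with `d = b c*`. This makes the embedding of `A`
into `L¹` positive. -/
theorem IsFaithfulTracialState.isPosFunctional_traceFunctional {τ : A →L[ℂ] ℂ}
    (hτ : IsFaithfulTracialState τ) {a : A} (ha : 0 ≤ a) :
    IsPosFunctional (traceFunctional τ a) := by
  intro b
  obtain ⟨c, rfl⟩ := CStarAlgebra.nonneg_iff_eq_star_mul_self.mp ha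
  have : traceFunctional τ (star c * c) (star b * b) = τ (star (b * star c) * (b * star c)) := by
    rw [traceFunctional_apply, star_mul, star_star, mul_assoc, hτ.trace]
    simp only [mul_assoc]
  rw [this]
  exact hτ.pos _

end PositiveFunctional

/-! ### The positive cone of `L¹(A, τ)` -/

namespace TraceL1

section Algebraic

variable {A : Type*} [NormedRing A] [NormedAlgebra ℂ A] {τ : A →L[ℂ] ℂ}

/-! Instance shortcuts, so that the algebraic operations are found through the norm. -/

/-- The normed group structure of `L¹(A, τ)`. -/
noncomputable def normedGroup : NormedAddCommGroup (TraceL1 τ) := Submodule.normedAddCommGroup _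

attribute [scoped instance 2000] normedGroup

noncomputable scoped instance (priority := 2000) instSeminormedAddCommGroup :
    SeminormedAddCommGroup (TraceL1 τ) := normedGroup.toSeminormedAddCommGroup

noncomputable scoped instance (priority := 2000) instAddCommGroup :
    AddCommGroup (TraceL1 τ) := normedGroup.toAddCommGroup

noncomputable scoped instance (priority := 2000) instAddCommMonoid :
    AddCommMonoid (TraceL1 τ) := normedGroup.toAddCommGroup.toAddCommMonoid

/-- The normed space structure of `L¹(A, τ)`. -/
noncomputable def normedSpace : NormedSpace ℂ (TraceL1 τ) := Submodule.normedSpace _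

attribute [scoped instance 2000] normedSpace

noncomputable scoped instance (priority := 2000) instModule :
    Module ℂ (TraceL1 τ) := normedSpace.toModule

noncomputable scoped instance (priority := 2000) instSub : Sub (TraceL1 τ) :=
  normedGroup.toAddCommGroup.toAddGroup.toSubNegMonoid.toSub

noncomputable scoped instance (priority := 2000) instAdd : Add (TraceL1 τ) :=
  normedGroup.toAddCommGroup.toAddCommMonoid.toAddMonoid.toAddSemigroup.toAdd

noncomputable scoped instance (priority := 2000) instZero : Zero (TraceL1 τ) :=
  normedGroup.toAddCommGroup.toAddCommMonoid.toAddMonoid.toZero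

noncomputable scoped instance (priority := 2000) instSMul : SMul ℂ (TraceL1 τ) :=
  normedSpace.toModule.toSMul

noncomputable scoped instance (priority := 2000) instNorm : Norm (TraceL1 τ) :=
  normedGroup.toNorm

noncomputable scoped instance (priority := 2000) instMetricSpace : MetricSpace (TraceL1 τ) :=
  normedGroup.toMetricSpace

noncomputable scoped instance (priority := 2000) instPseudoMetricSpace :
    PseudoMetricSpace (TraceL1 τ) := normedGroup.toMetricSpace.toPseudoMetricSpace

noncomputable scoped instance (priority := 2000) instUniformSpace : UniformSpace (TraceL1 τ) :=
  normedGroup.toMetricSpace.toPseudoMetricSpace.toUniformSpace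

noncomputable scoped instance (priority := 2000) instTopologicalSpace :
    TopologicalSpace (TraceL1 τ) :=
  normedGroup.toMetricSpace.toPseudoMetricSpace.toUniformSpace.toTopologicalSpace

@[simp] theorem pair_add (x y : TraceL1 τ) (a : A) : (x + y).pair a = x.pair a + y.pair a := rfl
@[simp] theorem pair_sub (x y : TraceL1 τ) (a : A) : (x - y).pair a = x.pair a - y.pair a := rfl
@[simp] theorem pair_smul (c : ℂ) (x : TraceL1 τ) (a : A) : (c • x).pair a = c * x.pair a := rfl
@[simp] theorem pair_of (a b : A) : (of τ a).pair b = τ (a * b) := rfl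
@[simp] theorem trace_zero : (0 : TraceL1 τ).trace = 0 := rfl
@[simp] theorem trace_smul (c : ℂ) (x : TraceL1 τ) : (c • x).trace = c * x.trace := rfl
@[simp] theorem trace_of (a : A) : (of τ a).trace = τ a := by simp [trace]

theorem ext_pair {x y : TraceL1 τ} (h : ∀ a, x.pair a = y.pair a) : x = y :=
  Subtype.ext (ContinuousLinearMap.ext h)

variable (τ) in
/-- The embedding of `A` into `L¹(A, τ)` as a continuous linear map. -/
noncomputable def ofCLM : A →L[ℂ] TraceL1 τ :=
  ((traceFunctional τ).codRestrict _ fun a => (of τ a).2 :)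

@[simp] theorem ofCLM_apply (a : A) : ofCLM τ a = of τ a := rfl

/-- The pairing with a fixed element of `A` as a continuous functional on `L¹(A, τ)`. -/
noncomputable def pairCLM (τ : A →L[ℂ] ℂ) (a : A) : TraceL1 τ →L[ℂ] ℂ :=
  (ContinuousLinearMap.apply ℂ ℂ a).comp (Submodule.subtypeL _)

theorem continuous_pair (a : A) : Continuous fun x : TraceL1 τ => x.pair a :=
  (pairCLM τ a).continuous

theorem continuous_trace : Continuous (trace : TraceL1 τ → ℂ) := continuous_pair 1

scoped instance instCompleteSpace : CompleteSpace (TraceL1 τ) :=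
  (Submodule.isClosed_topologicalClosure _).completeSpace_coe

/-- The real part of the trace. -/
noncomputable def tr (x : TraceL1 τ) : ℝ := x.trace.re

@[simp] theorem tr_sub (x y : TraceL1 τ) : (x - y).tr = x.tr - y.tr := rfl
@[simp] theorem tr_zero : (0 : TraceL1 τ).tr = 0 := rfl
@[simp] theorem tr_smul (c : ℝ) (x : TraceL1 τ) : ((c : ℂ) • x).tr = c * x.tr := by
  rw [tr, trace_smul, Complex.re_ofReal_mul, tr]

theorem tr_of (a : A) : (of τ a).tr = (τ a).re := by simp [tr]

end Algebraic

section StarAlgebraic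

variable {A : Type*} [NormedRing A] [NormedAlgebra ℂ A] [StarRing A] {τ : A →L[ℂ] ℂ}

theorem IsPos.zero : (0 : TraceL1 τ).IsPos := fun _ => le_rfl

theorem IsPos.add {x y : TraceL1 τ} (hx : x.IsPos) (hy : y.IsPos) : (x + y).IsPos :=
  fun b => add_nonneg (hx b) (hy b)

theorem IsPos.smul {x : TraceL1 τ} (hx : x.IsPos) {c : ℝ} (hc : 0 ≤ c) :
    ((c : ℂ) • x).IsPos :=
  fun b => mul_nonneg (by exact_mod_cast hc) (hx b)

theorem isClosed_isPos : IsClosed {x : TraceL1 τ | x.IsPos} := by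
  simp only [IsPos, Set.ofPred_forall]
  exact isClosed_iInter fun b => isClosed_le continuous_const (continuous_pair _)

theorem IsPos.eq_tr {x : TraceL1 τ} (hx : x.IsPos) : x.trace = (x.tr : ℂ) := by
  have h := hx 1
  rw [star_one, one_mul] at h
  change 0 ≤ x.trace at h
  exact Complex.ext (by simp [tr]) (by simpa using (Complex.nonneg_iff.mp h).2.symm)

theorem IsPos.tr_nonneg {x : TraceL1 τ} (hx : x.IsPos) : 0 ≤ x.tr := by
  have h := hx 1
  rw [star_one, one_mul] at h
  exact (Complex.nonneg_iff.mp h).1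

theorem mem_states_iff {x : TraceL1 τ} : x ∈ states τ ↔ x.IsPos ∧ x.tr = 1 := by
  refine and_congr_right fun h => ?_
  rw [h.eq_tr]
  norm_cast

theorem tr_of_mem {x : TraceL1 τ} (hx : x ∈ states τ) : x.tr = 1 := (mem_states_iff.mp hx).2

end StarAlgebraic

theorem IsPos.functional {A : Type*} [CStarAlgebra A] {τ : A →L[ℂ] ℂ} {x : TraceL1 τ}
    (hx : x.IsPos) : IsPosFunctional (x : StrongDual ℂ A) := hx

variable {A : Type*} [CStarAlgebra A] [PartialOrder A] [StarOrderedRing A] {τ : A →L[ℂ] ℂ}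

theorem IsPos.pair_nonneg {x : TraceL1 τ} (hx : x.IsPos) {a : A} (ha : 0 ≤ a) :
    0 ≤ x.pair a := hx.functional.nonneg ha

theorem IsPos.norm_eq {x : TraceL1 τ} (hx : x.IsPos) : ‖x‖ = x.tr := hx.functional.norm_eq

theorem IsPos.eq_zero_of_tr_eq_zero {x : TraceL1 τ} (hx : x.IsPos) (h : x.tr = 0) : x = 0 :=
  (norm_eq_zero (a := x)).mp (hx.norm_eq.trans h)

theorem IsPos.tr_pos {x : TraceL1 τ} (hx : x.IsPos) (h : x ≠ 0) : 0 < x.tr :=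
  lt_of_le_of_ne hx.tr_nonneg fun h0 => h (hx.eq_zero_of_tr_eq_zero h0.symm)

theorem IsPos.of_nonneg (hτ : IsFaithfulTracialState τ) {a : A} (ha : 0 ≤ a) : (of τ a).IsPos :=
  hτ.isPosFunctional_traceFunctional ha

theorem of_ne_zero (hτ : IsFaithfulTracialState τ) {a : A} (ha : 0 ≤ a) (h : a ≠ 0) :
    of τ a ≠ 0 := fun h0 => (hτ.re_pos ha h).ne' (by rw [← tr_of, h0, tr_zero])

theorem of_one_mem_states (hτ : IsFaithfulTracialState τ) : of τ 1 ∈ states τ :=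
  ⟨.of_nonneg hτ zero_le_one, by rw [trace_of, hτ.map_one]⟩

end TraceL1

set_option linter.unusedSectionVars false

/-! ### Hennion's metric -/

namespace TraceL1

section Metric

variable {A : Type*} [CStarAlgebra A] [PartialOrder A] [StarOrderedRing A] {τ : A →L[ℂ] ℂ}
  {x y : TraceL1 τ}

theorem norm_of_mem (hx : x ∈ states τ) : ‖x‖ = 1 := hx.1.norm_eq.trans (tr_of_mem hx)

theorem le_one_of_isPos_sub (hx : x ∈ states τ) (hy : y ∈ states τ) {t : ℝ}
    (h : (x - (t : ℂ) • y).IsPos) : t ≤ 1 := by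
  have := h.tr_nonneg
  rw [tr_sub, tr_smul, tr_of_mem hx, tr_of_mem hy] at this
  linarith

theorem bddAbove_mQuantity (hx : x ∈ states τ) (hy : y ∈ states τ) :
    BddAbove {t : ℝ | (x - (t : ℂ) • y).IsPos} :=
  ⟨1, fun _ ht => le_one_of_isPos_sub hx hy ht⟩

theorem le_mQuantity (hx : x ∈ states τ) (hy : y ∈ states τ) {t : ℝ}
    (h : (x - (t : ℂ) • y).IsPos) : t ≤ mQuantity x y :=
  le_csSup (bddAbove_mQuantity hx hy) h

theorem isPos_sub_zero_smul (hx : x ∈ states τ) : (x - ((0 : ℝ) : ℂ) • y).IsPos := by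
  simpa using hx.1

theorem mQuantity_nonneg (hx : x ∈ states τ) (hy : y ∈ states τ) : 0 ≤ mQuantity x y :=
  le_mQuantity hx hy (isPos_sub_zero_smul hx)

theorem mQuantity_le_one (hx : x ∈ states τ) (hy : y ∈ states τ) : mQuantity x y ≤ 1 :=
  csSup_le ⟨0, isPos_sub_zero_smul hx⟩ fun _ ht => le_one_of_isPos_sub hx hy ht

/-- The cone is closed, so the supremum that defines `m` is attained. -/
theorem isPos_sub_mQuantity (hx : x ∈ states τ) (hy : y ∈ states τ) :
    (x - (mQuantity x y : ℂ) • y).IsPos := by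
  have hcl : IsClosed {t : ℝ | (x - (t : ℂ) • y).IsPos} :=
    isClosed_isPos.preimage (by fun_prop)
  exact hcl.csSup_mem ⟨0, isPos_sub_zero_smul hx⟩ (bddAbove_mQuantity hx hy)

theorem mQuantity_mul_mem (hx : x ∈ states τ) (hy : y ∈ states τ) :
    mQuantity x y * mQuantity y x ∈ Icc (0 : ℝ) 1 :=
  ⟨mul_nonneg (mQuantity_nonneg hx hy) (mQuantity_nonneg hy hx),
    mul_le_one₀ (mQuantity_le_one hx hy) (mQuantity_nonneg hy hx) (mQuantity_le_one hy hx)⟩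

theorem hennionDist_nonneg (hx : x ∈ states τ) (hy : y ∈ states τ) : 0 ≤ hennionDist x y := by
  obtain ⟨h0, h1⟩ := mQuantity_mul_mem hx hy
  exact div_nonneg (by linarith) (by linarith)

theorem hennionDist_le_one (hx : x ∈ states τ) (hy : y ∈ states τ) : hennionDist x y ≤ 1 := by
  obtain ⟨h0, h1⟩ := mQuantity_mul_mem hx hy
  exact (div_le_one (by linarith)).mpr (by linarith)

theorem one_sub_div_one_add_le {p q : ℝ} (hp : 0 ≤ p) (h : p ≤ q) :
    (1 - q) / (1 + q) ≤ (1 - p) / (1 + p) := by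
  rw [div_le_div_iff₀ (by linarith) (by linarith)]
  nlinarith

theorem hennionDist_le (hx : x ∈ states τ) (hy : y ∈ states τ) {s t : ℝ} (hs : 0 ≤ s)
    (ht : 0 ≤ t) (h1 : (x - (s : ℂ) • y).IsPos) (h2 : (y - (t : ℂ) • x).IsPos) :
    hennionDist x y ≤ (1 - s * t) / (1 + s * t) :=
  one_sub_div_one_add_le (mul_nonneg hs ht)
    (mul_le_mul (le_mQuantity hx hy h1) (le_mQuantity hy hx h2) ht (mQuantity_nonneg hx hy))

theorem le_mQuantity_mul_of_hennionDist_le (hx : x ∈ states τ) (hy : y ∈ states τ) {c : ℝ}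
    (h : hennionDist x y ≤ c) (hc : -1 < c) :
    (1 - c) / (1 + c) ≤ mQuantity x y * mQuantity y x := by
  obtain ⟨h0, h1⟩ := mQuantity_mul_mem hx hy
  rw [hennionDist, div_le_iff₀ (by linarith)] at h
  rw [div_le_iff₀ (by linarith)]
  nlinarith

/-- In `x - y = (x - m y) - (1 - m) y` both terms are positive of trace `1 - m`, so the norm is at
most `2(1 - m)`. Moreover `1 - m ≤ 1 - m m' ≤ 2d`, because `1 + m m' ≤ 2`. -/
theorem norm_sub_le_hennionDist (hx : x ∈ states τ) (hy : y ∈ states τ) :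
    ‖x - y‖ ≤ 4 * hennionDist x y := by
  set m := mQuantity x y
  have hm := mQuantity_le_one hx hy
  have h1 : ‖x - (m : ℂ) • y‖ = 1 - m := by
    rw [(isPos_sub_mQuantity hx hy).norm_eq, tr_sub, tr_smul, tr_of_mem hx, tr_of_mem hy, mul_one]
  have h2 : ‖((1 - m : ℝ) : ℂ) • y‖ = 1 - m := by
    rw [norm_smul, norm_of_mem hy, Complex.norm_real, Real.norm_of_nonneg (by linarith), mul_one]
  have h3 : x - y = (x - (m : ℂ) • y) - ((1 - m : ℝ) : ℂ) • y := by
    push_cast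
    module
  have h4 : ‖x - y‖ ≤ 2 * (1 - m) := by
    rw [h3]
    refine (norm_sub_le _ _).trans ?_
    linarith
  obtain ⟨h5, h6⟩ := mQuantity_mul_mem hx hy
  have h7 : 1 - mQuantity x y * mQuantity y x ≤ 2 * hennionDist x y := by
    rw [hennionDist, ← mul_div_assoc, le_div_iff₀ (by linarith)]
    nlinarith
  have h8 : mQuantity x y * mQuantity y x ≤ m :=
    mul_le_of_le_one_right (mQuantity_nonneg hx hy) (mQuantity_le_one hy hx)
  linarith

theorem hennionDist_self (hx : x ∈ states τ) : hennionDist x x = 0 := by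
  refine le_antisymm ?_ (hennionDist_nonneg hx hx)
  refine (hennionDist_le hx hx zero_le_one zero_le_one ?_ ?_).trans_eq (by norm_num) <;>
  simpa using IsPos.zero

theorem eq_of_hennionDist_le_zero (hx : x ∈ states τ) (hy : y ∈ states τ)
    (h : hennionDist x y ≤ 0) : x = y := by
  have := norm_sub_le_hennionDist hx hy
  exact sub_eq_zero.mp ((norm_eq_zero (a := x - y)).mp
    (le_antisymm (by linarith) (norm_nonneg _)))

theorem hennionDist_pos (hx : x ∈ states τ) (hy : y ∈ states τ) (h : x ≠ y) :
    0 < hennionDist x y :=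
  not_le.mp fun h' => h (eq_of_hennionDist_le_zero hx hy h')

theorem mQuantity_lt_one (hx : x ∈ states τ) (hy : y ∈ states τ) (h : x ≠ y) :
    mQuantity x y < 1 := by
  refine lt_of_le_of_ne (mQuantity_le_one hx hy) fun h1 => h ?_
  have h2 := isPos_sub_mQuantity hx hy
  rw [h1, Complex.ofReal_one, one_smul] at h2
  exact sub_eq_zero.mp (h2.eq_zero_of_tr_eq_zero
    (by rw [tr_sub, tr_of_mem hx, tr_of_mem hy, sub_self]))

/-- The normalisation of a nonzero positive element. -/
theorem normalize_mem_states (hx : x.IsPos) (h : x ≠ 0) : ((x.tr⁻¹ : ℝ) : ℂ) • x ∈ states τ :=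
  mem_states_iff.mpr ⟨hx.smul (inv_nonneg.mpr hx.tr_nonneg),
    by rw [tr_smul, inv_mul_cancel₀ (hx.tr_pos h).ne']⟩

theorem ne_zero_of_mem (hx : x ∈ states τ) : x ≠ 0 := fun h => by
  have := tr_of_mem hx
  rw [h, tr_zero] at this
  exact zero_ne_one this

/-- The metric is projective: normalisation multiplies `s` and `t` by reciprocal factors and keeps
the product `s t`. -/
theorem hennionDist_normalize_le (hx : x.IsPos) (hy : y.IsPos) (hx0 : x ≠ 0) (hy0 : y ≠ 0)
    {s t : ℝ} (hs : 0 ≤ s) (ht : 0 ≤ t) (h1 : (x - (s : ℂ) • y).IsPos)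
    (h2 : (y - (t : ℂ) • x).IsPos) :
    hennionDist (((x.tr⁻¹ : ℝ) : ℂ) • x) (((y.tr⁻¹ : ℝ) : ℂ) • y)
      ≤ (1 - s * t) / (1 + s * t) := by
  have hx1 := hx.tr_pos hx0
  have hy1 := hy.tr_pos hy0
  have hxc : (x.tr : ℂ) ≠ 0 := by exact_mod_cast hx1.ne'
  have hyc : (y.tr : ℂ) ≠ 0 := by exact_mod_cast hy1.ne'
  have key := hennionDist_le (normalize_mem_states hx hx0) (normalize_mem_states hy hy0)
    (s := s * y.tr / x.tr) (t := t * x.tr / y.tr) (by positivity) (by positivity) ?_ ?_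
  · rwa [show s * y.tr / x.tr * (t * x.tr / y.tr) = s * t by field_simp] at key
  · convert h1.smul (inv_nonneg.mpr hx1.le) using 1
    push_cast
    match_scalars <;> field_simp
  · convert h2.smul (inv_nonneg.mpr hy1.le) using 1
    push_cast
    match_scalars <;> field_simp

theorem isPos_sub_of_normalize (hx : x.IsPos) (hy : y.IsPos) (hx0 : x ≠ 0) (hy0 : y ≠ 0) {p : ℝ}
    (h : (((x.tr⁻¹ : ℝ) : ℂ) • x - (p : ℂ) • ((y.tr⁻¹ : ℝ) : ℂ) • y).IsPos) :
    (x - ((p * x.tr / y.tr : ℝ) : ℂ) • y).IsPos := by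
  have hx1 := hx.tr_pos hx0
  have hxc : (x.tr : ℂ) ≠ 0 := by exact_mod_cast hx1.ne'
  have hyc : (y.tr : ℂ) ≠ 0 := by exact_mod_cast (hy.tr_pos hy0).ne'
  convert h.smul hx1.le using 1
  push_cast
  match_scalars <;> field_simp

end Metric

/-! ### The contraction constant -/

/-- Linear, positive and faithful maps. -/
structure FaithfulPositive {A : Type*} [NormedRing A] [NormedAlgebra ℂ A] [StarRing A]
    {τ : A →L[ℂ] ℂ} (g : TraceL1 τ → TraceL1 τ) : Prop where
  linear : IsLinearMap ℂ g
  positive : PositiveMap g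
  faithful : FaithfulMap g

/-- For `a`, `b` the images of `x - m y` and `y - m' x`, the vectors `w(a + m b)` and `w(b + m' a)`
are the images of `x` and `y`. The coefficient `(r + m) / (1 + r m')` is the one that leaves a
multiple of `a - r b`, whose positivity is known. -/
theorem hennion_identity {E : Type*} [AddCommGroup E] [Module ℂ E] (a b : E) {m m' r w i : ℂ}
    (hw : w * (1 - m * m') = 1) (hi : i * (1 + r * m') = 1) :
    w • (a + m • b) - ((r + m) * i) • w • (b + m' • a) = i • (a - r • b) := by
  match_scalars
  · linear_combination i * hw - w * hi
  · linear_combination -r * i * hw - w * m * hi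

/-- The left side equals `(1 - rs)(1 - mm')` over `(1 + rs)(1 + mm') + 2(rm' + sm)`. Dropping the
nonnegative last summand leaves a product of two quotients, the first of which is at most `D`. -/
theorem hennion_inequality {D m m' r s : ℝ} (hD : 0 ≤ D) (hm : 0 ≤ m) (hm' : 0 ≤ m')
    (hr : 0 ≤ r) (hs : 0 ≤ s) (hmm : m * m' ≤ 1) (h : (1 - D) / (1 + D) ≤ r * s) :
    (1 - (r + m) / (1 + r * m') * ((s + m') / (1 + s * m)))
      / (1 + (r + m) / (1 + r * m') * ((s + m') / (1 + s * m)))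
      ≤ D * ((1 - m * m') / (1 + m * m')) := by
  have h0 : 1 - r * s ≤ D * (1 + r * s) := by
    rw [div_le_iff₀ (by linarith)] at h
    linarith
  have h1 : (1 - (r + m) / (1 + r * m') * ((s + m') / (1 + s * m)))
      / (1 + (r + m) / (1 + r * m') * ((s + m') / (1 + s * m)))
      = ((1 - r * s) * (1 - m * m')) /
        ((1 + r * s) * (1 + m * m') + 2 * (r * m' + s * m)) := by
    rw [div_eq_div_iff (by positivity) (by positivity)]
    field_simp
    ring
  rw [h1, ← mul_div_assoc, div_le_div_iff₀ (by positivity) (by positivity)]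
  have h2 : 0 ≤ m * m' := by positivity
  have h3 : 0 ≤ r * m' + s * m := by positivity
  have h4 : 0 ≤ (1 - m * m') * (1 + m * m') := mul_nonneg (by linarith) (by linarith)
  calc (1 - r * s) * (1 - m * m') * (1 + m * m')
      = (1 - r * s) * ((1 - m * m') * (1 + m * m')) := by ring
    _ ≤ D * (1 + r * s) * ((1 - m * m') * (1 + m * m')) := mul_le_mul_of_nonneg_right h0 h4
    _ = D * (1 - m * m') * ((1 + r * s) * (1 + m * m')) := by ring
    _ ≤ _ := mul_le_mul_of_nonneg_left (by linarith) (mul_nonneg hD (by linarith))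

section Contraction

variable {A : Type*} [CStarAlgebra A] [PartialOrder A] [StarOrderedRing A] {τ : A →L[ℂ] ℂ}
  {g h : TraceL1 τ → TraceL1 τ} {x y : TraceL1 τ}

theorem FaithfulPositive.comp (hg : FaithfulPositive g) (hh : FaithfulPositive h) :
    FaithfulPositive (g ∘ h) where
  linear := (hg.linear.mk'.comp hh.linear.mk').isLinear
  positive x hx := hg.positive _ (hh.positive x hx)
  faithful x hx h0 := hh.faithful x hx (hg.faithful _ (hh.positive x hx) h0)

theorem projAction_def (g : TraceL1 τ → TraceL1 τ) (x : TraceL1 τ) :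
    projAction g x = (g x).trace⁻¹ • g x := rfl

theorem projAction_eq (hg : FaithfulPositive g) (hx : x.IsPos) :
    projAction g x = (((g x).tr⁻¹ : ℝ) : ℂ) • g x := by
  rw [projAction_def, (hg.positive x hx).eq_tr, Complex.ofReal_inv]

theorem FaithfulPositive.ne_zero (hg : FaithfulPositive g) (hx : x ∈ states τ) : g x ≠ 0 :=
  fun h0 => ne_zero_of_mem hx (hg.faithful x hx.1 h0)

theorem projAction_mem_states (hg : FaithfulPositive g) (hx : x ∈ states τ) :
    projAction g x ∈ states τ := by
  rw [projAction_eq hg hx.1]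
  exact normalize_mem_states (hg.positive x hx.1) (hg.ne_zero hx)

theorem projAction_smul (hg : FaithfulPositive g) {c : ℝ} (hc : c ≠ 0) :
    projAction g ((c : ℂ) • x) = projAction g x := by
  have hc' : (c : ℂ) ≠ 0 := by exact_mod_cast hc
  rw [projAction_def, projAction_def, hg.linear.map_smul, trace_smul, smul_smul, mul_inv]
  congr 1
  field_simp

theorem projAction_comp (hg : FaithfulPositive g) (hh : FaithfulPositive h) (hx : x ∈ states τ) :
    projAction (g ∘ h) x = projAction g (projAction h x) := by
  have h1 := (hh.positive x hx.1).tr_pos (hh.ne_zero hx)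
  rw [projAction_eq hh hx.1, projAction_smul hg (inv_ne_zero h1.ne')]
  rfl

/-- If the image of `g` has Hennion diameter at most `D`, then `g` contracts by the factor `D`. -/
theorem hennionDist_projAction_le (hg : FaithfulPositive g) {D : ℝ}
    (hD : ∀ u ∈ states τ, ∀ v ∈ states τ, hennionDist (projAction g u) (projAction g v) ≤ D)
    (hx : x ∈ states τ) (hy : y ∈ states τ) :
    hennionDist (projAction g x) (projAction g y) ≤ D * hennionDist x y := by
  by_cases hxy : x = y
  · rw [hxy, hennionDist_self hy, hennionDist_self (projAction_mem_states hg hy), mul_zero]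
  have hD0 : 0 ≤ D := (hennionDist_nonneg (projAction_mem_states hg hx)
    (projAction_mem_states hg hx)).trans (hD x hx x hx)
  set m := mQuantity x y with hm
  set m' := mQuantity y x with hm'
  have hm0 : 0 ≤ m := mQuantity_nonneg hx hy
  have hm0' : 0 ≤ m' := mQuantity_nonneg hy hx
  have hm1 : m < 1 := mQuantity_lt_one hx hy hxy
  have hm1' : m' < 1 := mQuantity_lt_one hy hx (Ne.symm hxy)
  have hmm : m * m' < 1 := by nlinarith
  -- As `x ≠ y`, both differences are nonzero and positive, and they recover the states: `(1 - m m')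
  -- x = a + m b` and `(1 - m m') y = b + m' a`.
  set a := x - (m : ℂ) • y with ha
  set b := y - (m' : ℂ) • x with hb
  have hap : a.IsPos := isPos_sub_mQuantity hx hy
  have hbp : b.IsPos := isPos_sub_mQuantity hy hx
  have hat : a.tr = 1 - m := by rw [ha, tr_sub, tr_smul, tr_of_mem hx, tr_of_mem hy, mul_one]
  have hbt : b.tr = 1 - m' := by rw [hb, tr_sub, tr_smul, tr_of_mem hx, tr_of_mem hy, mul_one]
  have ha0 : a ≠ 0 := fun h0 => by rw [h0, tr_zero] at hat; linarith
  have hb0 : b ≠ 0 := fun h0 => by rw [h0, tr_zero] at hbt; linarith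
  have hgap := hg.positive a hap
  have hgbp := hg.positive b hbp
  have hga0 : g a ≠ 0 := fun h0 => ha0 (hg.faithful a hap h0)
  have hgb0 : g b ≠ 0 := fun h0 => hb0 (hg.faithful b hbp h0)
  have hga1 := hgap.tr_pos hga0
  have hgb1 := hgbp.tr_pos hgb0
  -- the images of `a` and `b`
  have hua : projAction g ((((1 - m)⁻¹ : ℝ) : ℂ) • a) = projAction g a :=
    projAction_smul hg (inv_ne_zero (by linarith))
  have hub : projAction g ((((1 - m')⁻¹ : ℝ) : ℂ) • b) = projAction g b :=
    projAction_smul hg (inv_ne_zero (by linarith))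
  -- The diameter bound is used for the directions of `a` and `b`, not for those of `x` and `y`.
  have hdab := hD _ (hat ▸ normalize_mem_states hap ha0) _ (hbt ▸ normalize_mem_states hbp hb0)
  rw [hua, hub] at hdab
  have hUa : projAction g a ∈ states τ := by
    rw [projAction_eq hg hap]; exact normalize_mem_states hgap hga0
  have hUb : projAction g b ∈ states τ := by
    rw [projAction_eq hg hbp]; exact normalize_mem_states hgbp hgb0
  have hpq := le_mQuantity_mul_of_hennionDist_le hUa hUb hdab (by linarith)
  set p := mQuantity (projAction g a) (projAction g b) with hp
  set q := mQuantity (projAction g b) (projAction g a) with hq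
  have hp0 : 0 ≤ p := mQuantity_nonneg hUa hUb
  have hq0 : 0 ≤ q := mQuantity_nonneg hUb hUa
  have hpp := isPos_sub_mQuantity hUa hUb
  have hqp := isPos_sub_mQuantity hUb hUa
  rw [← hp, projAction_eq hg hap, projAction_eq hg hbp] at hpp
  rw [← hq, projAction_eq hg hap, projAction_eq hg hbp] at hqp
  have hr := isPos_sub_of_normalize hgap hgbp hga0 hgb0 hpp
  have hs := isPos_sub_of_normalize hgbp hgap hgb0 hga0 hqp
  -- `r` and `s` compare `g a` and `g b` before normalisation; the trace factors cancel in `r s = p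
  -- q`.
  set r := p * (g a).tr / (g b).tr with hr'
  set s := q * (g b).tr / (g a).tr with hs'
  have hr0 : 0 ≤ r := by positivity
  have hs0 : 0 ≤ s := by positivity
  have hrs : r * s = p * q := by rw [hr', hs']; field_simp
  rw [← hrs] at hpq
  have hgx : (((1 - m * m' : ℝ)) : ℂ) • g x = g a + (m : ℂ) • g b := by
    rw [← hg.linear.map_smul, ← hg.linear.map_smul, ← hg.linear.map_add, ha, hb]
    congr 1
    push_cast
    module
  have hgy : (((1 - m * m' : ℝ)) : ℂ) • g y = g b + (m' : ℂ) • g a := by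
    rw [← hg.linear.map_smul, ← hg.linear.map_smul, ← hg.linear.map_add, ha, hb]
    congr 1
    push_cast
    module
  have hw : ((1 - m * m' : ℝ) : ℂ) ≠ 0 := by
    have : (1 - m * m' : ℝ) ≠ 0 := by linarith
    exact_mod_cast this
  have hd1 : (1 + r * m' : ℝ) ≠ 0 := by positivity
  have hd2 : (1 + s * m : ℝ) ≠ 0 := by positivity
  have hd1' : (1 + r * m' : ℂ) ≠ 0 := by exact_mod_cast hd1
  have hd2' : (1 + s * m : ℂ) ≠ 0 := by exact_mod_cast hd2
  have hX : g x = (((1 - m * m')⁻¹ : ℝ) : ℂ) • (g a + (m : ℂ) • g b) := by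
    rw [← hgx, smul_smul, Complex.ofReal_inv, inv_mul_cancel₀ hw, one_smul]
  have hY : g y = (((1 - m * m')⁻¹ : ℝ) : ℂ) • (g b + (m' : ℂ) • g a) := by
    rw [← hgy, smul_smul, Complex.ofReal_inv, inv_mul_cancel₀ hw, one_smul]
  have hw' : (1 - m * m' : ℂ) ≠ 0 := by exact_mod_cast hw
  have e1 : (g x - (((r + m) / (1 + r * m') : ℝ) : ℂ) • g y).IsPos := by
    convert hr.smul (c := (1 + r * m')⁻¹) (by positivity) using 1
    rw [hX, hY]
    push_cast
    rw [div_eq_mul_inv]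
    exact hennion_identity _ _ (inv_mul_cancel₀ hw') (inv_mul_cancel₀ hd1')
  have e2 : (g y - (((s + m') / (1 + s * m) : ℝ) : ℂ) • g x).IsPos := by
    convert hs.smul (c := (1 + s * m)⁻¹) (by positivity) using 1
    rw [hX, hY]
    push_cast
    rw [mul_comm (m : ℂ) m', div_eq_mul_inv]
    exact hennion_identity _ _ (inv_mul_cancel₀ (by rwa [mul_comm])) (inv_mul_cancel₀ hd2')
  rw [projAction_eq hg hx.1, projAction_eq hg hy.1]
  refine (hennionDist_normalize_le (hg.positive x hx.1) (hg.positive y hy.1) (hg.ne_zero hx)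
    (hg.ne_zero hy) (by positivity) (by positivity) e1 e2).trans ?_
  rw [hennionDist]
  exact hennion_inequality hD0 hm0 hm0' hr0 hs0 hmm.le hpq

/-- Since `d ≤ 1`, the diameter bound holds with `D = 1`. So no faithful positive map expands `d`,
and the `sSup` that defines `c` is not the default value of an unbounded set. -/
theorem bddAbove_contractionConst (hg : FaithfulPositive g) :
    1 ∈ upperBounds {r | ∃ x ∈ states τ, ∃ y ∈ states τ, x ≠ y ∧
    r = hennionDist (projAction g x) (projAction g y) / hennionDist x y} := by
  rintro _ ⟨x, hx, y, hy, hxy, rfl⟩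
  rw [div_le_one (hennionDist_pos hx hy hxy)]
  refine (hennionDist_projAction_le hg (fun u hu v hv => ?_) hx hy).trans_eq (one_mul _)
  exact hennionDist_le_one (projAction_mem_states hg hu) (projAction_mem_states hg hv)

theorem contractionConst_nonneg (hg : FaithfulPositive g) : 0 ≤ contractionConst g := by
  refine Real.sSup_nonneg ?_
  rintro _ ⟨x, hx, y, hy, hxy, rfl⟩
  exact div_nonneg (hennionDist_nonneg (projAction_mem_states hg hx) (projAction_mem_states hg hy))
    (hennionDist_nonneg hx hy)

theorem contractionConst_le_one (hg : FaithfulPositive g) : contractionConst g ≤ 1 :=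
  Real.sSup_le (bddAbove_contractionConst hg) zero_le_one

theorem hennionDist_le_contractionConst_mul (hg : FaithfulPositive g) (hx : x ∈ states τ)
    (hy : y ∈ states τ) : hennionDist (projAction g x) (projAction g y)
      ≤ contractionConst g * hennionDist x y := by
  by_cases hxy : x = y
  · rw [hxy, hennionDist_self hy, hennionDist_self (projAction_mem_states hg hy), mul_zero]
  · rw [← div_le_iff₀ (hennionDist_pos hx hy hxy)]
    exact le_csSup ⟨1, bddAbove_contractionConst hg⟩ ⟨x, hx, y, hy, hxy, rfl⟩

theorem hennionDist_le_contractionConst (hg : FaithfulPositive g) (hx : x ∈ states τ)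
    (hy : y ∈ states τ) : hennionDist (projAction g x) (projAction g y) ≤ contractionConst g :=
  (hennionDist_le_contractionConst_mul hg hx hy).trans
    (mul_le_of_le_one_right (contractionConst_nonneg hg) (hennionDist_le_one hx hy))

theorem contractionConst_comp_le (hg : FaithfulPositive g) (hh : FaithfulPositive h) :
    contractionConst (g ∘ h) ≤ contractionConst g * contractionConst h := by
  refine Real.sSup_le ?_ (mul_nonneg (contractionConst_nonneg hg) (contractionConst_nonneg hh))
  rintro _ ⟨x, hx, y, hy, hxy, rfl⟩
  rw [div_le_iff₀ (hennionDist_pos hx hy hxy), projAction_comp hg hh hx, projAction_comp hg hh hy,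
    mul_assoc]
  exact (hennionDist_le_contractionConst_mul hg (projAction_mem_states hh hx)
    (projAction_mem_states hh hy)).trans (mul_le_mul_of_nonneg_left
      (hennionDist_le_contractionConst_mul hh hx hy) (contractionConst_nonneg hg))

/-- The contraction constant is the Hennion diameter of the image. -/
theorem contractionConst_le_iff (hg : FaithfulPositive g) {D : ℝ} (hD0 : 0 ≤ D) :
    contractionConst g ≤ D ↔ ∀ x ∈ states τ, ∀ y ∈ states τ,
      hennionDist (projAction g x) (projAction g y) ≤ D := by
  refine ⟨fun h x hx y hy => (hennionDist_le_contractionConst hg hx hy).trans h, fun h => ?_⟩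
  refine Real.sSup_le ?_ hD0
  rintro _ ⟨x, hx, y, hy, hxy, rfl⟩
  rw [div_le_iff₀ (hennionDist_pos hx hy hxy)]
  exact hennionDist_projAction_le hg h hx hy

theorem norm_projAction_sub_le (hg : FaithfulPositive g) (hx : x ∈ states τ)
    (hy : y ∈ states τ) : ‖projAction g x - projAction g y‖ ≤ 4 * contractionConst g :=
  (norm_sub_le_hennionDist (projAction_mem_states hg hx) (projAction_mem_states hg hy)).trans
    (mul_le_mul_of_nonneg_left (hennionDist_le_contractionConst hg hx hy) (by norm_num))

end Contraction

end TraceL1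

/-! ### Functionals dominated by a trace -/

section Clamp

variable {A : Type*} [CStarAlgebra A] [PartialOrder A] [StarOrderedRing A]

/-- A self-adjoint element is cut off at the levels `0` and `t`. -/
theorem exists_clamp (a : A) (ha : IsSelfAdjoint a) {t : ℝ} (ht : 0 ≤ t) :
    ∃ e u v : A, 0 ≤ e ∧ e ≤ algebraMap ℝ A t ∧ 0 ≤ u ∧ 0 ≤ v ∧ a = e + (u - v) ∧
      e * u = t • u ∧ u * e = t • u ∧ e * v = 0 ∧ v * e = 0 := by
  have hmul : ∀ f g : ℝ → ℝ, Continuous f → Continuous g →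
      cfc f a * cfc g a = cfc (fun s => f s * g s) a :=
    fun f g hf hg => (cfc_mul f g a hf.continuousOn hg.continuousOn).symm
  have he : Continuous fun s : ℝ => max 0 (min s t) := by fun_prop
  have hu : Continuous fun s : ℝ => max (s - t) 0 := by fun_prop
  have hv : Continuous fun s : ℝ => max (-s) 0 := by fun_prop
  have h1 : ∀ s : ℝ, max 0 (min s t) * max (s - t) 0 = t * max (s - t) 0 := fun s => by
    rcases le_total s t with h | h
    · rw [max_eq_right (by linarith : s - t ≤ 0), mul_zero, mul_zero]
    · rw [min_eq_right h, max_eq_right ht]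
  have h2 : ∀ s : ℝ, max 0 (min s t) * max (-s) 0 = 0 := fun s => by
    rcases le_total s 0 with h | h
    · rw [min_eq_left (by linarith), max_eq_left h, zero_mul]
    · rw [max_eq_right (by linarith : -s ≤ 0), mul_zero]
  -- `e` is the truncation of `a`, `u` the excess above `t` and `v` the negative part; `e` takes the
  -- value `t` where `u` lives and `0` where `v` lives.
  refine ⟨cfc (fun s : ℝ => max 0 (min s t)) a, cfc (fun s : ℝ => max (s - t) 0) a,
    cfc (fun s : ℝ => max (-s) 0) a, cfc_nonneg fun s _ => le_max_left _ _, ?_,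
    cfc_nonneg fun s _ => le_max_right _ _, cfc_nonneg fun s _ => le_max_right _ _, ?_, ?_, ?_, ?_,
    ?_⟩
  · exact cfc_le_algebraMap _ t a fun s _ => max_le ht (min_le_right _ _)
  · rw [← cfc_sub _ _ a hu.continuousOn hv.continuousOn,
      ← cfc_add _ _ _ he.continuousOn (by fun_prop)]
    conv_lhs => rw [← cfc_id ℝ a]
    refine cfc_congr fun s _ => ?_
    simp only [id]
    rcases le_total s 0 with h | h
    · rw [min_eq_left (by linarith), max_eq_left h, max_eq_right (by linarith),
        max_eq_left (by linarith)]
      ring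
    · rcases le_total s t with h' | h'
      · rw [min_eq_left h', max_eq_right h, max_eq_right (by linarith), max_eq_right (by linarith)]
        ring
      · rw [min_eq_right h', max_eq_right ht, max_eq_left (by linarith),
          max_eq_right (by linarith)]
        ring
  · rw [hmul _ _ he hu, ← cfc_smul t _ a hu.continuousOn]
    exact cfc_congr fun s _ => h1 s
  · rw [hmul _ _ hu he, ← cfc_smul t _ a hu.continuousOn]
    exact cfc_congr fun s _ => (mul_comm _ _).trans (h1 s)
  · rw [hmul _ _ he hv, ← cfc_zero ℝ a]
    exact cfc_congr fun s _ => h2 s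
  · rw [hmul _ _ hv he, ← cfc_zero ℝ a]
    exact cfc_congr fun s _ => (mul_comm _ _).trans (h2 s)

/-- A functional `0 ≤ φ ≤ t τ` is a limit of functionals `τ(a ·)` with `0 ≤ a ≤ t`. -/
theorem exists_seq_tendsto_of_le_trace {τ φ : A →L[ℂ] ℂ} (hτ : IsFaithfulTracialState τ)
    (hφ : IsPosFunctional φ) {t : ℝ} (ht : 0 ≤ t)
    (hle : ∀ b, 0 ≤ b → (φ b).re ≤ t * (τ b).re) :
    ∃ a : ℕ → A, (∀ n, 0 ≤ a n ∧ a n ≤ algebraMap ℝ A t) ∧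
      ∀ c, 0 ≤ c → Tendsto (fun n => τ (a n * c)) atTop (𝓝 (φ c)) := by
  -- Up to a constant, `Q a` would be the squared `L²` distance from `a` to the sought density.
  set Q : A → ℝ := fun a => (τ (a * a)).re - 2 * (φ a).re with hQ
  set K : Set A := {a | 0 ≤ a ∧ a ≤ algebraMap ℝ A t} with hK
  have hsq : ∀ a : A, IsSelfAdjoint a → 0 ≤ (τ (a * a)).re := fun a ha => by
    have := (Complex.nonneg_iff.mp (hτ.pos a)).1
    rwa [ha.star_eq] at this
  have hbdd : BddBelow (Q '' K) := by
    refine ⟨-2 * (φ (algebraMap ℝ A t)).re, ?_⟩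
    rintro _ ⟨a, ⟨ha0, ha1⟩, rfl⟩
    have h1 := hφ.re_mono ha1
    have h2 := hsq a (.of_nonneg ha0)
    simp only [hQ]
    linarith
  have hne : (Q '' K).Nonempty := ⟨_, 0, ⟨le_rfl, algebraMap_nonneg A ht⟩, rfl⟩
  set q := sInf (Q '' K) with hq
  -- Clamping to `[0, t]` does not increase `Q`: the difference is `2(t τ(u) - φ(u)) + 2φ(v) + τ((u
  -- - v)²) ≥ 0`. Hence the infimum over `K` is a lower bound on all self-adjoint elements.
  have hge : ∀ a : A, IsSelfAdjoint a → q ≤ Q a := by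
    intro a ha
    obtain ⟨e, u, v, he0, he1, hu0, hv0, rfl, heu, hue, hev, hve⟩ := exists_clamp a ha ht
    refine (csInf_le hbdd ⟨e, ⟨he0, he1⟩, rfl⟩).trans ?_
    have h1 : (e + (u - v)) * (e + (u - v)) = e * e + (t • u + t • u) + (u - v) * (u - v) := by
      have : (e + (u - v)) * (e + (u - v))
        = e * e + (e * u - e * v + (u * e - v * e)) + (u - v) * (u - v) := by noncomm_ring
      rw [this, heu, hue, hev, hve]
      simp
    have h2 := hsq (u - v) ((IsSelfAdjoint.of_nonneg hu0).sub (.of_nonneg hv0))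
    have h3 := hle u hu0
    have h4 := (Complex.nonneg_iff.mp (hφ.nonneg hv0)).1
    have h5 : (τ (t • u)).re = t * (τ u).re := by
      rw [← Complex.coe_smul, map_smul, smul_eq_mul, Complex.re_ofReal_mul]
    simp only [hQ, h1, map_add, map_sub, Complex.add_re, Complex.sub_re, h5]
    linarith [map_sub τ u v]
  have hex : ∀ n : ℕ, ∃ a ∈ K, Q a < q + 1 / (n + 1) := fun n => by
    obtain ⟨_, ⟨a, ha, rfl⟩, h⟩ := exists_lt_of_csInf_lt hne
      (show sInf (Q '' K) < q + 1 / (n + 1) by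
        have : (0 : ℝ) < 1 / (n + 1) := by positivity
        linarith)
    exact ⟨a, ha, h⟩
  choose a haK haQ using hex
  refine ⟨a, haK, fun c hc => ?_⟩
  have hcs : IsSelfAdjoint c := .of_nonneg hc
  set δ : ℕ → ℝ := fun n => (τ (a n * c)).re - (φ c).re with hδ
  -- First variation: `Q(a n + s c) ≥ q` for all real `s` is a nonnegative quadratic in `s`, and its
  -- discriminant bounds `δ n`.
  have hquad : ∀ n, δ n ^ 2 ≤ (τ (c * c)).re * (1 / (n + 1)) := by
    intro n
    have h1 : ∀ s : ℝ, 0 ≤ (τ (c * c)).re * (s * s) + 2 * δ n * s + 1 / (n + 1) := fun s => by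
      have h2 := hge (a n + (s : ℂ) • c)
        ((IsSelfAdjoint.of_nonneg (haK n).1).add (IsSelfAdjoint.smul (Complex.conj_ofReal s) hcs))
      have h3 : (a n + (s : ℂ) • c) * (a n + (s : ℂ) • c)
          = a n * a n + (s : ℂ) • (a n * c + c * a n) + ((s * s : ℝ) : ℂ) • (c * c) := by
        rw [add_mul, mul_add, mul_add, mul_smul_comm, smul_mul_assoc, smul_mul_smul_comm, smul_add,
          Complex.ofReal_mul]
        abel
      have h4 := haQ n
      have h5 : ∀ (r : ℝ) (ψ : A →L[ℂ] ℂ) (b : A), (ψ ((r : ℂ) • b)).re = r * (ψ b).re :=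
        fun r ψ b => by rw [map_smul, smul_eq_mul, Complex.re_ofReal_mul]
      simp only [hQ, h3, map_add, Complex.add_re, h5, hτ.trace c (a n)] at h2 h4
      simp only [hδ]
      linarith
    have := discrim_le_zero (K := ℝ) h1
    rw [discrim] at this
    linarith
  have hδ0 : Tendsto δ atTop (𝓝 0) := by
    have h1 : Tendsto (fun n : ℕ => (τ (c * c)).re * (1 / ((n : ℝ) + 1))) atTop (𝓝 0) := by
      simpa using tendsto_one_div_add_atTop_nhds_zero_nat.const_mul (τ (c * c)).re
    have h2 := squeeze_zero (fun n => sq_nonneg (δ n)) hquad h1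
    have h3 := (Real.continuous_sqrt.tendsto 0).comp h2
    rw [Real.sqrt_zero] at h3
    exact tendsto_zero_iff_abs_tendsto_zero _ |>.mpr (h3.congr fun n => Real.sqrt_sq_eq_abs _)
  have hre : Tendsto (fun n => ((τ (a n * c)).re : ℂ)) atTop (𝓝 ((φ c).re : ℂ)) := by
    refine (Complex.continuous_ofReal.tendsto _).comp ?_
    simpa [hδ] using hδ0.add_const (φ c).re
  rw [hφ.eq_re hc]
  refine hre.congr fun n => ?_
  exact ((hτ.isPosFunctional_traceFunctional (haK n).1).eq_re hc).symm

end Clamp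

set_option linter.unusedSectionVars false

/-! ### Weak limits and suprema in von Neumann algebras -/

/-- The spectrum is the same in the closed subalgebra as in `A`, so the functional calculus of the
subalgebra already provides the square root. -/
theorem StarSubalgebra.exists_isSelfAdjoint_mul_self {A : Type*} [CStarAlgebra A] [PartialOrder A]
    [StarOrderedRing A] (S : StarSubalgebra ℂ A) (hS : IsClosed (S : Set A)) {x : S}
    (hx : 0 ≤ (x : A)) : ∃ b : S, IsSelfAdjoint b ∧ x = b * b := by
  let _ : CStarAlgebra S := StarSubalgebra.cstarAlgebra S (h_closed := hS)
  have hsa : IsSelfAdjoint x := Subtype.ext (IsSelfAdjoint.of_nonneg hx).star_eq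
  have h1 : SpectrumRestricts x ContinuousMap.realToNNReal := by
    refine SpectrumRestricts.nnreal_iff.mpr fun r hr => ?_
    have h2 : (r : ℂ) ∈ spectrum ℂ x := by
      rw [spectrum.mem_iff] at hr ⊢
      exact hr
    rw [StarSubalgebra.spectrum_eq (hS := hS)] at h2
    exact_mod_cast spectrum_nonneg_of_nonneg hx h2
  obtain ⟨b, hb, -, h3⟩ := CFC.exists_sqrt_of_isSelfAdjoint_of_quasispectrumRestricts hsa
    (quasispectrumRestricts_iff_spectrumRestricts.mpr h1)
  exact ⟨b, hb, h3.symm⟩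

namespace VonNeumannAlgebra

variable {H : Type*} [NormedAddCommGroup H] [InnerProductSpace ℂ H] [CompleteSpace H]

local notation "⟪" x ", " y "⟫" => inner ℂ x y

theorem isClosed_coe (M : VonNeumannAlgebra H) :
    IsClosed (M.toStarSubalgebra : Set (H →L[ℂ] H)) := by
  have h1 := Set.isClosed_centralizer (Set.centralizer (M : Set (H →L[ℂ] H)))
  rwa [M.centralizer_centralizer] at h1

/-- A von Neumann algebra is a C⋆-algebra. -/
noncomputable abbrev toCStarAlgebra (M : VonNeumannAlgebra H) :
    CStarAlgebra M.toStarSubalgebra :=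
  StarSubalgebra.cstarAlgebra M.toStarSubalgebra (h_closed := M.isClosed_coe)

attribute [local instance] toCStarAlgebra

/-- Over `ℂ` the condition includes that `⟪x, T x⟫` is real, which already makes `T` self-adjoint.
-/
theorem operator_nonneg_iff {T : H →L[ℂ] H} : 0 ≤ T ↔ ∀ x, 0 ≤ ⟪x, T x⟫ := by
  rw [ContinuousLinearMap.nonneg_iff_isPositive]
  refine ⟨fun h x => h.inner_nonneg_right x, fun h => ?_⟩
  rw [ContinuousLinearMap.isPositive_iff_complex]
  intro x
  have h1 : ⟪T x, x⟫ = ⟪x, T x⟫ := by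
    rw [← inner_conj_symm]
    exact Complex.conj_eq_iff_im.mpr (Complex.nonneg_iff.mp (h x)).2.symm
  rw [h1]
  obtain ⟨h2, h3⟩ := Complex.nonneg_iff.mp (h x)
  exact ⟨Complex.ext (by simp) (by simpa using h3), h2⟩

variable {M : VonNeumannAlgebra H}

theorem nonneg_iff {a : M.toStarSubalgebra} :
    0 ≤ a ↔ ∀ x, 0 ≤ ⟪x, (a : H →L[ℂ] H) x⟫ :=
  (Iff.rfl : 0 ≤ a ↔ (0 : H →L[ℂ] H) ≤ a).trans operator_nonneg_iff

/-- Positive operators in `M` have their square roots in `M`, so the order inherited from the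
operators on `H` is the one generated by the elements `b* b` of `M`. -/
instance instStarOrderedRing : StarOrderedRing M.toStarSubalgebra := by
  refine StarOrderedRing.of_nonneg_iff (fun {x y} h z => ?_) fun x => ?_
  · exact add_le_add_right (a := (z : H →L[ℂ] H)) (show (x : H →L[ℂ] H) ≤ y from h)
  constructor
  · intro hx
    obtain ⟨b, hb, rfl⟩ := StarSubalgebra.exists_isSelfAdjoint_mul_self _ M.isClosed_coe
      (show (0 : H →L[ℂ] H) ≤ x from hx)
    exact AddSubmonoid.subset_closure ⟨b, congrArg (· * b) hb.star_eq⟩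
  · intro hx
    induction hx using AddSubmonoid.closure_induction with
    | mem x hx =>
      obtain ⟨b, rfl⟩ := hx
      exact star_mul_self_nonneg (b : H →L[ℂ] H)
    | zero => exact le_rfl
    | add x y _ _ hx hy => exact add_nonneg (show (0 : H →L[ℂ] H) ≤ x from hx) hy

/-- Bounded families in a von Neumann algebra converge weakly along ultrafilters. -/
theorem exists_weak_limit {ι : Type*} (U : Ultrafilter ι) (a : ι → M.toStarSubalgebra) {C : ℝ}
    (ha : ∀ i, ‖(a i : H →L[ℂ] H)‖ ≤ C) :
    ∃ b : M.toStarSubalgebra, ∀ x y, Tendsto (fun i => ⟪x, (a i : H →L[ℂ] H) y⟫) U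
      (𝓝 ⟪x, (b : H →L[ℂ] H) y⟫) := by
  have hbd : ∀ x y i, ‖⟪x, (a i : H →L[ℂ] H) y⟫‖ ≤ C * ‖x‖ * ‖y‖ := fun x y i =>
    calc _ ≤ ‖x‖ * ‖(a i : H →L[ℂ] H) y‖ := norm_inner_le_norm _ _
      _ ≤ ‖x‖ * (C * ‖y‖) := by
        gcongr
        exact (ContinuousLinearMap.le_opNorm _ _).trans (by gcongr; exact ha i)
      _ = _ := by ring
  have hlim : ∀ x y, ∃ l, ‖l‖ ≤ C * ‖x‖ * ‖y‖ ∧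
      Tendsto (fun i => ⟪x, (a i : H →L[ℂ] H) y⟫) U (𝓝 l) := fun x y => by
    obtain ⟨l, hl, hl'⟩ := (isCompact_closedBall (0 : ℂ) (C * ‖x‖ * ‖y‖)).ultrafilter_le_nhds
      (U.map fun i => ⟪x, (a i : H →L[ℂ] H) y⟫)
      (by
        rw [le_principal_iff, Ultrafilter.coe_map, mem_map]
        exact Filter.univ_mem' fun i => mem_closedBall_zero_iff.mpr (hbd x y i))
    exact ⟨l, mem_closedBall_zero_iff.mp hl, hl'⟩
  choose L hL hLt using hlim
  have huniq : ∀ {x y l}, Tendsto (fun i => ⟪x, (a i : H →L[ℂ] H) y⟫) U (𝓝 l) → L x y = l :=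
    fun h => tendsto_nhds_unique (hLt _ _) h
  -- The limits of the matrix coefficients form a bounded sesquilinear form, hence come from an
  -- operator. The representing operator acts in the first slot, so its adjoint is the limit.
  let B : H →L⋆[ℂ] H →L[ℂ] ℂ := LinearMap.mkContinuous₂
    (LinearMap.mk₂'ₛₗ (starRingEnd ℂ) (RingHom.id ℂ) L
      (fun x x' y => huniq (by simpa [inner_add_left] using (hLt x y).add (hLt x' y)))
      (fun c x y => huniq (by simpa [inner_smul_left, mul_comm] using (hLt x y).const_mul (starRingEnd ℂ c)))
      (fun x y y' => huniq (by simpa [inner_add_right] using (hLt x y).add (hLt x y')))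
      (fun c x y => huniq (by simpa [inner_smul_right] using (hLt x y).const_mul c))) C hL
  set b : H →L[ℂ] H := (InnerProductSpace.continuousLinearMapOfBilin B).adjoint with hb
  have hbL : ∀ x y, ⟪x, b y⟫ = L x y := fun x y => by
    rw [hb, ContinuousLinearMap.adjoint_inner_right,
      InnerProductSpace.continuousLinearMapOfBilin_apply]
    rfl
  -- Commutation with the commutant survives weak limits, so `b` is in the bicommutant.
  have hmem : b ∈ M.toStarSubalgebra := by
    have h1 : b ∈ Set.centralizer (Set.centralizer (M : Set (H →L[ℂ] H))) := by
      intro c hc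
      refine ContinuousLinearMap.ext fun y => ext_inner_left ℂ fun x => ?_
      change ⟪x, c (b y)⟫ = ⟪x, b (c y)⟫
      rw [← ContinuousLinearMap.adjoint_inner_left, hbL, hbL]
      refine tendsto_nhds_unique (hLt _ _) ((hLt x (c y)).congr fun i => ?_)
      rw [ContinuousLinearMap.adjoint_inner_left]
      have h2 : (a i : H →L[ℂ] H) * c = c * (a i : H →L[ℂ] H) := hc _ (a i).2
      exact congrArg (fun T : H →L[ℂ] H => ⟪x, T y⟫) h2
    rw [M.centralizer_centralizer] at h1
    exact h1
  exact ⟨⟨b, hmem⟩, fun x y => by simpa only [hbL] using hLt x y⟩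

/-- Bounded increasing families in a von Neumann algebra have a supremum, which is a weak limit. -/
theorem exists_isLUB {D : Set M.toStarSubalgebra} (hne : D.Nonempty) (h0 : ∀ d ∈ D, 0 ≤ d)
    (hdir : DirectedOn (· ≤ ·) D) {g : M.toStarSubalgebra} (hg : ∀ d ∈ D, d ≤ g) :
    ∃ s, IsLUB D s ∧ ∀ x, IsLUB ((fun d : M.toStarSubalgebra => (⟪x, (d : H →L[ℂ] H) x⟫).re) '' D)
      (⟪x, (s : H →L[ℂ] H) x⟫).re := by
  have : Nonempty D := hne.to_subtype
  have : IsDirectedOrder D := ⟨fun a b => by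
    obtain ⟨c, hc, h1, h2⟩ := hdir a a.2 b b.2
    exact ⟨⟨c, hc⟩, h1, h2⟩⟩
  -- An ultrafilter finer than `atTop` on `D`: its members eventually lie above each fixed `d`, so
  -- the weak limit along it is an upper bound.
  let U : Ultrafilter D := Ultrafilter.of atTop
  have hU : (U : Filter D) ≤ atTop := Ultrafilter.of_le atTop
  obtain ⟨s, hs⟩ := exists_weak_limit U (fun d : D => (d : M.toStarSubalgebra))
    (C := ‖(g : H →L[ℂ] H)‖) fun d => CStarAlgebra.norm_le_norm_of_nonneg_of_le
      (show (0 : H →L[ℂ] H) ≤ _ from h0 d d.2) (show ((d : M.toStarSubalgebra) : H →L[ℂ] H) ≤ g from hg d d.2)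
  have hev : ∀ d : D, ∀ᶠ i in (U : Filter D), d ≤ i := fun d => hU (eventually_ge_atTop d)
  have hsub : ∀ {a b : M.toStarSubalgebra}, a ≤ b ↔
      ∀ x, ⟪x, (a : H →L[ℂ] H) x⟫ ≤ ⟪x, (b : H →L[ℂ] H) x⟫ := fun {a b} => by
    rw [← sub_nonneg, nonneg_iff]
    refine forall_congr' fun x => ?_
    rw [← sub_nonneg (a := ⟪x, (b : H →L[ℂ] H) x⟫), ← inner_sub_right]
    rfl
  have hre : ∀ {a b : M.toStarSubalgebra}, a ≤ b → ∀ x,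
      (⟪x, (a : H →L[ℂ] H) x⟫).re ≤ (⟪x, (b : H →L[ℂ] H) x⟫).re := fun h x =>
    (Complex.le_def.mp (hsub.mp h x)).1
  refine ⟨s, ⟨fun d hd => hsub.mpr fun x => ?_, fun u hu => hsub.mpr fun x => ?_⟩,
    fun x => ⟨?_, fun r hr => ?_⟩⟩
  · exact ge_of_tendsto (hs x x) ((hev ⟨d, hd⟩).mono fun i hi => hsub.mp hi x)
  · exact le_of_tendsto (hs x x) (Eventually.of_forall fun i => hsub.mp (hu i.2) x)
  · rintro _ ⟨d, hd, rfl⟩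
    exact ge_of_tendsto ((Complex.continuous_re.tendsto _).comp (hs x x))
      ((hev ⟨d, hd⟩).mono fun i hi => hre hi x)
  · exact le_of_tendsto ((Complex.continuous_re.tendsto _).comp (hs x x))
      (Eventually.of_forall fun i => hr ⟨i, i.2, rfl⟩)

end VonNeumannAlgebra

set_option linter.unusedSectionVars false

/-! ### Normal traces are weakly continuous -/

/-- The bound lets `ψ` factor through `L` as a bounded functional on the range. Hahn–Banach extends
it to `H` and Riesz represents it. -/
theorem exists_inner_of_norm_le {V H : Type*} [AddCommGroup V] [Module ℂ V]
    [NormedAddCommGroup H] [InnerProductSpace ℂ H] [CompleteSpace H] (L : V →ₗ[ℂ] H)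
    (ψ : V →ₗ[ℂ] ℂ) {C : ℝ} (h : ∀ v, ‖ψ v‖ ≤ C * ‖L v‖) :
    ∃ z : H, ∀ v, ψ v = inner ℂ z (L v) := by
  have hker : LinearMap.ker L ≤ LinearMap.ker ψ := fun v hv => by
    have := h v
    rw [LinearMap.mem_ker.mp hv, norm_zero, mul_zero] at this
    exact norm_le_zero_iff.mp this
  let f₀ : LinearMap.range L →ₗ[ℂ] ℂ :=
    ((LinearMap.ker L).liftQ ψ hker).comp (LinearMap.quotKerEquivRange L).symm.toLinearMap
  have hf₀ : ∀ v, f₀ ⟨L v, v, rfl⟩ = ψ v := fun v => by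
    have : (LinearMap.quotKerEquivRange L).symm ⟨L v, v, rfl⟩ = (LinearMap.ker L).mkQ v :=
      LinearMap.quotKerEquivRange_symm_apply_image L v _
    simp [f₀, this]
  let f : StrongDual ℂ (LinearMap.range L) := f₀.mkContinuous C (by
    rintro ⟨_, v, rfl⟩
    rw [hf₀]
    exact h v)
  obtain ⟨g, hg, -⟩ := exists_extension_norm_eq _ f
  refine ⟨(InnerProductSpace.toDual ℂ H).symm g, fun v => ?_⟩
  rw [InnerProductSpace.toDual_symm_apply, ← hf₀]
  exact (hg ⟨L v, v, rfl⟩).symm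

namespace VonNeumannAlgebra

variable {H : Type*} [NormedAddCommGroup H] [InnerProductSpace ℂ H] [CompleteSpace H]
  {M : VonNeumannAlgebra H}

local notation "⟪" x ", " y "⟫" => inner ℂ x y

attribute [local instance] toCStarAlgebra

theorem isFaithfulTracialState {τ : M.toStarSubalgebra →L[ℂ] ℂ}
    (hτ : IsFaithfulNormalTracialState M τ) : IsFaithfulTracialState τ :=
  ⟨hτ.map_one, hτ.nonneg, hτ.trace, hτ.faithful⟩

/-- A functional on a von Neumann algebra that respects bounded weak limits along `U`. -/
def IsWeaklyContinuousAlong (U : Filter ℕ) (φ : M.toStarSubalgebra →L[ℂ] ℂ) : Prop :=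
  ∀ (a : ℕ → M.toStarSubalgebra) (b : M.toStarSubalgebra) (C : ℝ), (∀ n, ‖a n‖ ≤ C) →
    (∀ x y, Tendsto (fun n => ⟪x, (a n : H →L[ℂ] H) y⟫) U (𝓝 ⟪x, (b : H →L[ℂ] H) y⟫)) →
    Tendsto (fun n => φ (a n)) U (𝓝 (φ b))

theorem IsWeaklyContinuousAlong.add {U : Filter ℕ} {φ ψ : M.toStarSubalgebra →L[ℂ] ℂ}
    (hφ : IsWeaklyContinuousAlong U φ) (hψ : IsWeaklyContinuousAlong U ψ) :
    IsWeaklyContinuousAlong U (φ + ψ) :=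
  fun a b C ha hab => (hφ a b C ha hab).add (hψ a b C ha hab)

/-- Only bounded sequences are tested, and on them a norm approximation of `φ` is uniform. -/
theorem IsWeaklyContinuousAlong.of_approx {U : Filter ℕ} {φ : M.toStarSubalgebra →L[ℂ] ℂ}
    (h : ∀ ε > 0, ∃ ψ, IsWeaklyContinuousAlong U ψ ∧ ‖φ - ψ‖ ≤ ε) :
    IsWeaklyContinuousAlong U φ := by
  intro a b C ha hab
  rw [Metric.tendsto_nhds]
  intro ε hε
  set K : ℝ := |C| + ‖b‖ + 1 with hK
  have hK0 : 0 < K := by positivity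
  obtain ⟨ψ, hψ, hle⟩ := h (ε / (4 * K)) (by positivity)
  have hd : ∀ c : M.toStarSubalgebra, ‖c‖ ≤ K → dist (φ c) (ψ c) ≤ ε / 4 := fun c hc => by
    rw [dist_eq_norm]
    calc ‖φ c - ψ c‖ = ‖(φ - ψ) c‖ := rfl
      _ ≤ ‖φ - ψ‖ * ‖c‖ := (φ - ψ).le_opNorm c
      _ ≤ ε / (4 * K) * K := by gcongr
      _ = ε / 4 := by field_simp
  have hb : ‖b‖ ≤ K := by rw [hK]; linarith [abs_nonneg C]
  filter_upwards [(Metric.tendsto_nhds.mp (hψ a b C ha hab)) (ε / 4) (by positivity)] with n hn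
  have h1 := hd (a n) ((ha n).trans (by rw [hK]; linarith [le_abs_self C, norm_nonneg b]))
  have h2 := hd b hb
  rw [dist_comm] at h2
  calc dist (φ (a n)) (φ b) ≤ dist (φ (a n)) (ψ (a n)) + dist (ψ (a n)) (ψ b)
      + dist (ψ b) (φ b) := dist_triangle4 _ _ _ _
    _ < ε := by linarith

variable {τ : M.toStarSubalgebra →L[ℂ] ℂ}

/-- Below every nonzero positive element there is a nonzero positive element below which the trace
is dominated by a vector functional. -/
theorem exists_trace_le_vector (hτ : IsFaithfulNormalTracialState M τ) {g : M.toStarSubalgebra}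
    (hg : 0 ≤ g) (hg0 : g ≠ 0) :
    ∃ f, 0 ≤ f ∧ f ≤ g ∧ f ≠ 0 ∧ ∃ x : H, ∀ b : M.toStarSubalgebra, 0 ≤ b → b ≤ f →
      (τ b).re ≤ (⟪x, (b : H →L[ℂ] H) x⟫).re := by
  have hx0 : ∃ x₀, 0 < (⟪x₀, (g : H →L[ℂ] H) x₀⟫).re := by
    by_contra! hcon
    refine hg0 (le_antisymm ?_ hg)
    rw [← neg_nonneg, nonneg_iff]
    intro x
    have h1 := nonneg_iff.mp hg x
    have h2 : ⟪x, ((-g : M.toStarSubalgebra) : H →L[ℂ] H) x⟫ = -⟪x, (g : H →L[ℂ] H) x⟫ := by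
      rw [← inner_neg_right]; rfl
    rw [h2, Complex.nonneg_iff, Complex.neg_re, Complex.neg_im]
    rw [Complex.nonneg_iff] at h1
    exact ⟨by linarith [hcon x], by rw [← h1.2, neg_zero]⟩
  obtain ⟨x₀, hx₀⟩ := hx0
  set r := (⟪x₀, (g : H →L[ℂ] H) x₀⟫).re with hr
  have hτg : 0 ≤ (τ g).re :=
    (Complex.nonneg_iff.mp ((isFaithfulTracialState hτ).pos.nonneg hg)).1
  -- The scaling makes the vector functional at `g` equal to `τ(g) + 1`, strictly above `τ(g)`.
  set c : ℝ := √(((τ g).re + 1) / r) with hc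
  set x : H := (c : ℂ) • x₀ with hx
  set ω : M.toStarSubalgebra → ℝ := fun a => (⟪x, (a : H →L[ℂ] H) x⟫).re with hω
  have hωadd : ∀ a b, ω (a + b) = ω a + ω b := fun a b => by
    simp only [hω]
    rw [← Complex.add_re, ← inner_add_right]
    rfl
  have hωg : (τ g).re < ω g := by
    have : ω g = c ^ 2 * r := by
      simp only [hω, hx, map_smul, inner_smul_left, inner_smul_right, Complex.conj_ofReal,
        Complex.re_ofReal_mul, hr]
      ring
    rw [this, hc, Real.sq_sqrt (by positivity), div_mul_cancel₀ _ hx₀.ne']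
    linarith
  -- Take `e ≤ g` maximal with `ω(e) ≤ τ(e)`. Then `f = g - e` is nonzero because `ω(g) > τ(g)`, and
  -- any `b ≤ f` with `ω(b) < τ(b)` could be added to `e`. Chains have upper bounds in `Z` since `ω`
  -- at a supremum is the supremum of its values.
  set Z : Set M.toStarSubalgebra := {e | 0 ≤ e ∧ e ≤ g ∧ ω e ≤ (τ e).re} with hZ
  obtain ⟨e, -, he⟩ := zorn_le_nonempty₀ Z (fun D hD hchain y hy => by
    obtain ⟨s, hs, hsω⟩ := exists_isLUB ⟨y, hy⟩ (fun d hd => (hD hd).1) hchain.directedOn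
      (fun d hd => (hD hd).2.1)
    refine ⟨s, ⟨(hD hy).1.trans (hs.1 hy), hs.2 fun d hd => (hD hd).2.1, ?_⟩, fun z hz => hs.1 hz⟩
    refine (hsω x).2 ?_
    rintro _ ⟨d, hd, rfl⟩
    exact (hD hd).2.2.trans ((isFaithfulTracialState hτ).pos.re_mono (hs.1 hd)))
    0 ⟨le_rfl, hg, by simp [hω]⟩
  obtain ⟨he0, heg, heω⟩ := he.prop
  refine ⟨g - e, sub_nonneg.mpr heg, sub_le_self _ he0, fun h => ?_, x, fun b hb hbf => ?_⟩
  · rw [sub_eq_zero.mp h] at hωg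
    linarith
  · by_contra! hcon
    have hmem : e + b ∈ Z := by
      refine ⟨add_nonneg he0 hb, ?_, ?_⟩
      · rw [add_comm]
        exact le_sub_iff_add_le.mp hbf
      · rw [hωadd, map_add, Complex.add_re]
        exact add_le_add heω hcon.le
    have h1 : e + b ≤ e := he.le_of_ge hmem (le_add_of_nonneg_right hb)
    have h2 : b = 0 := le_antisymm (by simpa using h1) hb
    rw [h2] at hcon
    simp at hcon

/-- If the trace is dominated by a vector functional below `f`, then `τ(f ·)` is a vector
functional. -/
theorem traceFunctional_eq_inner (hτ : IsFaithfulNormalTracialState M τ) {f : M.toStarSubalgebra}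
    (hf : 0 ≤ f) {x : H} (h : ∀ b : M.toStarSubalgebra, 0 ≤ b → b ≤ f →
      (τ b).re ≤ (⟪x, (b : H →L[ℂ] H) x⟫).re) :
    ∃ z y : H, ∀ b : M.toStarSubalgebra, τ (f * b) = ⟪z, (b : H →L[ℂ] H) y⟫ := by
  have hτ' := isFaithfulTracialState hτ
  obtain ⟨w, hws, hw⟩ := StarSubalgebra.exists_isSelfAdjoint_mul_self _ M.isClosed_coe
    (show (0 : H →L[ℂ] H) ≤ f from hf)
  set y : H := (w : H →L[ℂ] H) x with hy
  -- For `‖b‖ ≤ 1` one has `(b w)* (b w) = w b* b w ≤ w² = f`, so the domination hypothesis applies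
  -- to it and gives `‖b y‖²`.
  have hone : ∀ b : M.toStarSubalgebra, ‖b‖ ≤ 1 →
      (τ (star (b * w) * (b * w))).re ≤ ‖(b : H →L[ℂ] H) y‖ ^ 2 := fun b hb => by
    have h1 : star b * b ≤ 1 := by
      rw [← CStarAlgebra.norm_le_one_iff_of_nonneg _ (star_mul_self_nonneg b),
        CStarRing.norm_star_mul_self]
      exact mul_le_one₀ hb (norm_nonneg _) hb
    have h2 : star (b * w) * (b * w) ≤ f := by
      have := star_left_conjugate_le_conjugate h1 w
      rw [mul_one, hws.star_eq, ← hw] at this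
      rwa [star_mul, hws.star_eq, mul_assoc, ← mul_assoc (star b), ← mul_assoc]
    refine (h _ (star_mul_self_nonneg _) h2).trans_eq ?_
    have h3 : ((star (b * w) * (b * w) : M.toStarSubalgebra) : H →L[ℂ] H) x
        = (ContinuousLinearMap.adjoint ((b * w : M.toStarSubalgebra) : H →L[ℂ] H))
          ((b : H →L[ℂ] H) y) := rfl
    rw [h3, ContinuousLinearMap.adjoint_inner_right]
    have h4 : ((b * w : M.toStarSubalgebra) : H →L[ℂ] H) x = (b : H →L[ℂ] H) y := rfl
    rw [h4]
    exact (norm_sq_eq_re_inner (𝕜 := ℂ) _).symm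
  have hall : ∀ b : M.toStarSubalgebra,
      (τ (star (b * w) * (b * w))).re ≤ ‖(b : H →L[ℂ] H) y‖ ^ 2 := fun b => by
    by_cases hb : b = 0
    · simp [hb]
    have hb' : 0 < ‖b‖ := norm_pos_iff.mpr hb
    have h1 := hone (((‖b‖⁻¹ : ℝ) : ℂ) • b) (by
      rw [norm_smul, Complex.norm_real, norm_inv, norm_norm, inv_mul_cancel₀ hb'.ne'])
    have h2 : (((‖b‖⁻¹ : ℝ) : ℂ) • b * w) = ((‖b‖⁻¹ : ℝ) : ℂ) • (b * w) := smul_mul_assoc _ _ _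
    have h3 : ‖((((‖b‖⁻¹ : ℝ) : ℂ) • b : M.toStarSubalgebra) : H →L[ℂ] H) y‖
        = ‖b‖⁻¹ * ‖(b : H →L[ℂ] H) y‖ := by
      change ‖((‖b‖⁻¹ : ℝ) : ℂ) • (b : H →L[ℂ] H) y‖ = _
      rw [norm_smul, Complex.norm_real, norm_inv, norm_norm]
    have h4 : star ((‖b‖⁻¹ : ℝ) : ℂ) * ((‖b‖⁻¹ : ℝ) : ℂ) = ((‖b‖⁻¹ ^ 2 : ℝ) : ℂ) := by
      rw [Complex.star_def, Complex.conj_ofReal, sq, Complex.ofReal_mul]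
    rw [h2, h3, star_smul, smul_mul_smul_comm, h4, map_smul, smul_eq_mul, Complex.re_ofReal_mul,
      mul_pow] at h1
    exact le_of_mul_le_mul_left h1 (by positivity)
  have hτf : 0 ≤ (τ f).re := (Complex.nonneg_iff.mp (hτ'.pos.nonneg hf)).1
  -- By traciality `τ(f b) = τ(w* (b w))`; Cauchy–Schwarz bounds it by `√τ(f) ‖b y‖`, so it is a
  -- bounded functional of the vector `b y`.
  obtain ⟨z, hz⟩ := exists_inner_of_norm_le (V := M.toStarSubalgebra)
    (L := { toFun := fun b => (b : H →L[ℂ] H) y, map_add' := fun _ _ => rfl,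
            map_smul' := fun _ _ => rfl })
    (ψ := (traceFunctional τ f).toLinearMap) (C := √(τ f).re) (fun b => by
      have h1 : traceFunctional τ f b = τ (star w * (b * w)) := by
        rw [traceFunctional_apply, hw, hws.star_eq, mul_assoc, hτ.trace, mul_assoc]
      have h2 := hτ'.pos.cauchySchwarz w (b * w)
      change ‖traceFunctional τ f b‖ ≤ √(τ f).re * ‖(b : H →L[ℂ] H) y‖
      rw [h1]
      refine abs_le_of_sq_le_sq' ?_ (by positivity) |>.2
      rw [mul_pow, Real.sq_sqrt hτf]
      refine h2.trans ?_
      rw [hws.star_eq, ← hw]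
      exact mul_le_mul_of_nonneg_left (hall b) hτf)
  exact ⟨z, y, hz⟩

/-- Exhaustion over those `e` in `[0, 1]` for which `τ(e ·)` is weakly continuous. Chains are
bounded in this set by normality, because `‖τ((s - d) ·)‖ = τ(s - d)`. If a maximal `e` were not
`1`, there would be a nonzero `f ≤ 1 - e` for which `τ(f ·)` is a vector functional, and `e + f`
would contradict maximality. -/
theorem isWeaklyContinuousAlong_trace (hτ : IsFaithfulNormalTracialState M τ) (U : Filter ℕ) :
    IsWeaklyContinuousAlong U τ := by
  have hτ' := isFaithfulTracialState hτ
  set Z : Set M.toStarSubalgebra :=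
    {e | 0 ≤ e ∧ e ≤ 1 ∧ IsWeaklyContinuousAlong U (traceFunctional τ e)} with hZ
  obtain ⟨e, -, he⟩ := zorn_le_nonempty₀ Z (fun D hD hchain y hy => by
    obtain ⟨s, hs, -⟩ := exists_isLUB ⟨y, hy⟩ (fun d hd => (hD hd).1) hchain.directedOn
      (fun d hd => (hD hd).2.1)
    refine ⟨s, ⟨(hD hy).1.trans (hs.1 hy), hs.2 fun d hd => (hD hd).2.1, ?_⟩, fun z hz => hs.1 hz⟩
    refine .of_approx fun ε hε => ?_
    have h1 := hτ.normal D s ⟨y, hy⟩ (fun d hd => (hD hd).1) hchain.directedOn hs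
    obtain ⟨_, ⟨d, hd, rfl⟩, hdε⟩ := (lt_isLUB_iff h1).mp (show (τ s).re - ε < (τ s).re by linarith)
    refine ⟨traceFunctional τ d, (hD hd).2.2, ?_⟩
    rw [← map_sub,
      (hτ'.isPosFunctional_traceFunctional (sub_nonneg.mpr (hs.1 hd))).norm_eq,
      traceFunctional_apply, mul_one, map_sub, Complex.sub_re]
    dsimp only at hdε
    linarith)
    0 ⟨le_rfl, zero_le_one, fun a b C _ _ => by simpa using tendsto_const_nhds⟩
  obtain ⟨he0, he1, heW⟩ := he.prop
  have hone : e = 1 := by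
    by_contra hne
    obtain ⟨f, hf0, hf1, hfne, x, hx⟩ := exists_trace_le_vector hτ (sub_nonneg.mpr he1)
      (sub_ne_zero.mpr (Ne.symm hne))
    obtain ⟨z, y, hzy⟩ := traceFunctional_eq_inner hτ hf0 hx
    have hmem : e + f ∈ Z := by
      refine ⟨add_nonneg he0 hf0, ?_, ?_⟩
      · rw [add_comm]
        exact le_sub_iff_add_le.mp hf1
      · rw [map_add]
        refine heW.add fun a b C _ hab => ?_
        simp only [traceFunctional_apply, hzy]
        exact hab z y
    have h1 : e + f ≤ e := he.le_of_ge hmem (le_add_of_nonneg_right hf0)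
    exact hfne (le_antisymm (by simpa using h1) hf0)
  intro a b C ha hab
  have := heW a b C ha hab
  simpa only [hone, traceFunctional_apply, one_mul] using this

end VonNeumannAlgebra

/-! ### Radon–Nikodym densities in a tracial von Neumann algebra -/

/-- Every functional on `A` that is dominated by a multiple of `τ` has a density in `A`. -/
def HasBoundedDensities {A : Type*} [CStarAlgebra A] [PartialOrder A] (τ : A →L[ℂ] ℂ) : Prop :=
  ∀ φ : A →L[ℂ] ℂ, IsPosFunctional φ → ∀ t : ℝ, 0 ≤ t →
    (∀ b, 0 ≤ b → (φ b).re ≤ t * (τ b).re) → ∃ h, φ = traceFunctional τ h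

namespace VonNeumannAlgebra

attribute [local instance] toCStarAlgebra

/-- The approximants of `exists_seq_tendsto_of_le_trace` stay in `[0, t]`, so they have a weak limit
`b` in `M` along an ultrafilter. Weak continuity of `τ` identifies `τ(b c)` with `lim τ(a n c) =
φ(c)`. -/
theorem hasBoundedDensities {H : Type*} [NormedAddCommGroup H] [InnerProductSpace ℂ H]
    [CompleteSpace H] {M : VonNeumannAlgebra H} {τ : M.toStarSubalgebra →L[ℂ] ℂ}
    (hτ : IsFaithfulNormalTracialState M τ) : HasBoundedDensities τ := by
  intro φ hφ t ht hle
  have hτ' := isFaithfulTracialState hτ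
  obtain ⟨a, ha, hlim⟩ := exists_seq_tendsto_of_le_trace hτ' hφ ht hle
  let U : Ultrafilter ℕ := Ultrafilter.of atTop
  have hU : (U : Filter ℕ) ≤ atTop := Ultrafilter.of_le atTop
  have hbd : ∀ n, ‖a n‖ ≤ t := fun n =>
    (CStarAlgebra.norm_le_iff_le_algebraMap (a n) ht (ha n).1).mpr (ha n).2
  obtain ⟨b, hb⟩ := exists_weak_limit U a (C := t) hbd
  refine ⟨b, ?_⟩
  have key : ∀ c : M.toStarSubalgebra, 0 ≤ c → φ c = traceFunctional τ b c := fun c hc => by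
    refine tendsto_nhds_unique ((hlim c hc).mono_left hU) ?_
    refine isWeaklyContinuousAlong_trace hτ U (fun n => a n * c) (b * c) (t * ‖c‖)
      (fun n => (norm_mul_le _ _).trans (by gcongr; exact hbd n)) fun x y => ?_
    exact hb x ((c : H →L[ℂ] H) y)
  have := ext_of_nonneg (f := φ.toLinearMap) (g := (traceFunctional τ b).toLinearMap) key
  exact ContinuousLinearMap.ext fun c => LinearMap.congr_fun this c

end VonNeumannAlgebra

/-! ### The ergodic theorem for nonnegative superadditive processes -/

section Superadditive

open scoped ENNReal

variable {Ω : Type*} [MeasurableSpace Ω] {P : Measure Ω} [IsProbabilityMeasure P] {T : Ω → Ω}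

/-- A nonnegative superadditive process over a transformation `T`. -/
structure IsSuperadditive (T : Ω → Ω) (F : ℕ → Ω → ℝ≥0∞) : Prop where
  measurable : ∀ n, Measurable (F n)
  add_le : ∀ n m ω, F n ω + F m (T^[n] ω) ≤ F (n + m) ω

variable {F : ℕ → Ω → ℝ≥0∞}

theorem IsSuperadditive.le_add (hF : IsSuperadditive T F) (n m : ℕ) (ω : Ω) :
    F n ω ≤ F (n + m) ω := le_self_add.trans (hF.add_le n m ω)

/-- If every orbit segment that starts outside of `A` reaches the average `α` within time `N`, then
all long segments have average at least `α` up to the visits to `A`. -/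
theorem IsSuperadditive.mul_le_add_visits (hF : IsSuperadditive T F) {A : Set Ω} {α : ℝ≥0∞}
    {N : ℕ} (hA : ∀ ω ∉ A, ∃ j, 1 ≤ j ∧ j ≤ N ∧ α * j ≤ F j ω) (n : ℕ) (ω : Ω) :
    α * n ≤ F n ω + α * (N + ∑ i ∈ Finset.range n, A.indicator 1 (T^[i] ω)) := by
  induction n using Nat.strong_induction_on generalizing ω with
  | _ n ih =>
  by_cases hn : n ≤ N
  · refine le_add_left (mul_le_mul_right (le_add_right ?_) α)
    exact_mod_cast hn
  -- A point of `A` is passed in one step at the cost of `α`, charged to the visit. From any other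
  -- point the walk jumps `j ≤ N` steps and gains `α j`. The final stretch of length at most `N` is
  -- covered by `α N`.
  by_cases hω : ω ∈ A
  · obtain ⟨k, rfl⟩ : ∃ k, n = 1 + k := ⟨n - 1, by omega⟩
    have h1 := ih k (by omega) (T ω)
    have h2 := hF.add_le 1 k ω
    rw [Function.iterate_one] at h2
    rw [add_comm 1 k, Finset.sum_range_succ', add_comm k 1]
    simp only [Function.iterate_succ_apply, Function.iterate_zero, id, indicator_of_mem hω,
      Pi.one_apply]
    calc α * ((1 + k : ℕ) : ℝ≥0∞) = α * k + α := by push_cast; ring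
      _ ≤ (F k (T ω) + α * (N + ∑ i ∈ Finset.range k, A.indicator 1 (T^[i] (T ω)))) + α := by
        gcongr
      _ ≤ (F (1 + k) ω + α * (N + ∑ i ∈ Finset.range k, A.indicator 1 (T^[i] (T ω)))) + α := by
        gcongr
        exact le_add_self.trans h2
      _ = _ := by ring
  · obtain ⟨j, hj1, hjN, hj⟩ := hA ω hω
    obtain ⟨k, rfl⟩ : ∃ k, n = j + k := ⟨n - j, by omega⟩
    have h1 := ih k (by omega) (T^[j] ω)
    have h2 := hF.add_le j k ω
    rw [Finset.sum_range_add]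
    have h3 : ∀ i, T^[j + i] ω = T^[i] (T^[j] ω) := fun i => by
      rw [add_comm, Function.iterate_add_apply]
    simp only [h3]
    calc α * ((j + k : ℕ) : ℝ≥0∞) = α * j + α * k := by push_cast; ring
      _ ≤ F j ω + (F k (T^[j] ω)
          + α * (N + ∑ i ∈ Finset.range k, A.indicator 1 (T^[i] (T^[j] ω)))) := by gcongr
      _ = (F j ω + F k (T^[j] ω))
          + α * (N + ∑ i ∈ Finset.range k, A.indicator 1 (T^[i] (T^[j] ω))) := by ring
      _ ≤ _ := by
        gcongr
        exact le_add_self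

/-- The asymptotic growth rate `sup E[F n] / n` of a superadditive process. -/
noncomputable def growthRate (P : Measure Ω) (F : ℕ → Ω → ℝ≥0∞) : ℝ≥0∞ :=
  ⨆ n : ℕ, (∫⁻ ω, F (n + 1) ω ∂P) / (n + 1 : ℕ)

theorem lintegral_le_mul_growthRate (P : Measure Ω) (F : ℕ → Ω → ℝ≥0∞) (n : ℕ) :
    ∫⁻ ω, F (n + 1) ω ∂P ≤ growthRate P F * (n + 1 : ℕ) := by
  rw [← ENNReal.div_le_iff (by simp) (by simp)]
  exact le_iSup (fun n : ℕ => (∫⁻ ω, F (n + 1) ω ∂P) / (n + 1 : ℕ)) n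

/-- If the limsup exceeds some `α` above the growth rate with positive probability, then by
ergodicity it does so almost surely. The points that do not reach average `α` by time `N` then form
sets of vanishing measure. Integrating `mul_le_add_visits`, dividing by the length, and letting
first `n` and then `N` tend to infinity gives `α ≤ growthRate`. -/
theorem IsSuperadditive.limsup_le (hT : Ergodic T P) (hF : IsSuperadditive T F) :
    ∀ᵐ ω ∂P, limsup (fun n : ℕ => F (n + 1) ω / (n + 1 : ℕ)) atTop ≤ growthRate P F := by
  set f : Ω → ℝ≥0∞ := fun ω => limsup (fun n : ℕ => F (n + 1) ω / (n + 1 : ℕ)) atTop with hf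
  have hfm : Measurable f := Measurable.limsup fun n => (hF.measurable _).div_const _
  by_contra hcon
  -- a finite level strictly between
  have hex : ∃ α : ℝ≥0∞, growthRate P F < α ∧ α ≠ ∞ ∧ P {ω | α < f ω} ≠ 0 := by
    by_contra! h
    have h1 : ∀ q : ℚ, ∀ᵐ ω ∂P, growthRate P F < ((q : ℝ).toNNReal : ℝ≥0∞) →
        ¬ ((q : ℝ).toNNReal : ℝ≥0∞) < f ω := fun q => by
      by_cases hq : growthRate P F < ((q : ℝ).toNNReal : ℝ≥0∞)
      · filter_upwards [measure_eq_zero_iff_ae_notMem.mp (h _ hq ENNReal.coe_ne_top)] with ω hω _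
        exact hω
      · exact Eventually.of_forall fun ω h => absurd h hq
    refine hcon ((ae_all_iff.mpr h1).mono fun ω hω => not_lt.mp fun hlt => ?_)
    obtain ⟨q, -, hq1, hq2⟩ := ENNReal.lt_iff_exists_rat_btwn.mp hlt
    exact hω q hq1 hq2
  obtain ⟨α, hα, hαtop, hP⟩ := hex
  -- `F (n + 1) (T ω) ≤ F (n + 2) ω`, and the change of denominator costs the factor `(n + 2) / (n +
  -- 1) → 1`.
  have hinv : ∀ ω, f (T ω) ≤ f ω := by
    intro ω
    set v : ℕ → ℝ≥0∞ := fun n => ((n + 2 : ℕ) : ℝ≥0∞) / ((n + 1 : ℕ) : ℝ≥0∞) with hv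
    have hv1 : Tendsto v atTop (𝓝 1) := by
      have h1 : Tendsto (fun n : ℕ => 1 + ((n + 1 : ℕ) : ℝ≥0∞)⁻¹) atTop (𝓝 (1 + 0)) :=
        tendsto_const_nhds.add (ENNReal.tendsto_inv_nat_nhds_zero.comp (tendsto_add_atTop_nat 1))
      rw [add_zero] at h1
      refine h1.congr fun n => ?_
      have h2 : ((n + 2 : ℕ) : ℝ≥0∞) = (n + 1 : ℕ) + 1 := by push_cast; ring
      simp only [hv]
      rw [h2, ENNReal.add_div, ENNReal.div_self (by simp) (by simp), one_div]
    have hlv : limsup v atTop = 1 := hv1.limsup_eq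
    have h1 : ∀ n : ℕ, F (n + 1) (T ω) / (n + 1 : ℕ)
        ≤ ((fun n : ℕ => F (n + 1 + 1) ω / (n + 1 + 1 : ℕ)) * v) n := fun n => by
      have h2 := hF.add_le 1 (n + 1) ω
      rw [Function.iterate_one, add_comm 1] at h2
      simp only [Pi.mul_apply, hv]
      rw [← mul_div_assoc, ENNReal.div_mul_cancel (by simp) (by simp)]
      exact ENNReal.div_le_div_right (le_add_self.trans h2) _
    calc f (T ω) ≤ limsup ((fun n : ℕ => F (n + 1 + 1) ω / (n + 1 + 1 : ℕ)) * v) atTop :=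
          limsup_le_limsup (Eventually.of_forall h1)
      _ ≤ limsup (fun n : ℕ => F (n + 1 + 1) ω / (n + 1 + 1 : ℕ)) atTop * limsup v atTop :=
          ENNReal.limsup_mul_le' (Or.inr (by simp [hlv])) (Or.inr (by simp [hlv]))
      _ = f ω := by
        rw [hlv, mul_one]
        exact limsup_nat_add (fun n : ℕ => F (n + 1) ω / (n + 1 : ℕ)) 1
  have hae : ∀ᵐ ω ∂P, α < f ω := by
    have hms : MeasurableSet {ω | α < f ω} := measurableSet_lt measurable_const hfm
    have := hT.ae_empty_or_univ_of_preimage_ae_le (s := {ω | α < f ω}) hms.nullMeasurableSet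
      (Eventually.of_forall fun ω (hω : α < f (T ω)) => (hω.trans_le (hinv ω) : α < f ω))
    rcases this with h | h
    · exact absurd ((measure_congr h).trans measure_empty) hP
    · exact h.mono fun ω hω => hω.mpr (mem_univ ω)
  set A : ℕ → Set Ω := fun N => {ω | ∀ j, 1 ≤ j → j ≤ N → F j ω < α * j} with hA
  have hAm : ∀ N, MeasurableSet (A N) := fun N => by
    simp only [hA, Set.ofPred_forall]
    exact MeasurableSet.iInter fun j => MeasurableSet.iInter fun _ => MeasurableSet.iInter fun _ =>
      measurableSet_lt (hF.measurable j) measurable_const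
  have hAtend : Tendsto (fun N => P (A N)) atTop (𝓝 0) := by
    have h1 := tendsto_measure_iInter_atTop (μ := P) (s := A)
      (fun N => (hAm N).nullMeasurableSet)
      (fun N N' h ω hω j h1 h2 => hω j h1 (h2.trans h)) ⟨0, measure_ne_top _ _⟩
    have h2 : P (⋂ N, A N) = 0 := by
      refine measure_eq_zero_iff_ae_notMem.mpr (hae.mono fun ω hω hmem => ?_)
      obtain ⟨n, hn⟩ := (frequently_lt_of_lt_limsup (by isBoundedDefault) hω).exists
      have h3 := mem_iInter.mp hmem (n + 1) (n + 1) (by omega) le_rfl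
      rw [ENNReal.lt_div_iff_mul_lt (by simp) (by simp)] at hn
      exact absurd h3 hn.le.not_gt
    rwa [h2] at h1
  have hmain : ∀ N n : ℕ, α * (n + 1 : ℕ) ≤ growthRate P F * (n + 1 : ℕ)
      + α * (N + (n + 1 : ℕ) * P (A N)) := by
    intro N n
    have h1 : ∀ ω, α * (n + 1 : ℕ) ≤ F (n + 1) ω
        + α * (N + ∑ i ∈ Finset.range (n + 1), (A N).indicator 1 (T^[i] ω)) :=
      hF.mul_le_add_visits (fun ω hω => by
        simp only [hA, Set.mem_ofPred_eq, not_forall, not_lt] at hω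
        obtain ⟨j, h1, h2, h3⟩ := hω
        exact ⟨j, h1, h2, h3⟩) _
    have h2 : ∀ i, ∫⁻ ω, (A N).indicator (1 : Ω → ℝ≥0∞) (T^[i] ω) ∂P = P (A N) := fun i => by
      rw [(hT.toMeasurePreserving.iterate i).lintegral_comp
        (measurable_one.indicator (hAm N)), lintegral_indicator_one (hAm N)]
    have hm : ∀ i, Measurable fun ω => (A N).indicator (1 : Ω → ℝ≥0∞) (T^[i] ω) := fun i =>
      (measurable_one.indicator (hAm N)).comp (hT.measurable.iterate i)
    calc α * (n + 1 : ℕ) = ∫⁻ _, α * (n + 1 : ℕ) ∂P := by simp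
      _ ≤ ∫⁻ ω, F (n + 1) ω
        + α * (N + ∑ i ∈ Finset.range (n + 1), (A N).indicator 1 (T^[i] ω)) ∂P :=
        lintegral_mono h1
      _ = ∫⁻ ω, F (n + 1) ω ∂P + α * (N + (n + 1 : ℕ) * P (A N)) := by
        rw [lintegral_add_left (hF.measurable _), lintegral_const_mul' _ _ hαtop,
          lintegral_add_left measurable_const, lintegral_finsetSum _ fun i _ => hm i]
        simp [h2]
      _ ≤ _ := by
        gcongr
        exact lintegral_le_mul_growthRate P F n
  have hN : ∀ N : ℕ, α ≤ growthRate P F + α * P (A N) := fun N => by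
    have h1 : ∀ n : ℕ, α ≤ growthRate P F + α * (N * ((n + 1 : ℕ) : ℝ≥0∞)⁻¹ + P (A N)) := fun n => by
      have h2 := ENNReal.div_le_div_right (hmain N n) ((n + 1 : ℕ) : ℝ≥0∞)
      rw [ENNReal.mul_div_cancel_right (by simp) (by simp), ENNReal.add_div,
        ENNReal.mul_div_cancel_right (by simp) (by simp), mul_div_assoc, ENNReal.add_div,
        mul_comm _ (P (A N)), ENNReal.mul_div_cancel_right (by simp) (by simp)] at h2
      exact h2
    have h2 : Tendsto (fun n : ℕ =>
        growthRate P F + α * (N * ((n + 1 : ℕ) : ℝ≥0∞)⁻¹ + P (A N))) atTop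
        (𝓝 (growthRate P F + α * (N * 0 + P (A N)))) :=
      tendsto_const_nhds.add (ENNReal.Tendsto.const_mul ((ENNReal.Tendsto.const_mul
        (ENNReal.tendsto_inv_nat_nhds_zero.comp (tendsto_add_atTop_nat 1))
        (Or.inr (by simp))).add tendsto_const_nhds) (Or.inr hαtop))
    rw [mul_zero, zero_add] at h2
    exact ge_of_tendsto' h2 h1
  have hlim : Tendsto (fun N => growthRate P F + α * P (A N)) atTop
      (𝓝 (growthRate P F + α * 0)) :=
    tendsto_const_nhds.add (ENNReal.Tendsto.const_mul hAtend (Or.inr hαtop))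
  rw [mul_zero, add_zero] at hlim
  exact hα.not_ge (ge_of_tendsto' hlim hN)

/-- Sort the starting points by residue modulo `K`: for fixed `i`, the blocks that start at `i`, `i
+ K`, … are disjoint and fill the segment from `i` to `i + q K`. -/
theorem IsSuperadditive.sum_le (hF : IsSuperadditive T F) (K q : ℕ) (ω : Ω) :
    ∑ l ∈ Finset.range (q * K), F K (T^[l] ω) ≤ ∑ i ∈ Finset.range K, F (i + q * K) ω := by
  induction q with
  | zero => simp
  | succ q ih =>
    rw [add_mul, one_mul, Finset.sum_range_add]
    refine (add_le_add_left ih _).trans ?_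
    rw [← Finset.sum_add_distrib]
    refine Finset.sum_le_sum fun i _ => ?_
    have := hF.add_le (i + q * K) K ω
    rwa [add_comm (q * K) i, ← add_assoc]

theorem IsSuperadditive.birkhoffSum_le (hF : IsSuperadditive T F) {K : ℕ} (hK : 0 < K)
    (R : ℝ≥0∞) (n : ℕ) (ω : Ω) :
    ∑ l ∈ Finset.range n, min (F K (T^[l] ω)) R ≤ K * F n ω + 2 * K * R := by
  -- One period fewer than fits, so that blocks shifted by `i < K` still end before `n`; at most
  -- `2K` terms remain, each at most `R`. Truncated subtraction gives `q = 0` for `n < K`.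
  set q := n / K - 1 with hq
  have hdiv := Nat.div_add_mod n K
  have hmod := Nat.mod_lt n hK
  have hqn : q * K ≤ n := (Nat.mul_le_mul_right K (Nat.sub_le _ _)).trans (Nat.div_mul_le_self n K)
  have hrest : n - q * K ≤ 2 * K := by
    rcases Nat.eq_zero_or_pos (n / K) with h0 | h0
    · rw [h0, mul_zero, zero_add] at hdiv
      omega
    · obtain ⟨p, hp⟩ : ∃ p, n / K = p + 1 := ⟨n / K - 1, by omega⟩
      rw [hp, mul_add, mul_one, mul_comm] at hdiv
      rw [hq, hp, Nat.add_sub_cancel]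
      omega
  have h1 : ∑ l ∈ Finset.range (q * K), min (F K (T^[l] ω)) R ≤ K * F n ω := by
    rcases Nat.eq_zero_or_pos q with h0 | h0
    · simp [h0]
    calc ∑ l ∈ Finset.range (q * K), min (F K (T^[l] ω)) R
        ≤ ∑ l ∈ Finset.range (q * K), F K (T^[l] ω) := Finset.sum_le_sum fun _ _ => min_le_left _ _
      _ ≤ ∑ i ∈ Finset.range K, F (i + q * K) ω := hF.sum_le K q ω
      _ ≤ ∑ i ∈ Finset.range K, F n ω := by
        refine Finset.sum_le_sum fun i hi => ?_
        rw [Finset.mem_range] at hi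
        have h2 : (q + 1) * K ≤ n := by
          rw [hq, Nat.sub_add_cancel (by omega)]
          exact Nat.div_mul_le_self n K
        rw [add_mul, one_mul] at h2
        obtain ⟨p, hp⟩ := Nat.exists_eq_add_of_le (show i + q * K ≤ n by omega)
        rw [hp]
        exact hF.le_add _ _ _
      _ = K * F n ω := by simp
  obtain ⟨p, hp⟩ := Nat.exists_eq_add_of_le hqn
  rw [show p = n - q * K by omega] at hp
  conv_lhs => rw [hp, Finset.sum_range_add]
  refine add_le_add h1 ?_
  calc _ ≤ ∑ i ∈ Finset.range (n - q * K), R := Finset.sum_le_sum fun _ _ => min_le_right _ _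
    _ = (n - q * K : ℕ) * R := by simp
    _ ≤ 2 * K * R := by
      gcongr
      exact_mod_cast hrest

/-- For `β` below the growth rate some `K` has `E[F K] > β K`, even after truncation at a finite
`R`. The Birkhoff sums of `R - min(F K, R)` are additive, so the upper bound `limsup_le` applies to
them and bounds the averages of `min(F K, R)` from below. `birkhoffSum_le` carries this over to `F n
/ n`. -/
theorem IsSuperadditive.le_liminf (hT : Ergodic T P) (hF : IsSuperadditive T F) :
    ∀ᵐ ω ∂P, growthRate P F ≤ liminf (fun n : ℕ => F (n + 1) ω / (n + 1 : ℕ)) atTop := by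
  have key : ∀ β : ℝ≥0∞, β < growthRate P F →
      ∀ᵐ ω ∂P, β ≤ liminf (fun n : ℕ => F (n + 1) ω / (n + 1 : ℕ)) atTop := by
    intro β hβ
    obtain ⟨k, hk⟩ := lt_iSup_iff.mp hβ
    set K := k + 1 with hK
    rw [ENNReal.lt_div_iff_mul_lt (by simp) (by simp)] at hk
    have hmono : ∫⁻ ω, F K ω ∂P = ⨆ R : ℕ, ∫⁻ ω, min (F K ω) R ∂P := by
      rw [← lintegral_iSup (fun R => (hF.measurable K).min measurable_const)
        (fun R R' h ω => min_le_min_left _ (by exact_mod_cast h))]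
      refine lintegral_congr fun ω => ?_
      rw [← inf_iSup_eq, ENNReal.iSup_natCast, inf_top_eq]
    rw [hmono] at hk
    obtain ⟨R, hR⟩ := lt_iSup_iff.mp hk
    set f : Ω → ℝ≥0∞ := fun ω => min (F K ω) R with hf
    have hfm : Measurable f := (hF.measurable K).min measurable_const
    have hfR : ∀ ω, f ω ≤ R := fun ω => min_le_right _ _
    set G : ℕ → Ω → ℝ≥0∞ := fun n ω => ∑ i ∈ Finset.range n, (R - f (T^[i] ω)) with hG
    have hGm : ∀ i, Measurable fun ω => (R : ℝ≥0∞) - f (T^[i] ω) := fun i =>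
      (hfm.comp (hT.measurable.iterate i)).const_sub _
    have hGs : IsSuperadditive T G := by
      refine ⟨fun n => Finset.measurable_fun_sum _ fun i _ => hGm i, fun n m ω => ?_⟩
      simp only [hG]
      rw [Finset.sum_range_add]
      refine le_of_eq (congrArg _ (Finset.sum_congr rfl fun i _ => ?_))
      rw [add_comm, Function.iterate_add_apply]
    have hfi : ∫⁻ ω, f ω ∂P ≤ R := (lintegral_mono hfR).trans (by simp)
    have hGi : growthRate P G ≤ R - ∫⁻ ω, f ω ∂P := by
      refine iSup_le fun n => ?_
      rw [ENNReal.div_le_iff (by simp) (by simp)]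
      simp only [hG]
      rw [lintegral_finsetSum _ fun i _ => hGm i]
      have h1 : ∀ i, ∫⁻ ω, (R - f (T^[i] ω)) ∂P = R - ∫⁻ ω, f ω ∂P := fun i => by
        rw [(hT.toMeasurePreserving.iterate i).lintegral_comp (f := fun ω => (R : ℝ≥0∞) - f ω)
          (hfm.const_sub _), lintegral_sub hfm (ne_top_of_le_ne_top (by simp) hfi)
          (Eventually.of_forall hfR)]
        simp
      simp [h1, mul_comm]
    have hβR : β * K ≤ R := hR.le.trans hfi
    have hlt : R - ∫⁻ ω, f ω ∂P < R - β * K := by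
      refine ENNReal.sub_lt_of_lt_add hfi ?_
      calc (R : ℝ≥0∞) = (R - β * K) + β * K := (tsub_add_cancel_of_le hβR).symm
        _ < _ := ENNReal.add_lt_add_left (ne_top_of_le_ne_top (by simp) tsub_le_self) hR
    filter_upwards [hGs.limsup_le hT] with ω hω
    have hev : ∀ᶠ n : ℕ in atTop, β - 2 * R / (n + 1 : ℕ) ≤ F (n + 1) ω / (n + 1 : ℕ) := by
      filter_upwards [eventually_lt_of_limsup_lt ((hω.trans hGi).trans_lt hlt)] with n hn
      have hn' : G (n + 1) ω ≤ (R - β * K) * (n + 1 : ℕ) :=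
        (ENNReal.div_le_iff (by simp) (by simp)).mp hn.le
      have h1 := hF.birkhoffSum_le (K := K) (by omega) R (n + 1) ω
      have h2 : ∑ l ∈ Finset.range (n + 1), min (F K (T^[l] ω)) R + G (n + 1) ω
          = (n + 1 : ℕ) * R := by
        simp only [hG]
        rw [← Finset.sum_add_distrib]
        simp only [hf, add_tsub_cancel_of_le (min_le_right _ _)]
        simp
      have h3 : (K : ℝ≥0∞) * (β * (n + 1 : ℕ)) ≤ K * (F (n + 1) ω + 2 * R) := by
        have h4 : (R - β * K) * ((n + 1 : ℕ) : ℝ≥0∞) ≠ ∞ :=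
          ENNReal.mul_ne_top (ne_top_of_le_ne_top (by simp) tsub_le_self) (by simp)
        refine (ENNReal.add_le_add_iff_right h4).mp ?_
        calc (K : ℝ≥0∞) * (β * (n + 1 : ℕ)) + (R - β * K) * (n + 1 : ℕ)
            = (β * K + (R - β * K)) * (n + 1 : ℕ) := by ring
          _ = (n + 1 : ℕ) * R := by rw [add_tsub_cancel_of_le hβR, mul_comm]
          _ ≤ (K * F (n + 1) ω + 2 * K * R) + (R - β * K) * (n + 1 : ℕ) := by
            rw [← h2]
            exact add_le_add h1 hn'
          _ = _ := by ring
      rw [ENNReal.mul_le_mul_iff_right (by simp [hK]) (by simp)] at h3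
      rw [tsub_le_iff_right, ← ENNReal.add_div, ENNReal.le_div_iff_mul_le (by simp) (by simp)]
      exact h3
    have hlim : Tendsto (fun n : ℕ => β - 2 * R / ((n + 1 : ℕ) : ℝ≥0∞)) atTop (𝓝 (β - 0)) := by
      refine ENNReal.Tendsto.sub tendsto_const_nhds ?_ (Or.inr (by simp))
      have := ENNReal.Tendsto.const_mul (a := 2 * (R : ℝ≥0∞))
        (ENNReal.tendsto_inv_nat_nhds_zero.comp (tendsto_add_atTop_nat 1))
        (Or.inr (ENNReal.mul_ne_top (by simp) (by simp)))
      rwa [mul_zero] at this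
    rw [tsub_zero] at hlim
    rw [← hlim.liminf_eq]
    exact liminf_le_liminf hev
  have h1 : ∀ q : ℚ, ∀ᵐ ω ∂P, ((q : ℝ).toNNReal : ℝ≥0∞) < growthRate P F →
      ((q : ℝ).toNNReal : ℝ≥0∞) ≤ liminf (fun n : ℕ => F (n + 1) ω / (n + 1 : ℕ)) atTop := fun q => by
    by_cases hq : ((q : ℝ).toNNReal : ℝ≥0∞) < growthRate P F
    · exact (key _ hq).mono fun ω h _ => h
    · exact Eventually.of_forall fun ω h => absurd h hq
  filter_upwards [ae_all_iff.mpr h1] with ω hω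
  refine not_lt.mp fun hlt => ?_
  obtain ⟨q, -, hq1, hq2⟩ := ENNReal.lt_iff_exists_rat_btwn.mp hlt
  exact (hω q hq2).not_gt hq1

/-- The superadditive ergodic theorem for nonnegative processes. -/
theorem IsSuperadditive.tendsto_growthRate (hT : Ergodic T P) (hF : IsSuperadditive T F) :
    ∀ᵐ ω ∂P, Tendsto (fun n : ℕ => F (n + 1) ω / (n + 1 : ℕ)) atTop (𝓝 (growthRate P F)) := by
  filter_upwards [hF.limsup_le hT, hF.le_liminf hT] with ω h1 h2
  exact tendsto_of_le_liminf_of_limsup_le h2 h1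

end Superadditive

set_option linter.unusedSectionVars false

/-! ### Contracting products of positive maps -/

namespace TraceL1

variable {A : Type*} [CStarAlgebra A] [PartialOrder A] [StarOrderedRing A] {τ : A →L[ℂ] ℂ}
  {g h : TraceL1 τ → TraceL1 τ}

theorem isClosed_states : IsClosed (states τ) :=
  isClosed_isPos.inter (isClosed_singleton.preimage continuous_trace)

/-- The normalised functional `a ↦ τ(g(a)) / τ(g(1))`. -/
noncomputable def ratio (g : TraceL1 τ → TraceL1 τ) (a : A) : ℂ :=
  (g (of τ 1)).trace⁻¹ * (g (of τ a)).trace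

theorem FaithfulPositive.tr_of_one_pos (hτ : IsFaithfulTracialState τ) (hg : FaithfulPositive g) :
    0 < (g (of τ 1)).tr :=
  (hg.positive _ (.of_nonneg hτ zero_le_one)).tr_pos (hg.ne_zero (of_one_mem_states hτ))

theorem ratio_eq (hτ : IsFaithfulTracialState τ) (hg : FaithfulPositive g) {a : A} (ha : 0 ≤ a) :
    ratio g a = (((g (of τ a)).tr / (g (of τ 1)).tr : ℝ) : ℂ) := by
  rw [ratio, (hg.positive _ (.of_nonneg hτ ha)).eq_tr,
    (hg.positive _ (.of_nonneg hτ zero_le_one)).eq_tr]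
  push_cast
  ring

theorem ratio_one (hτ : IsFaithfulTracialState τ) (hg : FaithfulPositive g) : ratio g 1 = 1 := by
  rw [ratio_eq hτ hg zero_le_one, div_self (hg.tr_of_one_pos hτ).ne', Complex.ofReal_one]

/-- A map as a continuous linear map. -/
noncomputable def FaithfulPositive.toCLM (hg : FaithfulPositive g) (hc : Continuous g) :
    TraceL1 τ →L[ℂ] TraceL1 τ := ⟨hg.linear.mk', hc⟩

/-- The functional `ratio g` as a continuous linear functional. -/
noncomputable def ratioCLM (hg : FaithfulPositive g) (hc : Continuous g) : A →L[ℂ] ℂ :=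
  (g (of τ 1)).trace⁻¹ • ((pairCLM τ 1).comp (hg.toCLM hc)).comp (ofCLM τ)

theorem ratioCLM_apply (hg : FaithfulPositive g) (hc : Continuous g) (a : A) :
    ratioCLM hg hc a = ratio g a := rfl

theorem isPosFunctional_ratioCLM (hτ : IsFaithfulTracialState τ) (hg : FaithfulPositive g)
    (hc : Continuous g) : IsPosFunctional (ratioCLM hg hc) := by
  rw [isPosFunctional_iff]
  intro a ha
  rw [ratioCLM_apply, ratio_eq hτ hg ha]
  have h1 := (hg.positive _ (.of_nonneg hτ ha)).tr_nonneg
  have h2 := (hg.tr_of_one_pos hτ).le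
  exact_mod_cast div_nonneg h1 h2

theorem tr_of_le (hτ : IsFaithfulTracialState τ) (hg : FaithfulPositive g) {a : A} (ha : 0 ≤ a) :
    (g (of τ a)).tr ≤ ‖a‖ * (g (of τ 1)).tr := by
  have h1 : 0 ≤ algebraMap ℝ A ‖a‖ - a :=
    sub_nonneg.mpr (IsSelfAdjoint.le_algebraMap_norm_self (.of_nonneg ha))
  have h2 := (hg.positive _ (.of_nonneg hτ h1)).tr_nonneg
  have h3 : of τ (algebraMap ℝ A ‖a‖ - a) = ((‖a‖ : ℝ) : ℂ) • of τ 1 - of τ a := by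
    rw [← ofCLM_apply, map_sub, Algebra.algebraMap_eq_smul_one, ← Complex.coe_smul, map_smul]
    rfl
  rw [h3, hg.linear.map_sub, hg.linear.map_smul, tr_sub, tr_smul] at h2
  linarith

theorem norm_ratio_le (hτ : IsFaithfulTracialState τ) (hg : FaithfulPositive g) {a : A}
    (ha : 0 ≤ a) : ‖ratio g a‖ ≤ ‖a‖ := by
  have h1 := hg.tr_of_one_pos hτ
  have h2 := (hg.positive _ (.of_nonneg hτ ha)).tr_nonneg
  rw [ratio_eq hτ hg ha, Complex.norm_real, Real.norm_of_nonneg (by positivity), div_le_iff₀ h1]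
  exact tr_of_le hτ hg ha

theorem projAction_of_mem_states (hτ : IsFaithfulTracialState τ) (hg : FaithfulPositive g) {a : A}
    (ha : 0 ≤ a) (ha0 : a ≠ 0) : ∃ u ∈ states τ, projAction g u = projAction g (of τ a) := by
  have h1 := IsPos.of_nonneg hτ ha
  have h2 := of_ne_zero hτ ha ha0
  exact ⟨_, normalize_mem_states h1 h2, projAction_smul hg (inv_ne_zero (h1.tr_pos h2).ne')⟩

/-- As `r, s ≤ 1`, each is at least `(1 - c) / (1 + c)`. So `p / q` lies between this number and its
inverse, which is at most `1 + 4c` for `c ≤ 1/2`. -/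
theorem abs_div_sub_one_le {c r s p q : ℝ} (hc0 : 0 ≤ c) (hc : c ≤ 1 / 2) (hr0 : 0 ≤ r)
    (hr1 : r ≤ 1) (hs0 : 0 ≤ s) (hs1 : s ≤ 1) (hrs : (1 - c) / (1 + c) ≤ r * s) (hp : 0 < p)
    (hq : 0 < q) (hr : 0 ≤ p - r * q) (hs : 0 ≤ q - s * p) : |p / q - 1| ≤ 4 * c := by
  rw [div_le_iff₀ (by linarith)] at hrs
  have h1 : r * s * (1 + c) ≤ r * (1 + c) :=
    mul_le_mul_of_nonneg_right (mul_le_of_le_one_right hr0 hs1) (by linarith)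
  have h2 : r * s * (1 + c) ≤ s * (1 + c) :=
    mul_le_mul_of_nonneg_right (mul_le_of_le_one_left hs0 hr1) (by linarith)
  have e1 : 1 - 2 * c ≤ r := by nlinarith
  have e2 : (1 - c) * p ≤ s * (1 + c) * p := mul_le_mul_of_nonneg_right (by linarith) hp.le
  have e3 : (1 - c) * p ≤ (1 + c) * q := by nlinarith
  rw [abs_le, neg_le_sub_iff_le_add, sub_le_iff_le_add, div_le_iff₀ hq,
    ← sub_le_iff_le_add, le_div_iff₀ hq]
  constructor
  · nlinarith [mul_le_mul_of_nonneg_right e1 hq.le, mul_nonneg hc0 hq.le]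
  · have e4 : (1 + c) * q ≤ (1 - c) * ((4 * c + 1) * q) := by
      nlinarith [mul_nonneg (mul_nonneg hc0 (by linarith : (0 : ℝ) ≤ 1 - 2 * c)) hq.le]
    exact le_of_mul_le_mul_left (e3.trans e4) (by linarith)

/-- The ratio functional changes by a bounded factor under composition with a further map. -/
theorem ratio_comp_eq (hτ : IsFaithfulTracialState τ) (hg : FaithfulPositive g)
    (hh : FaithfulPositive h) {a : A} (ha : 0 ≤ a) (hc : contractionConst g ≤ 1 / 2) :
    ∃ q : ℝ, |q - 1| ≤ 4 * contractionConst g ∧ ratio (h ∘ g) a = q * ratio g a := by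
  set c := contractionConst g with hcdef
  have hc0 : 0 ≤ c := contractionConst_nonneg hg
  by_cases ha0 : a = 0
  · refine ⟨1, by simpa using hc0, ?_⟩
    have h0 : of τ (0 : A) = 0 := (ofCLM τ).map_zero
    rw [ha0, ratio, ratio, h0, hg.linear.map_zero, show (h ∘ g) 0 = h (g 0) from rfl, hg.linear.map_zero,
      hh.linear.map_zero, trace_zero, mul_zero, mul_zero, mul_zero]
  obtain ⟨u, hu, hux⟩ := projAction_of_mem_states hτ hg ha ha0
  have h1 := of_one_mem_states hτ
  have hd := hennionDist_le_contractionConst hg hu h1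
  have hx := projAction_mem_states hg hu
  have hy := projAction_mem_states hg h1
  set x := projAction g u with hxdef
  set y := projAction g (of τ 1) with hydef
  have hrs := le_mQuantity_mul_of_hennionDist_le hx hy hd (by linarith)
  -- The directions `x` of `g(a)` and `y` of `g(1)` dominate multiples of each other, and `h` keeps
  -- these inequalities. Hence `τ(h(x)) / τ(h(y))`, the factor sought, is close to 1.
  have hr := hh.positive _ (isPos_sub_mQuantity hx hy)
  have hs := hh.positive _ (isPos_sub_mQuantity hy hx)
  have hr0 := mQuantity_nonneg hx hy
  have hs0 := mQuantity_nonneg hy hx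
  have hr1 := mQuantity_le_one hx hy
  have hs1 := mQuantity_le_one hy hx
  set r := mQuantity x y
  set s := mQuantity y x
  have hr := hr.tr_nonneg
  have hs := hs.tr_nonneg
  rw [hh.linear.map_sub, hh.linear.map_smul, tr_sub, tr_smul] at hr hs
  have hhx := (hh.positive x hx.1).tr_pos (hh.ne_zero hx)
  have hhy := (hh.positive y hy.1).tr_pos (hh.ne_zero hy)
  have hga := (hg.positive _ (.of_nonneg hτ ha)).tr_pos
    (fun h0 => of_ne_zero hτ ha ha0 (hg.faithful _ (.of_nonneg hτ ha) h0))
  have hg1 := hg.tr_of_one_pos hτ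
  refine ⟨(h x).tr / (h y).tr, ?_, ?_⟩
  · exact abs_div_sub_one_le hc0 hc hr0 hr1 hs0 hs1 hrs hhx hhy hr hs
  · have e1 : (h (g (of τ a))).tr = (g (of τ a)).tr * (h x).tr := by
      rw [hux, projAction_eq hg (.of_nonneg hτ ha), hh.linear.map_smul, tr_smul, ← mul_assoc,
        mul_inv_cancel₀ hga.ne', one_mul]
    have e2 : (h (g (of τ 1))).tr = (g (of τ 1)).tr * (h y).tr := by
      rw [hydef, projAction_eq hg h1.1, hh.linear.map_smul, tr_smul, ← mul_assoc,
        mul_inv_cancel₀ hg1.ne', one_mul]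
    rw [ratio_eq hτ hg ha, ratio_eq hτ (hh.comp hg) ha, Function.comp_apply, Function.comp_apply,
      e1, e2, ← Complex.ofReal_mul]
    congr 1
    field_simp

/-- For `c > 1/2` the trivial bound `2‖a‖` is below `4c‖a‖`, so no smallness of `c` is needed. -/
theorem norm_ratio_comp_sub_le (hτ : IsFaithfulTracialState τ) (hg : FaithfulPositive g)
    (hh : FaithfulPositive h) {a : A} (ha : 0 ≤ a) :
    ‖ratio (h ∘ g) a - ratio g a‖ ≤ 4 * contractionConst g * ‖a‖ := by
  have h2 := norm_ratio_le hτ hg ha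
  rcases le_total (contractionConst g) (1 / 2) with hc | hc
  · obtain ⟨q, hq, h1⟩ := ratio_comp_eq hτ hg hh ha hc
    have h3 : ratio (h ∘ g) a - ratio g a = ((q - 1 : ℝ) : ℂ) * ratio g a := by
      rw [h1]; push_cast; ring
    rw [h3, norm_mul, Complex.norm_real, Real.norm_eq_abs]
    exact mul_le_mul hq h2 (norm_nonneg _) (by linarith [contractionConst_nonneg hg])
  · refine (norm_sub_le _ _).trans ?_
    have h1 := norm_ratio_le hτ (hh.comp hg) ha
    nlinarith [norm_nonneg a]

/-- Products `u k = u j ∘ v` with contraction constants tending to zero have a limit direction,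
which lies in the algebra. -/
theorem exists_limit_state (hτ : IsFaithfulTracialState τ) (hd : HasBoundedDensities τ)
    (u : ℕ → TraceL1 τ → TraceL1 τ) (hu : ∀ j, FaithfulPositive (u j))
    (hpres : ∀ j, PreservesAlgebra (u j))
    (hcomp : ∀ j k, j < k → ∃ v, FaithfulPositive v ∧ u k = u j ∘ v)
    (hlim : Tendsto (fun j => contractionConst (u j)) atTop (𝓝 0)) :
    ∃ X ∈ boundedStates τ, Tendsto (fun j => projAction (u j) (of τ 1)) atTop (𝓝 X) ∧
      ∀ j, ∀ x ∈ states τ, ‖projAction (u j) x - X‖ ≤ 4 * contractionConst (u j) := by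
  have h1 := of_one_mem_states hτ
  set x : ℕ → TraceL1 τ := fun j => projAction (u j) (of τ 1) with hx
  have hxS : ∀ j, x j ∈ states τ := fun j => projAction_mem_states (hu j) h1
  have hfac : ∀ j k, j ≤ k → ∃ y ∈ states τ, x k = projAction (u j) y := fun j k hjk => by
    rcases hjk.eq_or_lt with rfl | hlt
    · exact ⟨_, h1, rfl⟩
    · obtain ⟨v, hv, huv⟩ := hcomp j k hlt
      refine ⟨_, projAction_mem_states hv h1, ?_⟩
      rw [hx, ← projAction_comp (hu j) hv h1, ← huv]
  have hdist : ∀ j k, j ≤ k → ∀ y ∈ states τ,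
      ‖projAction (u j) y - x k‖ ≤ 4 * contractionConst (u j) := fun j k hjk y hy => by
    obtain ⟨z, hz, hxz⟩ := hfac j k hjk
    rw [hxz]
    exact norm_projAction_sub_le (hu j) hy hz
  have hlim4 : Tendsto (fun j => 4 * contractionConst (u j)) atTop (𝓝 0) := by
    simpa using hlim.const_mul 4
  have hcau : CauchySeq x := cauchySeq_of_le_tendsto_0' (fun j => 4 * contractionConst (u j))
    (fun j k hjk => by
      rw [dist_eq_norm]
      exact hdist j k hjk _ h1) hlim4
  obtain ⟨X, hX⟩ := cauchySeq_tendsto_of_complete hcau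
  have hXS : X ∈ states τ := isClosed_states.mem_of_tendsto hX (Eventually.of_forall hxS)
  refine ⟨X, ⟨hXS, ?_⟩, hX, fun j y hy => ?_⟩
  -- Distance at most `1/2` means `m m' ≥ (1 - 1/2) / (1 + 1/2) = 1/3`, so `x k ≤ 3 x j` for `k ≥ j`
  -- and in the limit `X ≤ 3 x j`. Since `x j` is an element `b` of `A`, this bounds `X` by `3‖b‖
  -- τ`.
  · obtain ⟨j, hj⟩ := (hlim.eventually (gt_mem_nhds (show (0 : ℝ) < 1 / 2 by norm_num))).exists
    obtain ⟨b, hb⟩ : x j ∈ range (of τ) := by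
      obtain ⟨b, hb⟩ := hpres j 1
      refine ⟨(u j (of τ 1)).trace⁻¹ • b, ?_⟩
      change _ = projAction (u j) (of τ 1)
      rw [projAction_def, ← hb, ← ofCLM_apply, map_smul]
      rfl
    have hpos : (x j - ((1 / 3 : ℝ) : ℂ) • X).IsPos := by
      refine isClosed_isPos.mem_of_tendsto (f := fun k => x j - ((1 / 3 : ℝ) : ℂ) • x k)
        (tendsto_const_nhds.sub (hX.const_smul _)) ?_
      filter_upwards [eventually_ge_atTop j] with k hk
      obtain ⟨z, hz, hxz⟩ := hfac j k hk
      have h2 := le_mQuantity_mul_of_hennionDist_le (hxS j) (hxS k)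
        ((by rw [hxz]; exact hennionDist_le_contractionConst (hu j) h1 hz :
          hennionDist (x j) (x k) ≤ contractionConst (u j)).trans hj.le) (by norm_num)
      have h3 : (1 / 3 : ℝ) ≤ mQuantity (x j) (x k) := by
        refine le_trans ?_ (h2.trans (mul_le_of_le_one_right (mQuantity_nonneg (hxS j) (hxS k))
          (mQuantity_le_one (hxS k) (hxS j))))
        norm_num
      have h4 := (isPos_sub_mQuantity (hxS j) (hxS k)).add
        ((hxS k).1.smul (sub_nonneg.mpr h3))
      convert h4 using 1
      push_cast
      module
    have hle : ∀ a : A, 0 ≤ a → (X.pair a).re ≤ 3 * ‖b‖ * (τ a).re := fun a ha => by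
      have h2 := (Complex.nonneg_iff.mp (hpos.pair_nonneg ha)).1
      rw [pair_sub, pair_smul, Complex.sub_re, Complex.re_ofReal_mul, ← hb, pair_of] at h2
      have h3 : (τ (b * a)).re ≤ (τ a).re * ‖b‖ := by
        refine (Complex.re_le_norm _).trans ?_
        rw [hτ.trace]
        have := (hτ.isPosFunctional_traceFunctional ha).norm_apply_le b
        rwa [traceFunctional_apply, traceFunctional_apply, mul_one] at this
      linarith
    obtain ⟨d, hd⟩ := hd X hXS.1.functional (3 * ‖b‖) (by positivity) hle
    exact ⟨d, Subtype.ext hd.symm⟩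
  · refine le_of_tendsto (tendsto_const_nhds.sub hX).norm ?_
    filter_upwards [eventually_ge_atTop j] with k hk
    exact hdist j k hk y hy

/-- Products `u k = v ∘ u j` with contraction constants tending to zero have a limit functional,
which is given by an element of the algebra. -/
theorem exists_limit_functional (hτ : IsFaithfulTracialState τ) (hd : HasBoundedDensities τ)
    (u : ℕ → TraceL1 τ → TraceL1 τ) (hu : ∀ j, FaithfulPositive (u j))
    (hcont : ∀ j, Continuous (u j))
    (hcomp : ∀ j k, j < k → ∃ v, FaithfulPositive v ∧ u k = v ∘ u j)
    (hlim : Tendsto (fun j => contractionConst (u j)) atTop (𝓝 0)) :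
    ∃ B ∈ boundedStates τ, (∀ a, Tendsto (fun j => ratio (u j) a) atTop (𝓝 (B.pair a))) ∧
      ∀ j, ∀ a : A, 0 ≤ a → ‖ratio (u j) a - B.pair a‖ ≤ 4 * contractionConst (u j) * ‖a‖ := by
  set ψ : ℕ → A →L[ℂ] ℂ := fun j => ratioCLM (hu j) (hcont j) with hψ
  have hψa : ∀ j a, ψ j a = ratio (u j) a := fun _ _ => rfl
  have hdist : ∀ j k, j ≤ k → ∀ a : A, 0 ≤ a →
      ‖ratio (u j) a - ratio (u k) a‖ ≤ 4 * contractionConst (u j) * ‖a‖ := fun j k hjk a ha => by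
    rcases hjk.eq_or_lt with rfl | hlt
    · rw [sub_self, norm_zero]
      have := contractionConst_nonneg (hu j)
      positivity
    · obtain ⟨v, hv, huv⟩ := hcomp j k hlt
      rw [norm_sub_rev, huv]
      exact norm_ratio_comp_sub_le hτ (hu j) hv ha
  -- The estimate for positive elements is `4c`; a further factor 4 passes to all of `A`, hence to
  -- the dual norm.
  have hlim16 : Tendsto (fun j => 4 * (4 * contractionConst (u j))) atTop (𝓝 0) := by
    simpa using (hlim.const_mul 4).const_mul 4
  have hcau : CauchySeq ψ := cauchySeq_of_le_tendsto_0'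
    (fun j => 4 * (4 * contractionConst (u j))) (fun j k hjk => by
      have h0 := contractionConst_nonneg (hu j)
      rw [dist_eq_norm]
      refine (ψ j - ψ k).opNorm_le_bound (by positivity) fun a => ?_
      exact norm_le_four_mul_of_nonneg (ψ j - ψ k).toLinearMap (by positivity)
        (fun a ha => hdist j k hjk a ha) a) hlim16
  obtain ⟨φ, hφ⟩ := cauchySeq_tendsto_of_complete hcau
  have hφa : ∀ a, Tendsto (fun j => ratio (u j) a) atTop (𝓝 (φ a)) := fun a =>
    ((ContinuousLinearMap.apply ℂ ℂ a).continuous.tendsto φ).comp hφ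
  have hφpos : IsPosFunctional φ := fun b =>
    ge_of_tendsto' (hφa _) fun j => isPosFunctional_ratioCLM hτ (hu j) (hcont j) b
  have hφ1 : φ 1 = 1 := by
    refine tendsto_nhds_unique (hφa 1) ?_
    simp only [ratio_one hτ (hu _)]
    exact tendsto_const_nhds
  obtain ⟨j, hj⟩ := (hlim.eventually (gt_mem_nhds (show (0 : ℝ) < 1 / 2 by norm_num))).exists
  set K := ‖(hu j).toCLM (hcont j)‖ with hK
  have h1 := (hu j).tr_of_one_pos hτ
  -- With `c ≤ 1/2` the factor `q` is at most 3, and boundedness of `u j` gives `τ(u_j(a)) ≤ K ‖a‖₁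
  -- = K τ(a)` for positive `a`. So the limit is dominated by a multiple of `τ`.
  have hle : ∀ a : A, 0 ≤ a → (φ a).re ≤ 3 * K / (u j (of τ 1)).tr * (τ a).re := fun a ha => by
    refine le_of_tendsto ((Complex.continuous_re.tendsto _).comp (hφa a)) ?_
    filter_upwards [eventually_gt_atTop j] with k hk
    obtain ⟨v, hv, huv⟩ := hcomp j k hk
    obtain ⟨q, hq, hqe⟩ := ratio_comp_eq hτ (hu j) hv ha hj.le
    have hpos := (hu j).positive _ (.of_nonneg hτ ha)
    have h2 : (u j (of τ a)).tr ≤ K * (τ a).re := by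
      rw [← hpos.norm_eq, ← tr_of, ← (IsPos.of_nonneg hτ ha).norm_eq]
      exact ((hu j).toCLM (hcont j)).le_opNorm _
    have hq3 : q ≤ 3 := by
      have := (abs_le.mp hq).2
      linarith
    simp only [Function.comp_apply]
    rw [huv, hqe, ratio_eq hτ (hu j) ha, ← Complex.ofReal_mul, Complex.ofReal_re,
      div_mul_eq_mul_div, ← mul_div_assoc]
    refine div_le_div_of_nonneg_right ?_ h1.le
    rw [mul_assoc]
    exact mul_le_mul hq3 h2 hpos.tr_nonneg (by norm_num)
  obtain ⟨d, hd⟩ := hd φ hφpos (3 * K / (u j (of τ 1)).tr) (by positivity) hle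
  have hB : ∀ a, (of τ d).pair a = φ a := fun a => by rw [hd]; rfl
  refine ⟨of τ d, ⟨⟨fun b => ?_, ?_⟩, d, rfl⟩, fun a => ?_, fun j a ha => ?_⟩
  · rw [hB]
    exact hφpos b
  · exact (hB 1).trans hφ1
  · rw [hB]
    exact hφa a
  · rw [hB]
    refine le_of_tendsto (tendsto_const_nhds.sub (hφa a)).norm ?_
    filter_upwards [eventually_ge_atTop j] with k hk
    exact hdist j k hk a ha

/-- The rank one approximation of a contracting map. -/
theorem norm_sub_rank_one_le (hτ : IsFaithfulTracialState τ) (hg : FaithfulPositive g)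
    {X B : TraceL1 τ} (hX : X ∈ states τ)
    (hgX : ∀ x ∈ states τ, ‖projAction g x - X‖ ≤ 4 * contractionConst g)
    (hgB : ∀ a : A, 0 ≤ a → ‖ratio g a - B.pair a‖ ≤ 4 * contractionConst g * ‖a‖) (a : A) :
    ‖(g (of τ 1)).trace⁻¹ • g (of τ a) - B.pair a • X‖ ≤ 32 * contractionConst g * ‖a‖ := by
  have hc0 := contractionConst_nonneg hg
  let f : A →ₗ[ℂ] TraceL1 τ :=
    (g (of τ 1)).trace⁻¹ • (hg.linear.mk'.comp (ofCLM τ).toLinearMap)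
      - (LinearMap.toSpanSingleton ℂ (TraceL1 τ) X).comp (B : StrongDual ℂ A).toLinearMap
  have hf : ∀ a, f a = (g (of τ 1)).trace⁻¹ • g (of τ a) - B.pair a • X := fun a => rfl
  rw [← hf]
  -- On positive elements the errors of direction and of functional contribute `4c` each; passing to
  -- all of `A` multiplies `8c` by 4.
  refine (norm_le_four_mul_of_nonneg f (C := 8 * contractionConst g) (by positivity)
    (fun a ha => ?_) a).trans_eq (by ring)
  by_cases ha0 : a = 0
  · rw [ha0, map_zero, norm_zero, norm_zero, mul_zero]
  obtain ⟨u, hu, hux⟩ := projAction_of_mem_states hτ hg ha ha0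
  have hpos := hg.positive _ (.of_nonneg hτ ha)
  have hne : g (of τ a) ≠ 0 :=
    fun h0 => of_ne_zero hτ ha ha0 (hg.faithful _ (.of_nonneg hτ ha) h0)
  have htr : (g (of τ a)).trace ≠ 0 := by
    rw [hpos.eq_tr]
    exact_mod_cast (hpos.tr_pos hne).ne'
  have h1 : (g (of τ 1)).trace⁻¹ • g (of τ a) = ratio g a • projAction g (of τ a) := by
    rw [ratio, projAction_def, smul_smul, mul_assoc, mul_inv_cancel₀ htr, mul_one]
  have h2 : ratio g a • projAction g (of τ a) - B.pair a • X
      = ratio g a • (projAction g (of τ a) - X) + (ratio g a - B.pair a) • X := by module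
  rw [hf, h1, h2]
  refine (norm_add_le _ _).trans ?_
  rw [norm_smul, norm_smul, norm_of_mem hX, mul_one, ← hux]
  calc _ ≤ ‖a‖ * (4 * contractionConst g) + 4 * contractionConst g * ‖a‖ :=
        add_le_add (mul_le_mul (norm_ratio_le hτ hg ha) (hgX u hu) (norm_nonneg _)
          (norm_nonneg _)) (hgB a ha)
    _ = _ := by ring

end TraceL1

set_option linter.unusedSectionVars false

/-! ### Submultiplicative cocycles with values in the unit interval -/

section NegLog

open scoped ENNReal

/-- `-log r` for `r ≥ 0`, with value `∞` at `r = 0`. -/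
noncomputable def negLog (r : ℝ) : ℝ≥0∞ := if r ≤ 0 then ⊤ else ENNReal.ofReal (-Real.log r)

/-- `exp (-x)` for `x ∈ [0, ∞]`. -/
noncomputable def expNeg (x : ℝ≥0∞) : ℝ := (EReal.exp (-(x : EReal))).toReal

theorem measurable_negLog : Measurable negLog :=
  Measurable.ite measurableSet_Iic measurable_const (by fun_prop)

theorem negLog_eq_zero_iff {r : ℝ} : negLog r = 0 ↔ 1 ≤ r := by
  rw [negLog]
  split_ifs with h
  · simp only [ENNReal.top_ne_zero, false_iff, not_le]
    linarith
  · rw [ENNReal.ofReal_eq_zero, neg_nonpos, Real.log_nonneg_iff (not_le.mp h)]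

theorem negLog_add_le {r s t : ℝ} (hr : r ≤ 1) (hs : s ≤ 1) (hr0 : 0 ≤ r) (hs0 : 0 ≤ s)
    (h : t ≤ r * s) : negLog r + negLog s ≤ negLog t := by
  by_cases ht : t ≤ 0
  · rw [negLog, negLog, negLog, if_pos ht]
    exact le_top
  have hr1 : 0 < r := hr0.lt_of_ne' fun h0 => ht (by rwa [h0, zero_mul] at h)
  have hs1 : 0 < s := hs0.lt_of_ne' fun h0 => ht (by rwa [h0, mul_zero] at h)
  rw [negLog, negLog, negLog, if_neg ht, if_neg hr1.not_ge, if_neg hs1.not_ge,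
    ← ENNReal.ofReal_add (neg_nonneg.mpr (Real.log_nonpos hr0 hr))
      (neg_nonneg.mpr (Real.log_nonpos hs0 hs))]
  refine ENNReal.ofReal_le_ofReal ?_
  have := Real.log_le_log (not_le.mp ht) h
  rw [Real.log_mul hr1.ne' hs1.ne'] at this
  linarith

theorem expNeg_top : expNeg ⊤ = 0 := by simp [expNeg]

theorem expNeg_of_ne_top {x : ℝ≥0∞} (h : x ≠ ⊤) : expNeg x = Real.exp (-x.toReal) := by
  rw [expNeg, ← EReal.coe_ennreal_toReal h, ← EReal.coe_neg, EReal.exp_coe,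
    ENNReal.toReal_ofReal (Real.exp_pos _).le]

theorem expNeg_nonneg (x : ℝ≥0∞) : 0 ≤ expNeg x := ENNReal.toReal_nonneg

theorem expNeg_lt_one {x : ℝ≥0∞} (h : x ≠ 0) : expNeg x < 1 := by
  by_cases hx : x = ⊤
  · rw [hx, expNeg_top]
    exact one_pos
  · rw [expNeg_of_ne_top hx, Real.exp_lt_one_iff, neg_lt_zero]
    exact ENNReal.toReal_pos h hx

/-- Continuity at `∞` matters: an infinite growth rate corresponds to `C = 0`. -/
theorem continuous_expNeg : Continuous expNeg := by
  rw [continuous_iff_continuousAt]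
  intro x
  have h : EReal.exp (-(x : EReal)) ≠ ⊤ := by
    by_cases hx : x = ⊤
    · simp [hx]
    · rw [← EReal.coe_ennreal_toReal hx, ← EReal.coe_neg, EReal.exp_coe]
      exact ENNReal.ofReal_ne_top
  refine (ENNReal.tendsto_toReal h).comp ?_
  exact (ENNReal.continuous_exp.comp
    (continuous_neg.comp continuous_coe_ennreal_ereal)).continuousAt

theorem expNeg_negLog_div {r : ℝ} (h0 : 0 ≤ r) (h1 : r ≤ 1) (n : ℕ) :
    expNeg (negLog r / (n + 1 : ℕ)) = r ^ (1 / ((n + 1 : ℕ) : ℝ)) := by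
  rcases h0.eq_or_lt with rfl | h0
  · rw [negLog, if_pos le_rfl, ENNReal.top_div_of_ne_top (ENNReal.natCast_ne_top _), expNeg_top,
      Real.zero_rpow (by positivity)]
  · rw [negLog, if_neg h0.not_ge, expNeg_of_ne_top
      (ENNReal.div_ne_top ENNReal.ofReal_ne_top (by simp)), ENNReal.toReal_div,
      ENNReal.toReal_ofReal (neg_nonneg.mpr (Real.log_nonpos h0.le h1)), ENNReal.toReal_natCast,
      Real.rpow_def_of_pos h0]
    congr 1
    ring

end NegLog

/-! ### Exponential rates of submultiplicative cocycles -/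

section Submultiplicative

open scoped ENNReal

variable {Ω : Type*} [MeasurableSpace Ω]

/-- A submultiplicative cocycle over `T` with values in `[0, 1]`; the index `j` stands for
products with `j + 1` factors. -/
structure IsSubmultiplicative (T : Ω → Ω) (f : ℕ → Ω → ℝ) : Prop where
  measurable : ∀ j, Measurable (f j)
  nonneg : ∀ j ω, 0 ≤ f j ω
  le_one : ∀ j ω, f j ω ≤ 1
  le_mul : ∀ i j ω, f (i + 1 + j) ω ≤ f j (T^[i + 1] ω) * f i ω

/-- The process `-log f`. -/
noncomputable def negLogSeq (f : ℕ → Ω → ℝ) : ℕ → Ω → ℝ≥0∞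
  | 0 => 0
  | j + 1 => fun ω => negLog (f j ω)

theorem IsSubmultiplicative.isSuperadditive {T : Ω → Ω} {f : ℕ → Ω → ℝ}
    (hf : IsSubmultiplicative T f) : IsSuperadditive T (negLogSeq f) where
  measurable n := by
    cases n with
    | zero => exact measurable_const
    | succ n => exact measurable_negLog.comp (hf.measurable n)
  add_le n m ω := by
    cases n with
    | zero => simp [negLogSeq]
    | succ i =>
      cases m with
      | zero => simp [negLogSeq]
      | succ j =>
        rw [← add_assoc, add_right_comm i 1 j, add_comm (negLogSeq f (i + 1) ω),
          show i + j + 1 = i + 1 + j by ring]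
        exact negLog_add_le (hf.le_one _ _) (hf.le_one _ _) (hf.nonneg _ _) (hf.nonneg _ _)
          (hf.le_mul i j ω)

variable {P : Measure Ω} [IsProbabilityMeasure P]

theorem IsSubmultiplicative.tendsto_rpow {T : Ω → Ω} {f : ℕ → Ω → ℝ}
    (hf : IsSubmultiplicative T f) (hT : Ergodic T P) :
    ∀ᵐ ω ∂P, Tendsto (fun j : ℕ => f j ω ^ (1 / ((j + 1 : ℕ) : ℝ))) atTop
      (𝓝 (expNeg (growthRate P (negLogSeq f)))) := by
  filter_upwards [hf.isSuperadditive.tendsto_growthRate hT] with ω hω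
  refine ((continuous_expNeg.tendsto _).comp hω).congr fun j => ?_
  exact expNeg_negLog_div (hf.nonneg j ω) (hf.le_one j ω) j

/-- Products are indexed by their last point instead of their first; over `T⁻¹` the two factors of
the cocycle inequality exchange their roles. -/
theorem IsSubmultiplicative.reverse {T : Ω ≃ᵐ Ω} {f : ℕ → Ω → ℝ}
    (hf : IsSubmultiplicative T f) :
    IsSubmultiplicative T.symm (fun j ω => f j (T.symm^[j] ω)) where
  measurable j := (hf.measurable j).comp (T.symm.measurable.iterate j)
  nonneg j ω := hf.nonneg j _
  le_one j ω := hf.le_one j _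
  le_mul i j ω := by
    have h := hf.le_mul j i (T.symm^[i + 1 + j] ω)
    have h1 : T^[j + 1] (T.symm^[i + 1 + j] ω) = T.symm^[i] ω := by
      rw [show i + 1 + j = j + 1 + i by ring,
        Function.iterate_add_apply T.symm (j + 1) i]
      exact (Function.LeftInverse.iterate (fun x => T.apply_symm_apply x) (j + 1)) _
    rw [h1, show j + 1 + i = i + 1 + j by ring] at h
    rw [mul_comm, ← Function.iterate_add_apply, add_comm j (i + 1)]
    exact h

/-- Forward and backward rates of a submultiplicative cocycle agree. -/
theorem IsSubmultiplicative.exists_rate {T : Ω ≃ᵐ Ω} (hT : Ergodic T P) {f : ℕ → Ω → ℝ}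
    (hf : IsSubmultiplicative T f) {j₀ : ℕ} (h0 : P {ω | f j₀ ω < 1} ≠ 0) :
    ∃ C : ℝ, 0 ≤ C ∧ C < 1 ∧
      (∀ᵐ ω ∂P, Tendsto (fun j : ℕ => f j ω ^ (1 / ((j + 1 : ℕ) : ℝ))) atTop (𝓝 C)) ∧
      ∀ᵐ ω ∂P, Tendsto (fun j : ℕ => f j (T.symm^[j] ω) ^ (1 / ((j + 1 : ℕ) : ℝ))) atTop
        (𝓝 C) := by
  have hT' : Ergodic T.symm P := hT.symm
  -- The growth rate depends only on expectations, which the measure preserving iterates of `T⁻¹`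
  -- leave unchanged.
  have hrate : growthRate P (negLogSeq fun j ω => f j (T.symm^[j] ω))
      = growthRate P (negLogSeq f) := by
    refine iSup_congr fun n => ?_
    congr 1
    exact (hT'.toMeasurePreserving.iterate n).lintegral_comp
      (measurable_negLog.comp (hf.measurable n))
  refine ⟨_, expNeg_nonneg _, expNeg_lt_one ?_, hf.tendsto_rpow hT, ?_⟩
  -- A zero rate forces the expectation of `-log f j₀` to vanish, hence `f j₀ ≥ 1` almost surely.
  · intro hL
    have h1 := lintegral_le_mul_growthRate P (negLogSeq f) j₀
    rw [hL, zero_mul, nonpos_iff_eq_zero,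
      lintegral_eq_zero_iff (hf.isSuperadditive.measurable _)] at h1
    refine h0 (measure_mono_null (fun ω hω => ?_) (ae_iff.mp h1))
    exact fun h2 => (negLog_eq_zero_iff.mp h2).not_gt hω
  · rw [← hrate]
    exact hf.reverse.tendsto_rpow hT'

theorem eventually_le_pow {s : ℕ → ℝ} (hs0 : ∀ j, 0 ≤ s j) {C κ : ℝ} (hκ : C < κ)
    (h : Tendsto (fun j : ℕ => s j ^ (1 / ((j + 1 : ℕ) : ℝ))) atTop (𝓝 C)) :
    ∀ᶠ j in atTop, s j ≤ κ ^ (j + 1) := by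
  filter_upwards [h.eventually_lt_const hκ] with j hj
  have := Real.rpow_le_rpow (by have := hs0 j; positivity) hj.le (Nat.cast_nonneg (j + 1))
  rwa [← Real.rpow_mul (hs0 j), one_div, inv_mul_cancel₀ (by positivity), Real.rpow_one,
    Real.rpow_natCast] at this

theorem tendsto_zero_of_tendsto_rpow {s : ℕ → ℝ} (hs0 : ∀ j, 0 ≤ s j) {C : ℝ} (hC : 0 ≤ C)
    (hC1 : C < 1) (h : Tendsto (fun j : ℕ => s j ^ (1 / ((j + 1 : ℕ) : ℝ))) atTop (𝓝 C)) :
    Tendsto s atTop (𝓝 0) := by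
  obtain ⟨κ, hκ, hκ1⟩ := exists_between hC1
  exact squeeze_zero' (.of_forall hs0) (eventually_le_pow hs0 hκ h)
    ((tendsto_pow_atTop_nhds_zero_of_lt_one (hC.trans hκ.le) hκ1).comp (tendsto_add_atTop_nat 1))

/-- A random constant that bounds a sequence by a geometric sequence. -/
theorem exists_measurable_geometric_bound {s : ℕ → Ω → ℝ} (hs : ∀ j, Measurable (s j))
    (hs0 : ∀ j ω, 0 ≤ s j ω) {C κ : ℝ} (hC : 0 ≤ C) (hκ : C < κ)
    (h : ∀ᵐ ω ∂P, Tendsto (fun j : ℕ => s j ω ^ (1 / ((j + 1 : ℕ) : ℝ))) atTop (𝓝 C)) :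
    ∃ K : Ω → ℝ, Measurable K ∧ (∀ ω, 0 ≤ K ω) ∧
      ∀ᵐ ω ∂P, ∀ j, s j ω ≤ K ω * κ ^ (j + 1) := by
  have hκ0 : 0 < κ := hC.trans_lt hκ
  -- The best constant, with the supremum taken in `[0, ∞]` for measurability; `toReal` sends an
  -- infinite supremum, possible only on a null set, to `0`.
  refine ⟨fun ω => (⨆ j, ENNReal.ofReal (s j ω / κ ^ (j + 1))).toReal,
    (Measurable.iSup fun j => ((hs j).div_const _).ennreal_ofReal).ennreal_toReal,
    fun ω => ENNReal.toReal_nonneg, ?_⟩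
  filter_upwards [h] with ω hω
  have hev : ∀ᶠ j in atTop, s j ω / κ ^ (j + 1) ≤ 1 := by
    filter_upwards [eventually_le_pow (fun j => hs0 j ω) hκ hω] with j hj
    rwa [div_le_one (by positivity)]
  obtain ⟨R, hR⟩ : BddAbove (range fun j => s j ω / κ ^ (j + 1)) :=
    (isBoundedUnder_of_eventually_le hev).bddAbove_range
  have hne : (⨆ j, ENNReal.ofReal (s j ω / κ ^ (j + 1))) ≠ ⊤ :=
    ne_top_of_le_ne_top ENNReal.ofReal_ne_top
      (iSup_le fun j => ENNReal.ofReal_le_ofReal (hR ⟨j, rfl⟩))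
  intro j
  rw [← div_le_iff₀ (by positivity)]
  exact (ENNReal.ofReal_le_iff_le_toReal hne).mp
    (le_iSup (fun j => ENNReal.ofReal (s j ω / κ ^ (j + 1))) j)

end Submultiplicative

set_option linter.unusedSectionVars false

/-! ### Random positive maps and their products -/

section RandomProducts

variable {Ω E : Type*} (T : Equiv.Perm Ω) (γ : Ω → E → E)

/-- Stationarity: a product started at time `m` is one started at time `0` for the shifted point, so
one cocycle describes all of them. -/
theorem processAux_eq (m : ℤ) (ω : Ω) (j : ℕ) :
    processAux T γ m ω j = processAux T γ 0 ((T ^ m) ω) j := by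
  induction j with
  | zero => simp [processAux]
  | succ j ih =>
    rw [processAux, processAux, ih, zero_add, add_comm m, zpow_add, Equiv.Perm.mul_apply]

theorem processAux_add (m : ℤ) (ω : Ω) (i j : ℕ) :
    processAux T γ m ω (i + 1 + j)
      = processAux T γ (m + (i + 1 : ℕ)) ω j ∘ processAux T γ m ω i := by
  induction j with
  | zero => rfl
  | succ j ih =>
    rw [← add_assoc, processAux, ih, processAux, ← Function.comp_assoc, add_assoc m]
    push_cast
    rw [add_assoc ((i : ℤ) + 1) j 1]

theorem quantumProcess_eq (n m : ℤ) (ω : Ω) :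
    quantumProcess T γ n m ω = processAux T γ 0 ((T ^ m) ω) (n - m).toNat :=
  processAux_eq T γ m ω _

theorem quantumProcess_comp {n k m : ℤ} (hmk : m < k) (hkn : k ≤ n) (ω : Ω) :
    quantumProcess T γ n m ω = quantumProcess T γ n k ω ∘ quantumProcess T γ (k - 1) m ω := by
  have h := processAux_add T γ m ω (k - 1 - m).toNat (n - k).toNat
  rw [show (k - 1 - m).toNat + 1 + (n - k).toNat = (n - m).toNat by omega,
    show m + (((k - 1 - m).toNat + 1 : ℕ) : ℤ) = k by omega] at h
  exact h

theorem processAux_congr {γ γ' : Ω → E → E} {ω : Ω}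
    (h : ∀ i : ℤ, γ ((T ^ i) ω) = γ' ((T ^ i) ω)) (m : ℤ) (j : ℕ) :
    processAux T γ m ω j = processAux T γ' m ω j := by
  induction j with
  | zero => exact h m
  | succ j ih => rw [processAux, processAux, ih, h]

variable [MeasurableSpace Ω] {P : Measure Ω}

theorem measurePreserving_zpow {T : Ω ≃ᵐ Ω} (hT : MeasurePreserving T P P) (m : ℤ) :
    MeasurePreserving (T.toEquiv ^ m : Equiv.Perm Ω) P P := by
  have h1 : ∀ n : ℕ, ⇑((T.toEquiv : Equiv.Perm Ω) ^ n) = T^[n] := fun n =>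
    (Equiv.Perm.iterate_eq_pow (T.toEquiv : Equiv.Perm Ω) n).symm
  have h2 : ∀ n : ℕ, ⇑((T.symm.toEquiv : Equiv.Perm Ω) ^ n) = T.symm^[n] := fun n =>
    (Equiv.Perm.iterate_eq_pow (T.symm.toEquiv : Equiv.Perm Ω) n).symm
  obtain ⟨n, rfl | rfl⟩ := m.eq_nat_or_neg
  · rw [zpow_natCast, h1]
    exact hT.iterate n
  · rw [zpow_neg, zpow_natCast, ← inv_pow,
      show (T.toEquiv : Equiv.Perm Ω)⁻¹ = (T.symm.toEquiv : Equiv.Perm Ω) from rfl, h2]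
    exact hT.symm.iterate n

end RandomProducts

theorem measurableSet_pair_mem {Ω E : Type*} [MeasurableSpace Ω] [TopologicalSpace E]
    [TopologicalSpace.PseudoMetrizableSpace E] {u v : Ω → E} (hu : StronglyMeasurable u)
    (hv : StronglyMeasurable v) {C : Set (E × E)} (hC : IsClosed C) :
    MeasurableSet {ω | (u ω, v ω) ∈ C} := by
  let _ : MeasurableSpace (E × E) := borel _
  have _ : BorelSpace (E × E) := ⟨rfl⟩
  exact (hu.prodMk hv).measurable hC.measurableSet

theorem pair_mem_of_dense {X E : Type*} [TopologicalSpace X] [TopologicalSpace E] {f : X → E}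
    {Q : Set X} (hQ : Dense Q) (hf : Continuous f) {C : Set (E × E)} (hC : IsClosed C)
    (h : ∀ x ∈ Q, ∀ y ∈ Q, (f x, f y) ∈ C) (x y : X) : (f x, f y) ∈ C := by
  have hcl : IsClosed {p : X × X | (f p.1, f p.2) ∈ C} :=
    hC.preimage ((hf.comp continuous_fst).prodMk (hf.comp continuous_snd))
  have hsub : closure (Q ×ˢ Q) ⊆ {p : X × X | (f p.1, f p.2) ∈ C} :=
    closure_minimal (fun p hp => h p.1 hp.1 p.2 hp.2) hcl
  rw [(hQ.prod hQ).closure_eq] at hsub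
  exact hsub (mem_univ (x, y))

/-! ### Random positive maps and measurability of the contraction constant -/

namespace TraceL1

variable {A : Type*} [CStarAlgebra A] [PartialOrder A] [StarOrderedRing A] {τ : A →L[ℂ] ℂ}
  {Ω : Type*} [MeasurableSpace Ω]

/-- A random variable with values in the bounded, faithful positive maps that preserve `A`. -/
structure RandomMap (γ : Ω → TraceL1 τ → TraceL1 τ) : Prop where
  faithfulPositive : ∀ ω, FaithfulPositive (γ ω)
  continuous : ∀ ω, Continuous (γ ω)
  preserves : ∀ ω, PreservesAlgebra (γ ω)
  stronglyMeasurable : ∀ x, StronglyMeasurable fun ω => γ ω x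

variable {γ δ : Ω → TraceL1 τ → TraceL1 τ}

theorem secondCountableTopology [h : TopologicalSpace.SeparableSpace (TraceL1 τ)] :
    SecondCountableTopology (TraceL1 τ) :=
  @UniformSpace.secondCountable_of_separable (TraceL1 τ) _
    (@EMetric.instIsCountablyGeneratedUniformity (TraceL1 τ) _) h

/-- A Carathéodory argument: continuity in `x` and measurability in `ω` give joint measurability on
a separable space. This makes compositions of random maps measurable. -/
theorem RandomMap.apply [TopologicalSpace.SeparableSpace (TraceL1 τ)] (hγ : RandomMap γ)
    {Y : Ω → TraceL1 τ} (hY : StronglyMeasurable Y) : StronglyMeasurable fun ω => γ ω (Y ω) := by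
  let _ : MeasurableSpace (TraceL1 τ) := borel _
  have _ : BorelSpace (TraceL1 τ) := ⟨rfl⟩
  have _ : SecondCountableTopology (TraceL1 τ) :=
    secondCountableTopology
  exact (stronglyMeasurable_uncurry_of_continuous_of_stronglyMeasurable
    (u := fun (x : TraceL1 τ) ω => γ ω x) hγ.continuous hγ.stronglyMeasurable).comp_measurable
    (hY.measurable.prodMk measurable_id)

theorem RandomMap.comp [TopologicalSpace.SeparableSpace (TraceL1 τ)] (hγ : RandomMap γ)
    (hδ : RandomMap δ) : RandomMap fun ω => γ ω ∘ δ ω where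
  faithfulPositive ω := (hγ.faithfulPositive ω).comp (hδ.faithfulPositive ω)
  continuous ω := (hγ.continuous ω).comp (hδ.continuous ω)
  preserves ω a := by
    obtain ⟨b, hb⟩ := hδ.preserves ω a
    rw [Function.comp_apply, ← hb]
    exact hγ.preserves ω b
  stronglyMeasurable x := hγ.apply (hδ.stronglyMeasurable x)

theorem RandomMap.comp_measurable (hγ : RandomMap γ) {T : Ω → Ω} (hT : Measurable T) :
    RandomMap fun ω => γ (T ω) where
  faithfulPositive _ := hγ.faithfulPositive _
  continuous _ := hγ.continuous _
  preserves _ := hγ.preserves _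
  stronglyMeasurable x := (hγ.stronglyMeasurable x).comp_measurable hT

theorem RandomMap.processAux [TopologicalSpace.SeparableSpace (TraceL1 τ)] (hγ : RandomMap γ)
    {T : Equiv.Perm Ω} (hT : ∀ m : ℤ, Measurable (T ^ m)) (m : ℤ) (j : ℕ) :
    RandomMap fun ω => processAux T γ m ω j := by
  induction j with
  | zero => exact hγ.comp_measurable (hT m)
  | succ j ih => exact (hγ.comp_measurable (hT _)).comp ih

theorem isPos_sub_of_le_mQuantity {x y : TraceL1 τ} (hx : x ∈ states τ) (hy : y ∈ states τ) {s : ℝ}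
    (h : s ≤ mQuantity x y) : (x - (s : ℂ) • y).IsPos := by
  have h1 := (isPos_sub_mQuantity hx hy).add (hy.1.smul (sub_nonneg.mpr h))
  have h2 : x - (mQuantity x y : ℂ) • y + ((mQuantity x y - s : ℝ) : ℂ) • y = x - (s : ℂ) • y :=
    ext_pair fun a => by
      simp only [pair_add, pair_sub, pair_smul]
      push_cast
      ring
  rwa [h2] at h1

/-- The inequality `m m' ≥ p` holds exactly when each `s > 0` satisfies `s ≤ m` or `p / s ≤ m'`.
This expresses the distance by positivity conditions, each closed in `(x, y)`. -/
theorem hennionDist_le_iff {x y : TraceL1 τ} (hx : x ∈ states τ) (hy : y ∈ states τ) {D : ℝ}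
    (hD0 : 0 ≤ D) (hD : D < 1) : hennionDist x y ≤ D ↔ ∀ s : ℝ, 0 < s →
      (x - (s : ℂ) • y).IsPos ∨ (y - (((1 - D) / (1 + D) / s : ℝ) : ℂ) • x).IsPos := by
  set p : ℝ := (1 - D) / (1 + D) with hp
  have hp0 : 0 < p := div_pos (by linarith) (by linarith)
  have h2 := mQuantity_nonneg hx hy
  have h3 := mQuantity_nonneg hy hx
  refine ⟨fun h s hs => ?_, fun h => ?_⟩
  · have h1 := le_mQuantity_mul_of_hennionDist_le hx hy h (by linarith)
    rcases le_or_gt s (mQuantity x y) with h4 | h4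
    · exact Or.inl (isPos_sub_of_le_mQuantity hx hy h4)
    · refine Or.inr (isPos_sub_of_le_mQuantity hy hx ?_)
      rw [div_le_iff₀ hs, mul_comm]
      exact h1.trans (mul_le_mul_of_nonneg_right h4.le h3)
  · have h1 : p ≤ mQuantity x y * mQuantity y x := by
      by_contra! hlt
      have h4 : Tendsto (fun s => s * mQuantity y x) (𝓝[>] (mQuantity x y))
          (𝓝 (mQuantity x y * mQuantity y x)) :=
        ((continuous_mul_const _).tendsto _).mono_left nhdsWithin_le_nhds
      -- If `m m' < p`, some `s` slightly above `m` still has `s m' < p`, and violates both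
      -- alternatives.
      obtain ⟨s, hs2, hs1⟩ := ((h4.eventually_lt_const hlt).and self_mem_nhdsWithin).exists
      have hs0 : 0 < s := h2.trans_lt hs1
      rcases h s hs0 with h5 | h5
      · exact (le_mQuantity hx hy h5).not_gt hs1
      · have h6 := le_mQuantity hy hx h5
        rw [div_le_iff₀ hs0, mul_comm] at h6
        exact hs2.not_ge h6
    rw [hennionDist, div_le_iff₀ (by positivity)]
    rw [hp, div_le_iff₀ (by linarith)] at h1
    linarith

theorem continuous_sub_const_smul {E X : Type*} [NormedAddCommGroup E] [NormedSpace ℂ E]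
    [TopologicalSpace X] {f g : X → E} (hf : Continuous f) (hg : Continuous g) (t : ℂ) :
    Continuous fun x => f x - t • g x := hf.sub (hg.const_smul t)

/-- The pairs of states at Hennion distance at most `D` form a closed set. -/
theorem isClosed_hennionDist_le (D : ℝ) :
    IsClosed {p : TraceL1 τ × TraceL1 τ | p.1 ∈ states τ ∧ p.2 ∈ states τ ∧
      hennionDist p.1 p.2 ≤ D} := by
  have hSS : IsClosed {p : TraceL1 τ × TraceL1 τ | p.1 ∈ states τ ∧ p.2 ∈ states τ} :=
    (isClosed_states.preimage continuous_fst).inter (isClosed_states.preimage continuous_snd)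
  rcases le_or_gt 1 D with hD | hD
  · have h : {p : TraceL1 τ × TraceL1 τ | p.1 ∈ states τ ∧ p.2 ∈ states τ ∧
        hennionDist p.1 p.2 ≤ D} = {p | p.1 ∈ states τ ∧ p.2 ∈ states τ} :=
      Set.ext fun p => ⟨fun h => ⟨h.1, h.2.1⟩,
        fun h => ⟨h.1, h.2, (hennionDist_le_one h.1 h.2).trans hD⟩⟩
    rw [h]
    exact hSS
  rcases lt_or_ge D 0 with hD0 | hD0
  · have h : {p : TraceL1 τ × TraceL1 τ | p.1 ∈ states τ ∧ p.2 ∈ states τ ∧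
        hennionDist p.1 p.2 ≤ D} = ∅ := eq_empty_iff_forall_notMem.mpr fun p hp =>
      absurd (hennionDist_nonneg hp.1 hp.2.1) (not_le.mpr (hp.2.2.trans_lt hD0))
    rw [h]
    exact isClosed_empty
  have hsub : ∀ t : ℝ, IsClosed {q : TraceL1 τ × TraceL1 τ | (q.1 - (t : ℂ) • q.2).IsPos} :=
    fun t => isClosed_isPos.preimage (continuous_sub_const_smul continuous_fst continuous_snd _)
  have hsub' : ∀ t : ℝ, IsClosed {q : TraceL1 τ × TraceL1 τ | (q.2 - (t : ℂ) • q.1).IsPos} :=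
    fun t => isClosed_isPos.preimage (continuous_sub_const_smul continuous_snd continuous_fst _)
  have hcl := isClosed_iInter fun s : Ioi (0 : ℝ) =>
    (hsub s).union (hsub' ((1 - D) / (1 + D) / s))
  have h : {p : TraceL1 τ × TraceL1 τ | p.1 ∈ states τ ∧ p.2 ∈ states τ ∧
      hennionDist p.1 p.2 ≤ D} = {p | p.1 ∈ states τ ∧ p.2 ∈ states τ} ∩ ⋂ s : Ioi (0 : ℝ),
        ({q | (q.1 - ((s : ℝ) : ℂ) • q.2).IsPos} ∪
          {q | (q.2 - (((1 - D) / (1 + D) / s : ℝ) : ℂ) • q.1).IsPos}) := by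
    ext p
    refine ⟨fun h => ⟨⟨h.1, h.2.1⟩, mem_iInter.mpr fun s => ?_⟩, fun h => ⟨h.1.1, h.1.2, ?_⟩⟩
    · exact (hennionDist_le_iff h.1 h.2.1 hD0 hD).mp h.2.2 s s.2
    · exact (hennionDist_le_iff h.1.1 h.1.2 hD0 hD).mpr fun s hs => mem_iInter.mp h.2 ⟨s, hs⟩
  rw [h]
  exact hSS.inter hcl

theorem stronglyMeasurable_projAction (hγ : RandomMap γ) (x : TraceL1 τ) :
    StronglyMeasurable fun ω => projAction (γ ω) x := by
  have h := hγ.stronglyMeasurable x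
  exact (continuous_trace.comp_stronglyMeasurable h).inv₀.smul h

theorem FaithfulPositive.continuousOn_projAction {g : TraceL1 τ → TraceL1 τ}
    (hg : FaithfulPositive g) (hc : Continuous g) : ContinuousOn (projAction g) (states τ) := by
  refine ContinuousOn.smul (ContinuousOn.inv₀ (continuous_trace.comp hc).continuousOn
    fun x hx => ?_) hc.continuousOn
  have h := hg.positive x hx.1
  show (g x).trace ≠ 0
  rw [h.eq_tr]
  exact_mod_cast (h.tr_pos (hg.ne_zero hx)).ne'

/-- `c ≤ D` says that the image has diameter at most `D`. The pairs at distance at most `D` form a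
closed set and the projective action is continuous on states, so a countable dense set of states
decides. -/
theorem RandomMap.measurable_contractionConst [TopologicalSpace.SeparableSpace (TraceL1 τ)]
    (hγ : RandomMap γ) : Measurable fun ω => contractionConst (γ ω) := by
  have _ : SecondCountableTopology (TraceL1 τ) :=
    secondCountableTopology
  obtain ⟨Q, hQc, hQd⟩ := TopologicalSpace.exists_countable_dense (states τ)
  refine measurable_of_Iic fun D => ?_
  rcases lt_or_ge D 0 with hD0 | hD0
  · have h : (fun ω => contractionConst (γ ω)) ⁻¹' Iic D = ∅ :=
      eq_empty_iff_forall_notMem.mpr fun ω hω =>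
        absurd (contractionConst_nonneg (hγ.faithfulPositive ω))
          (not_le.mpr (lt_of_le_of_lt hω hD0))
    rw [h]
    exact MeasurableSet.empty
  set C : Set (TraceL1 τ × TraceL1 τ) :=
    {p | p.1 ∈ states τ ∧ p.2 ∈ states τ ∧ hennionDist p.1 p.2 ≤ D} with hC
  have hCcl : IsClosed C := isClosed_hennionDist_le D
  have key : (fun ω => contractionConst (γ ω)) ⁻¹' Iic D = ⋂ x ∈ Q, ⋂ y ∈ Q,
      {ω | (projAction (γ ω) x, projAction (γ ω) y) ∈ C} := by
    ext ω
    have hg := hγ.faithfulPositive ω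
    simp only [mem_preimage, mem_Iic, mem_iInter, mem_ofPred_eq]
    rw [contractionConst_le_iff hg hD0]
    refine ⟨fun h x _ y _ => ⟨projAction_mem_states hg x.2, projAction_mem_states hg y.2,
      h x x.2 y y.2⟩, fun h x hx y hy => ?_⟩
    have hf : Continuous fun x : states τ => projAction (γ ω) x :=
      continuousOn_iff_continuous_domRestrict.mp
        (hg.continuousOn_projAction (hγ.continuous ω))
    exact (pair_mem_of_dense hQd hf hCcl h ⟨x, hx⟩ ⟨y, hy⟩).2.2
  rw [key]
  exact MeasurableSet.biInter hQc fun x _ => MeasurableSet.biInter hQc fun y _ =>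
    measurableSet_pair_mem (stronglyMeasurable_projAction hγ x) (stronglyMeasurable_projAction hγ y)
      hCcl

end TraceL1

set_option linter.unusedSectionVars false

/-! ### Measurability of limits -/

theorem stronglyMeasurable_of_dense {Ω E : Type*} [MeasurableSpace Ω] [TopologicalSpace E]
    [TopologicalSpace.PseudoMetrizableSpace E] [TopologicalSpace.SeparableSpace E] [Nonempty E]
    {g : Ω → E → E} (hc : ∀ ω, Continuous (g ω))
    (hg : ∀ i, StronglyMeasurable fun ω => g ω (TopologicalSpace.denseSeq E i)) (x : E) :
    StronglyMeasurable fun ω => g ω x := by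
  have h : x ∈ closure (range (TopologicalSpace.denseSeq E)) := by
    rw [(TopologicalSpace.denseRange_denseSeq E).closure_eq]
    exact mem_univ x
  obtain ⟨y, hy, hyx⟩ := mem_closure_iff_seq_limit.mp h
  choose i hi using hy
  refine stronglyMeasurable_of_tendsto (f := fun k ω => g ω (y k)) atTop (fun k => ?_)
    (tendsto_pi_nhds.mpr fun ω => ((hc ω).tendsto x).comp hyx)
  simp only [← hi]
  exact hg (i k)

/-- A version of Pettis' measurability theorem. -/
theorem stronglyMeasurable_of_separating {Ω E : Type*} [MeasurableSpace Ω] [NormedAddCommGroup E]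
    [NormedSpace ℂ E] [CompleteSpace E] [TopologicalSpace.SeparableSpace E] {ι : Type*} [Countable ι]
    {f : ι → E →L[ℂ] ℂ} (hf : ∀ x, (∀ i, f i x = 0) → x = 0) {Y : Ω → E}
    (hY : ∀ i, Measurable fun ω => f i (Y ω)) : StronglyMeasurable Y := by
  let _ : MeasurableSpace E := borel _
  have _ : BorelSpace E := ⟨rfl⟩
  have _ : SecondCountableTopology E := UniformSpace.secondCountable_of_separable E
  have hinj : Function.Injective fun (x : E) (i : ι) => f i x := fun x y h => by
    rw [← sub_eq_zero]
    refine hf _ fun i => ?_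
    rw [map_sub, sub_eq_zero]
    exact congrFun h i
  have hcont : Continuous fun (x : E) (i : ι) => f i x :=
    continuous_pi fun i => (f i).continuous
  -- Lusin–Souslin: a continuous injection of a Polish space is a measurable embedding, so
  -- coordinatewise measurability suffices.
  exact ((hcont.measurableEmbedding hinj).measurable_comp_iff.mp
    (measurable_pi_iff.mpr hY)).stronglyMeasurable

/-- A separable space of functionals has a countable separating set of points. -/
theorem exists_countable_separating_points {A : Type*} [NormedAddCommGroup A] [NormedSpace ℂ A]
    (V : Submodule ℂ (StrongDual ℂ A)) [TopologicalSpace.SeparableSpace V] :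
    ∃ a : ℕ → A, ∀ z : V, (∀ i, (z : StrongDual ℂ A) (a i) = 0) → z = 0 := by
  have h : ∀ i, ∃ a : A, ‖a‖ ≤ 1 ∧
      ‖TopologicalSpace.denseSeq V i‖ / 2 ≤ ‖(TopologicalSpace.denseSeq V i : StrongDual ℂ A) a‖ := by
    intro i
    set y := TopologicalSpace.denseSeq V i with hy
    rcases (norm_nonneg y).eq_or_lt with h0 | h0
    · exact ⟨0, by simp, by simp [← h0]⟩
    · obtain ⟨a, ha, hya⟩ := (y : StrongDual ℂ A).exists_lt_apply_of_lt_opNorm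
        (r := ‖y‖ / 2) (by change ‖y‖ / 2 < ‖y‖; linarith)
      exact ⟨a, ha.le, hya.le⟩
  choose a ha hya using h
  refine ⟨a, fun z hz => ?_⟩
  by_contra hne
  have hpos : 0 < ‖z‖ :=
    norm_pos_iff.mpr (show (z : StrongDual ℂ A) ≠ 0 from fun h => hne (Subtype.ext h))
  -- If `z` vanishes at `a i`, then `‖y‖ / 2 ≤ ‖y (a i)‖ ≤ ‖z - y‖`, so `‖z‖ ≤ 3‖z - y‖ < (3/8)‖z‖`.
  obtain ⟨i, hi⟩ := (TopologicalSpace.denseRange_denseSeq V).exists_dist_lt z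
    (show 0 < ‖z‖ / 8 by linarith)
  set y := TopologicalSpace.denseSeq V i
  have hi : ‖z - y‖ < ‖z‖ / 8 := (dist_eq_norm (z : StrongDual ℂ A) y).symm.trans_lt hi
  have h1 : ‖(y : StrongDual ℂ A) (a i)‖ ≤ ‖z - y‖ := by
    have h2 := ((z - y : V) : StrongDual ℂ A).le_opNorm (a i)
    have h3 : ((z - y : V) : StrongDual ℂ A) (a i) = -(y : StrongDual ℂ A) (a i) := by
      change (z : StrongDual ℂ A) (a i) - (y : StrongDual ℂ A) (a i) = _
      rw [hz i, zero_sub]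
    rw [h3, norm_neg] at h2
    exact h2.trans (mul_le_of_le_one_right (norm_nonneg _) (ha i))
  have h2 := hya i
  have h3 : ‖z‖ ≤ ‖z - y‖ + ‖y‖ := norm_le_norm_sub_add z y
  linarith

/-! ### Random limits in `L¹` -/

namespace TraceL1

variable {A : Type*} [CStarAlgebra A] [PartialOrder A] [StarOrderedRing A] {τ : A →L[ℂ] ℂ}
  {Ω : Type*} [MeasurableSpace Ω]

theorem stronglyMeasurable_of_pair [h : TopologicalSpace.SeparableSpace (TraceL1 τ)]
    {Y : Ω → TraceL1 τ} (hY : ∀ a, Measurable fun ω => (Y ω).pair a) : StronglyMeasurable Y := by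
  obtain ⟨a, ha⟩ := @exists_countable_separating_points A _ _
    (LinearMap.range (traceFunctional τ).toLinearMap).topologicalClosure h
  exact stronglyMeasurable_of_separating (f := fun i => pairCLM τ (a i)) (fun x hx => ha x hx)
    fun i => hY (a i)

/-- An almost surely positive, faithful and bounded random operator agrees almost surely with a
random variable all of whose values are such maps. -/
theorem exists_randomMap_ae_eq [h : TopologicalSpace.SeparableSpace (TraceL1 τ)] {P : Measure Ω}
    {γ : Ω → TraceL1 τ → TraceL1 τ} (hm : ∀ x, AEStronglyMeasurable (fun ω => γ ω x) P)
    (hlin : ∀ᵐ ω ∂P, IsLinearMap ℂ (γ ω)) (hcont : ∀ᵐ ω ∂P, Continuous (γ ω))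
    (hpos : ∀ᵐ ω ∂P, PositiveMap (γ ω)) (hfaith : ∀ᵐ ω ∂P, FaithfulMap (γ ω))
    (hpres : ∀ᵐ ω ∂P, PreservesAlgebra (γ ω)) :
    ∃ γ' : Ω → TraceL1 τ → TraceL1 τ, RandomMap γ' ∧ ∀ᵐ ω ∂P, γ ω = γ' ω := by
  classical
  have hmk : ∀ᵐ ω ∂P, ∀ i, γ ω (TopologicalSpace.denseSeq (TraceL1 τ) i)
      = (hm (TopologicalSpace.denseSeq (TraceL1 τ) i)).mk _ ω :=
    ae_all_iff.mpr fun i => (hm _).ae_eq_mk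
  have hall : ∀ᵐ ω ∂P, (FaithfulPositive (γ ω) ∧ Continuous (γ ω) ∧ PreservesAlgebra (γ ω)) ∧
      ∀ i, γ ω (TopologicalSpace.denseSeq (TraceL1 τ) i)
        = (hm (TopologicalSpace.denseSeq (TraceL1 τ) i)).mk _ ω := by
    filter_upwards [hlin, hcont, hpos, hfaith, hpres, hmk] with ω h1 h2 h3 h4 h5 h6
    exact ⟨⟨⟨h1, h3, h4⟩, h2, h5⟩, h6⟩
  obtain ⟨N, hN, hNm, hN0⟩ := exists_measurable_superset_of_null (ae_iff.mp hall)
  have hgood : ∀ ω ∉ N, (FaithfulPositive (γ ω) ∧ Continuous (γ ω) ∧ PreservesAlgebra (γ ω)) ∧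
      ∀ i, γ ω (TopologicalSpace.denseSeq (TraceL1 τ) i)
        = (hm (TopologicalSpace.denseSeq (TraceL1 τ) i)).mk _ ω :=
    fun ω hω => by_contra fun h => hω (hN h)
  -- The identity, which has every required property, replaces `γ` on a measurable null set. Off
  -- that set `γ` agrees with measurable versions on a dense sequence, and continuity does the rest.
  let γ' : Ω → TraceL1 τ → TraceL1 τ := fun ω => if ω ∈ N then id else γ ω
  have hγ' : ∀ ω, FaithfulPositive (γ' ω) ∧ Continuous (γ' ω) ∧ PreservesAlgebra (γ' ω) := by
    intro ω
    by_cases hω : ω ∈ N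
    · simp only [γ', if_pos hω]
      exact ⟨⟨⟨fun _ _ => rfl, fun _ _ => rfl⟩, fun _ h => h, fun _ _ h => h⟩, continuous_id,
        fun a => ⟨a, rfl⟩⟩
    · simp only [γ', if_neg hω]
      exact (hgood ω hω).1
  refine ⟨γ', ⟨fun ω => (hγ' ω).1, fun ω => (hγ' ω).2.1, fun ω => (hγ' ω).2.2,
    stronglyMeasurable_of_dense (fun ω => (hγ' ω).2.1) fun i => ?_⟩, ?_⟩
  · have h : (fun ω => γ' ω (TopologicalSpace.denseSeq (TraceL1 τ) i)) =
        N.piecewise (fun _ => TopologicalSpace.denseSeq (TraceL1 τ) i)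
          ((hm (TopologicalSpace.denseSeq (TraceL1 τ) i)).mk _) := by
      ext1 ω
      by_cases hω : ω ∈ N
      · simp only [γ', if_pos hω, piecewise_eq_of_mem _ _ _ hω, id]
      · simp only [γ', if_neg hω, piecewise_eq_of_notMem _ _ _ hω]
        exact (hgood ω hω).2 i
    rw [h]
    exact stronglyMeasurable_const.piecewise hNm (hm _).stronglyMeasurable_mk
  · filter_upwards [measure_eq_zero_iff_ae_notMem.mp hN0] with ω hω
    simp only [γ', if_neg hω]

theorem of_one_mem_boundedStates (hτ : IsFaithfulTracialState τ) : of τ 1 ∈ boundedStates τ :=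
  ⟨of_one_mem_states hτ, 1, rfl⟩

/-- A random limit direction of random products `u k = u j ∘ v`. -/
theorem exists_measurable_limit_state [TopologicalSpace.SeparableSpace (TraceL1 τ)]
    (hτ : IsFaithfulTracialState τ) (hd : HasBoundedDensities τ)
    (u : ℕ → Ω → TraceL1 τ → TraceL1 τ) (hu : ∀ j, RandomMap (u j))
    (hcomp : ∀ ω j k, j < k → ∃ v, FaithfulPositive v ∧ u k ω = u j ω ∘ v) :
    ∃ X : Ω → TraceL1 τ, StronglyMeasurable X ∧ (∀ ω, X ω ∈ boundedStates τ) ∧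
      ∀ ω, Tendsto (fun j => contractionConst (u j ω)) atTop (𝓝 0) →
        ∀ j, ∀ x ∈ states τ, ‖projAction (u j ω) x - X ω‖ ≤ 4 * contractionConst (u j ω) := by
  classical
  set G : Set Ω := {ω | Tendsto (fun j => contractionConst (u j ω)) atTop (𝓝 0)} with hG
  have hGm : MeasurableSet G := measurableSet_tendsto _ fun j => (hu j).measurable_contractionConst
  have h : ∀ ω, ∃ X ∈ boundedStates τ, ω ∈ G →
      Tendsto (fun j => projAction (u j ω) (of τ 1)) atTop (𝓝 X) ∧
      ∀ j, ∀ x ∈ states τ, ‖projAction (u j ω) x - X‖ ≤ 4 * contractionConst (u j ω) := by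
    intro ω
    by_cases hω : ω ∈ G
    · obtain ⟨X, hX, h⟩ := exists_limit_state hτ hd (fun j => u j ω)
        (fun j => (hu j).faithfulPositive ω) (fun j => (hu j).preserves ω) (hcomp ω) hω
      exact ⟨X, hX, fun _ => h⟩
    · exact ⟨_, of_one_mem_boundedStates hτ, fun h => absurd h hω⟩
  choose X hX hXG using h
  refine ⟨G.piecewise X fun _ => of τ 1, ?_, fun ω => ?_, fun ω hω j x hx => ?_⟩
  · refine stronglyMeasurable_of_tendsto
      (f := fun j => G.piecewise (fun ω => projAction (u j ω) (of τ 1)) fun _ => of τ 1) atTop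
      (fun j => (stronglyMeasurable_projAction (hu j) _).piecewise hGm stronglyMeasurable_const)
      (tendsto_pi_nhds.mpr fun ω => ?_)
    by_cases hω : ω ∈ G
    · simp only [piecewise_eq_of_mem _ _ _ hω]
      exact (hXG ω hω).1
    · simp only [piecewise_eq_of_notMem _ _ _ hω]
      exact tendsto_const_nhds
  · by_cases hω : ω ∈ G
    · rw [piecewise_eq_of_mem _ _ _ hω]
      exact hX ω
    · rw [piecewise_eq_of_notMem _ _ _ hω]
      exact of_one_mem_boundedStates hτ
  · rw [piecewise_eq_of_mem _ _ _ (show ω ∈ G from hω)]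
    exact (hXG ω hω).2 j x hx

/-- A random limit functional of random products `u k = v ∘ u j`. -/
theorem exists_measurable_limit_functional [TopologicalSpace.SeparableSpace (TraceL1 τ)]
    (hτ : IsFaithfulTracialState τ) (hd : HasBoundedDensities τ)
    (u : ℕ → Ω → TraceL1 τ → TraceL1 τ) (hu : ∀ j, RandomMap (u j))
    (hcomp : ∀ ω j k, j < k → ∃ v, FaithfulPositive v ∧ u k ω = v ∘ u j ω) :
    ∃ B : Ω → TraceL1 τ, StronglyMeasurable B ∧ (∀ ω, B ω ∈ boundedStates τ) ∧
      ∀ ω, Tendsto (fun j => contractionConst (u j ω)) atTop (𝓝 0) →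
        ∀ j, ∀ a : A, 0 ≤ a →
          ‖ratio (u j ω) a - (B ω).pair a‖ ≤ 4 * contractionConst (u j ω) * ‖a‖ := by
  classical
  set G : Set Ω := {ω | Tendsto (fun j => contractionConst (u j ω)) atTop (𝓝 0)} with hG
  have hGm : MeasurableSet G := measurableSet_tendsto _ fun j => (hu j).measurable_contractionConst
  have h : ∀ ω, ∃ B ∈ boundedStates τ, ω ∈ G →
      (∀ a, Tendsto (fun j => ratio (u j ω) a) atTop (𝓝 (B.pair a))) ∧
      ∀ j, ∀ a : A, 0 ≤ a →
        ‖ratio (u j ω) a - B.pair a‖ ≤ 4 * contractionConst (u j ω) * ‖a‖ := by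
    intro ω
    by_cases hω : ω ∈ G
    · obtain ⟨B, hB, h⟩ := exists_limit_functional hτ hd (fun j => u j ω)
        (fun j => (hu j).faithfulPositive ω) (fun j => (hu j).continuous ω) (hcomp ω) hω
      exact ⟨B, hB, fun _ => h⟩
    · exact ⟨_, of_one_mem_boundedStates hτ, fun h => absurd h hω⟩
  choose B hB hBG using h
  -- The functionals converge pointwise on `A`, so each pairing is measurable, and separability
  -- upgrades this to strong measurability.
  refine ⟨G.piecewise B fun _ => of τ 1, stronglyMeasurable_of_pair fun a => ?_, fun ω => ?_,
    fun ω hω j a ha => ?_⟩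
  · have hrm : ∀ j, Measurable fun ω => ratio (u j ω) a := fun j =>
      ((continuous_trace.comp_stronglyMeasurable ((hu j).stronglyMeasurable _)).measurable.inv).mul
        (continuous_trace.comp_stronglyMeasurable ((hu j).stronglyMeasurable _)).measurable
    refine measurable_of_tendsto_metrizable
      (f := fun j => G.piecewise (fun ω => ratio (u j ω) a) fun _ => (of τ 1).pair a)
      (fun j => (hrm j).piecewise hGm measurable_const) (tendsto_pi_nhds.mpr fun ω => ?_)
    by_cases hω : ω ∈ G
    · simp only [piecewise_eq_of_mem _ _ _ hω]
      exact (hBG ω hω).1 a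
    · simp only [piecewise_eq_of_notMem _ _ _ hω]
      exact tendsto_const_nhds
  · by_cases hω : ω ∈ G
    · rw [piecewise_eq_of_mem _ _ _ hω]
      exact hB ω
    · rw [piecewise_eq_of_notMem _ _ _ hω]
      exact of_one_mem_boundedStates hτ
  · rw [piecewise_eq_of_mem _ _ _ (show ω ∈ G from hω)]
    exact (hBG ω hω).2 j a ha

end TraceL1

set_option linter.unusedSectionVars false

/-! ### Convergence of random products to rank one operators -/

theorem symm_iterate_toNat_zpow {Ω : Type*} [MeasurableSpace Ω] (T : Ω ≃ᵐ Ω) {n m : ℤ} (h : m ≤ n)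
    (ω : Ω) : T.symm^[(n - m).toNat] ((T.toEquiv ^ n : Equiv.Perm Ω) ω)
      = (T.toEquiv ^ m : Equiv.Perm Ω) ω := by
  have h1 : T.symm^[(n - m).toNat] = ((T.toEquiv : Equiv.Perm Ω)⁻¹ ^ (n - m).toNat : Equiv.Perm Ω) :=
    Equiv.Perm.iterate_eq_pow (T.symm.toEquiv : Equiv.Perm Ω) _
  rw [h1, ← Equiv.Perm.mul_apply, inv_pow, ← zpow_natCast, Int.toNat_of_nonneg (by omega),
    ← zpow_neg, ← zpow_add]
  congr 2
  ring

theorem zpow_mul_pow_toNat {κ : ℝ} (hκ : 0 < κ) {n k m : ℤ} (hkn : k ≤ n) (hmk : m < k) :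
    κ ^ ((n - k).toNat + 1) * κ ^ ((k - 1 - m).toNat + 1) = κ ^ (n - m + 1) := by
  rw [← zpow_natCast, ← zpow_natCast, ← zpow_add₀ hκ.ne']
  congr 1
  omega

namespace TraceL1

variable {A : Type*} [CStarAlgebra A] [PartialOrder A] [StarOrderedRing A] {τ : A →L[ℂ] ℂ}
  {Ω : Type*} [MeasurableSpace Ω] {P : Measure Ω} [IsProbabilityMeasure P] {T : Ω ≃ᵐ Ω}
  {γ : Ω → TraceL1 τ → TraceL1 τ}

theorem RandomMap.quantumProcess [TopologicalSpace.SeparableSpace (TraceL1 τ)]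
    (hγ : RandomMap γ) (hT : MeasurePreserving T P P) (n m : ℤ) :
    RandomMap (quantumProcess T.toEquiv γ n m) :=
  hγ.processAux (fun i => (measurePreserving_zpow hT i).measurable) m _

theorem RandomMap.isSubmultiplicative [TopologicalSpace.SeparableSpace (TraceL1 τ)]
    (hγ : RandomMap γ) (hT : MeasurePreserving T P P) :
    IsSubmultiplicative T fun j ω => contractionConst (_root_.processAux T.toEquiv γ 0 ω j) := by
  have hR := hγ.processAux fun i => (measurePreserving_zpow hT i).measurable
  refine ⟨fun j => (hR 0 j).measurable_contractionConst,
    fun j ω => contractionConst_nonneg ((hR 0 j).faithfulPositive ω),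
    fun j ω => contractionConst_le_one ((hR 0 j).faithfulPositive ω), fun i j ω => ?_⟩
  have h : (T.toEquiv ^ (0 + ((i + 1 : ℕ) : ℤ)) : Equiv.Perm Ω) ω = T^[i + 1] ω := by
    rw [zero_add, zpow_natCast, ← Equiv.Perm.iterate_eq_pow]
    rfl
  have h1 := processAux_eq T.toEquiv γ (0 + ((i + 1 : ℕ) : ℤ)) ω j
  rw [h] at h1
  rw [processAux_add, h1]
  exact contractionConst_comp_le ((hR 0 j).faithfulPositive _) ((hR 0 i).faithfulPositive ω)

theorem contractionConst_quantumProcess_comp_le [TopologicalSpace.SeparableSpace (TraceL1 τ)]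
    (hγ : RandomMap γ) (hT : MeasurePreserving T P P) {n k m : ℤ} (hmk : m < k) (hkn : k ≤ n)
    (ω : Ω) : contractionConst (_root_.quantumProcess T.toEquiv γ n m ω)
      ≤ contractionConst (_root_.quantumProcess T.toEquiv γ n k ω)
        * contractionConst (_root_.quantumProcess T.toEquiv γ (k - 1) m ω) := by
  rw [quantumProcess_comp T.toEquiv γ hmk hkn]
  exact contractionConst_comp_le ((hγ.quantumProcess hT n k).faithfulPositive ω)
    ((hγ.quantumProcess hT (k - 1) m).faithfulPositive ω)

theorem tendsto_toNat_sub (m : ℤ) : Tendsto (fun n : ℤ => (n - m).toNat) atTop atTop :=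
  tendsto_atTop.mpr fun b => by
    filter_upwards [eventually_ge_atTop (m + b)] with n hn
    omega

theorem tendsto_toNat_sub_atBot (n : ℤ) : Tendsto (fun m : ℤ => (n - m).toNat) atBot atTop :=
  tendsto_atTop.mpr fun b => by
    filter_upwards [eventually_le_atBot (n - b)] with m hm
    omega

/-- Random products of positive maps, one of which contracts strictly, contract at an exponential
rate and approach rank one operators at that rate. -/
theorem RandomMap.exists_rank_one_approximation [h : TopologicalSpace.SeparableSpace (TraceL1 τ)]
    (hτ : IsFaithfulTracialState τ) (hd : HasBoundedDensities τ) (hγ : RandomMap γ)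
    (hT : Ergodic T P) {n₀ m₀ : ℤ}
    (h0 : P {ω | contractionConst (_root_.quantumProcess T.toEquiv γ n₀ m₀ ω) < 1} ≠ 0) :
    ∃ C : ℝ, 0 ≤ C ∧ C < 1 ∧
      (∀ m : ℤ, ∀ᵐ ω ∂P, Tendsto (fun n : ℤ =>
        contractionConst (_root_.quantumProcess T.toEquiv γ n m ω) ^
          (1 / ((n - m + 1 : ℤ) : ℝ))) atTop (𝓝 C)) ∧
      (∀ n : ℤ, ∀ᵐ ω ∂P, Tendsto (fun m : ℤ =>
        contractionConst (_root_.quantumProcess T.toEquiv γ n m ω) ^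
          (1 / ((n - m + 1 : ℤ) : ℝ))) atBot (𝓝 C)) ∧
      ∃ X B : ℤ → Ω → TraceL1 τ,
        (∀ n, StronglyMeasurable (X n) ∧ ∀ ω, X n ω ∈ boundedStates τ) ∧
        (∀ m, StronglyMeasurable (B m) ∧ ∀ ω, B m ω ∈ boundedStates τ) ∧
        ∀ κ : ℝ, C < κ → κ < 1 → ∀ k : ℤ,
          ∃ E : Ω → ℝ, Measurable E ∧ (∀ ω, 0 ≤ E ω) ∧
            ∀ᵐ ω ∂P, ∀ n m : ℤ, k ≤ n → m < k → ∀ a : A,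
              ‖(_root_.quantumProcess T.toEquiv γ n m ω (of τ 1)).trace⁻¹ •
                  _root_.quantumProcess T.toEquiv γ n m ω (of τ a) - ((B m ω).pair a) • X n ω‖
              ≤ E ω * κ ^ (n - m + 1) * ‖a‖ := by
  have hTm := hT.toMeasurePreserving
  set Γ := _root_.quantumProcess T.toEquiv γ with hΓ
  have hR : ∀ n m, RandomMap (Γ n m) := hγ.quantumProcess hTm
  have hf := hγ.isSubmultiplicative hTm
  set f : ℕ → Ω → ℝ := fun j ω => contractionConst (_root_.processAux T.toEquiv γ 0 ω j) with hfdef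
  have hΓf : ∀ n m ω, contractionConst (Γ n m ω)
      = f (n - m).toNat ((T.toEquiv ^ m : Equiv.Perm Ω) ω) := fun n m ω => by
    rw [hΓ, quantumProcess_eq]
  -- The same quantity seen from the fixed end `T^n ω`, in the form of the reversed cocycle.
  have hΓb : ∀ n m ω, m ≤ n → contractionConst (Γ n m ω)
      = f (n - m).toNat (T.symm^[(n - m).toNat] ((T.toEquiv ^ n : Equiv.Perm Ω) ω)) :=
    fun n m ω hmn => by rw [hΓf, symm_iterate_toNat_zpow T hmn]
  have hqmp : ∀ m : ℤ, MeasurePreserving (T.toEquiv ^ m : Equiv.Perm Ω) P P :=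
    measurePreserving_zpow hTm
  have h0' : P {ω | f (n₀ - m₀).toNat ω < 1} ≠ 0 := by
    rw [← (hqmp m₀).measure_preimage
      (measurableSet_lt (hf.measurable _) measurable_const).nullMeasurableSet]
    simp only [hΓf] at h0
    exact h0
  obtain ⟨C, hC0, hC1, hfwd, hbwd⟩ := hf.exists_rate hT h0'
  have hfwd' : ∀ m : ℤ, ∀ᵐ ω ∂P, Tendsto (fun j : ℕ =>
      f j ((T.toEquiv ^ m : Equiv.Perm Ω) ω) ^ (1 / ((j + 1 : ℕ) : ℝ))) atTop (𝓝 C) :=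
    fun m => (hqmp m).quasiMeasurePreserving.ae hfwd
  have hbwd' : ∀ n : ℤ, ∀ᵐ ω ∂P, Tendsto (fun j : ℕ =>
      f j (T.symm^[j] ((T.toEquiv ^ n : Equiv.Perm Ω) ω)) ^ (1 / ((j + 1 : ℕ) : ℝ))) atTop (𝓝 C) :=
    fun n => (hqmp n).quasiMeasurePreserving.ae hbwd
  have hcast : ∀ n m : ℤ, m ≤ n → ((n - m + 1 : ℤ) : ℝ) = (((n - m).toNat + 1 : ℕ) : ℝ) :=
    fun n m hmn => by
      have : n - m + 1 = (((n - m).toNat + 1 : ℕ) : ℤ) := by omega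
      rw [this, Int.cast_natCast]
  refine ⟨C, hC0, hC1, fun m => ?_, fun n => ?_, ?_⟩
  · filter_upwards [hfwd' m] with ω hω
    refine (hω.comp (tendsto_toNat_sub m)).congr' ?_
    filter_upwards [eventually_ge_atTop m] with n hn
    rw [hΓf, hcast n m hn]
    rfl
  · filter_upwards [hbwd' n] with ω hω
    refine (hω.comp (tendsto_toNat_sub_atBot n)).congr' ?_
    filter_upwards [eventually_le_atBot n] with m hm
    rw [hΓb n m ω hm, hcast n m hm]
    rfl
  -- With the last time fixed, earlier factors enter on the right; with the first time fixed, as for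
  -- `hB`, later factors enter on the left.
  have hX := fun n : ℤ => exists_measurable_limit_state hτ hd (fun j : ℕ => Γ n (n - j))
    (fun j => hR _ _) fun ω j k hjk => ⟨Γ (n - j - 1) (n - k) ω, (hR _ _).faithfulPositive ω,
      quantumProcess_comp T.toEquiv γ (by omega) (by omega) ω⟩
  have hB := fun m : ℤ => exists_measurable_limit_functional hτ hd (fun j : ℕ => Γ (m + j) m)
    (fun j => hR _ _) fun ω j k hjk => ⟨Γ (m + k) (m + j + 1) ω, (hR _ _).faithfulPositive ω, by
      have := quantumProcess_comp T.toEquiv γ (n := m + k) (k := m + j + 1) (m := m)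
        (by omega) (by omega) ω
      rwa [add_sub_cancel_right] at this⟩
  choose X hXm hXS hXlim using hX
  choose B hBm hBS hBlim using hB
  refine ⟨X, B, fun n => ⟨hXm n, hXS n⟩, fun m => ⟨hBm m, hBS m⟩, fun κ hκ hκ1 k => ?_⟩
  -- `K` controls products that start at `k`, `K'` those that end at `k - 1`. Both depend on `k` but
  -- not on the outer ends `n` and `m`, so `32 K K'` can serve as `E_k`.
  obtain ⟨K, hKm, hK0, hK⟩ := exists_measurable_geometric_bound
    (fun j => (hf.measurable j).comp (hqmp k).measurable) (fun j ω => hf.nonneg j _) hC0 hκ (hfwd' k)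
  obtain ⟨K', hKm', hK0', hK'⟩ := exists_measurable_geometric_bound
    (fun j => ((hf.measurable j).comp (T.symm.measurable.iterate j)).comp (hqmp (k - 1)).measurable)
    (fun j ω => hf.nonneg j _) hC0 hκ (hbwd' (k - 1))
  refine ⟨fun ω => 32 * (K ω * K' ω), (hKm.mul hKm').const_mul 32,
    fun ω => mul_nonneg (by norm_num) (mul_nonneg (hK0 ω) (hK0' ω)), ?_⟩
  filter_upwards [hK, hK', ae_all_iff.mpr hfwd', ae_all_iff.mpr hbwd'] with ω h1 h2 h3 h4
  intro n m hkn hmk a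
  have hXn := hXlim n ω (by
    refine (tendsto_zero_of_tendsto_rpow (fun j => hf.nonneg j _) hC0 hC1 (h4 n)).congr fun j => ?_
    rw [hΓb _ _ _ (by omega), show (n - (n - (j : ℤ))).toNat = j by omega]) (n - m).toNat
  have hBm := hBlim m ω (by
    refine (tendsto_zero_of_tendsto_rpow (fun j => hf.nonneg j _) hC0 hC1 (h3 m)).congr fun j => ?_
    rw [hΓf, show (m + (j : ℤ) - m).toNat = j by omega]) (n - m).toNat
  rw [show n - ((n - m).toNat : ℤ) = m by omega] at hXn
  rw [show m + ((n - m).toNat : ℤ) = n by omega] at hBm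
  refine (norm_sub_rank_one_le hτ ((hR n m).faithfulPositive ω) (hXS n ω).1 hXn hBm a).trans ?_
  refine mul_le_mul_of_nonneg_right ?_ (norm_nonneg a)
  rw [mul_assoc]
  refine mul_le_mul_of_nonneg_left ?_ (by norm_num)
  have h5 := contractionConst_quantumProcess_comp_le hγ hTm hmk hkn ω
  have h6 : contractionConst (Γ n k ω) ≤ K ω * κ ^ ((n - k).toNat + 1) := by
    rw [hΓf]
    exact h1 _
  have h7 : contractionConst (Γ (k - 1) m ω) ≤ K' ω * κ ^ ((k - 1 - m).toNat + 1) := by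
    rw [hΓb _ _ _ (by omega)]
    exact h2 _
  have hκ0 : 0 < κ := hC0.trans_lt hκ
  calc _ ≤ _ := h5
    _ ≤ (K ω * κ ^ ((n - k).toNat + 1)) * (K' ω * κ ^ ((k - 1 - m).toNat + 1)) :=
        mul_le_mul h6 h7 (contractionConst_nonneg ((hR _ _).faithfulPositive ω))
          (mul_nonneg (hK0 ω) (by positivity))
    _ = K ω * K' ω * (κ ^ ((n - k).toNat + 1) * κ ^ ((k - 1 - m).toNat + 1)) := by ring
    _ = _ := by rw [zpow_mul_pow_toNat hκ0 hkn hmk]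

end TraceL1

/-! ### From almost sure hypotheses to random maps -/

theorem TraceL1.exists_randomMap_ae_eq_of_isBounded {A : Type*} [CStarAlgebra A] [PartialOrder A]
    [StarOrderedRing A] {τ : A →L[ℂ] ℂ} (hsep : TopologicalSpace.SeparableSpace (TraceL1 τ))
    {Ω : Type*} [MeasurableSpace Ω] {P : Measure Ω} {γ : Ω → TraceL1 τ → TraceL1 τ}
    (hγ : IsBoundedRandomOperator P γ) (hpos : ∀ᵐ ω ∂P, TraceL1.PositiveMap (γ ω))
    (hfaith : ∀ᵐ ω ∂P, TraceL1.FaithfulMap (γ ω))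
    (hpres : ∀ᵐ ω ∂P, TraceL1.PreservesAlgebra (γ ω)) :
    ∃ γ' : Ω → TraceL1 τ → TraceL1 τ, TraceL1.RandomMap γ' ∧ ∀ᵐ ω ∂P, γ ω = γ' ω :=
  TraceL1.exists_randomMap_ae_eq (h := hsep) hγ.measurable
    (hγ.bounded.mono fun _ h => h.toIsLinearMap) (hγ.bounded.mono fun _ h => h.continuous)
    hpos hfaith hpres

theorem mainTheorem9
    {H : Type*} [NormedAddCommGroup H] [InnerProductSpace ℂ H] [CompleteSpace H]
    (M : VonNeumannAlgebra H) (τ : M.toStarSubalgebra →L[ℂ] ℂ)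
    (hτ : IsFaithfulNormalTracialState M τ)
    (hsep : TopologicalSpace.SeparableSpace (TraceL1 τ))
    {Ω : Type*} [MeasurableSpace Ω] (P : Measure Ω) [IsProbabilityMeasure P]
    (T : Ω ≃ᵐ Ω) (hT : Ergodic T P)
    (γ : Ω → TraceL1 τ → TraceL1 τ)
    (hγ : IsBoundedRandomOperator P γ)
    (hpos : ∀ᵐ ω ∂P, TraceL1.PositiveMap (γ ω))
    (hfaith : ∀ᵐ ω ∂P, TraceL1.FaithfulMap (γ ω))
    (hpres : ∀ᵐ ω ∂P, TraceL1.PreservesAlgebra (γ ω))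
    (hdual : ∀ᵐ ω ∂P, ∀ e : TraceL1 τ → TraceL1 τ,
      TraceL1.IsDualExtension (γ ω) e → TraceL1.FaithfulMap e)
    (hSHC : 0 < P {ω | ∃ n m : ℤ, m ≤ n ∧
      TraceL1.IsSHC (quantumProcess T.toEquiv γ n m ω)}) :
    ∃ C : ℝ, 0 ≤ C ∧ C < 1 ∧
      (∀ m : ℤ, ∀ᵐ ω ∂P, Tendsto (fun n : ℤ =>
        TraceL1.contractionConst (quantumProcess T.toEquiv γ n m ω) ^
          (1 / ((n - m + 1 : ℤ) : ℝ))) atTop (𝓝 C)) ∧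
      (∀ n : ℤ, ∀ᵐ ω ∂P, Tendsto (fun m : ℤ =>
        TraceL1.contractionConst (quantumProcess T.toEquiv γ n m ω) ^
          (1 / ((n - m + 1 : ℤ) : ℝ))) atBot (𝓝 C)) ∧
      ∃ X B : ℤ → Ω → TraceL1 τ,
        (∀ n, StronglyMeasurable (X n) ∧ ∀ ω, X n ω ∈ TraceL1.boundedStates τ) ∧
        (∀ m, StronglyMeasurable (B m) ∧ ∀ ω, B m ω ∈ TraceL1.boundedStates τ) ∧
        ∀ κ : ℝ, C < κ → κ < 1 → ∀ k : ℤ,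
          ∃ E : Ω → ℝ, Measurable E ∧ (∀ ω, 0 ≤ E ω) ∧
            ∀ᵐ ω ∂P, ∀ n m : ℤ, k ≤ n → m < k → ∀ a : M.toStarSubalgebra,
              ‖(quantumProcess T.toEquiv γ n m ω (TraceL1.of τ 1)).trace⁻¹ •
                  quantumProcess T.toEquiv γ n m ω (TraceL1.of τ a) -
                ((B m ω).pair a) • X n ω‖
              ≤ E ω * κ ^ (n - m + 1) * ‖a‖ := by
  let _ : CStarAlgebra M.toStarSubalgebra := VonNeumannAlgebra.toCStarAlgebra M
  have hτ' := VonNeumannAlgebra.isFaithfulTracialState hτ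
  have hd := VonNeumannAlgebra.hasBoundedDensities hτ
  have hTm := hT.toMeasurePreserving
  obtain ⟨γ', hγ', hae⟩ := TraceL1.exists_randomMap_ae_eq_of_isBounded hsep hγ hpos hfaith hpres
  -- The modification must agree with `γ` along the whole orbit; an orbit is countable and `T`
  -- preserves null sets.
  have hae' : ∀ᵐ ω ∂P, ∀ i : ℤ, γ ((T.toEquiv ^ i : Equiv.Perm Ω) ω)
      = γ' ((T.toEquiv ^ i : Equiv.Perm Ω) ω) :=
    ae_all_iff.mpr fun i => (measurePreserving_zpow hTm i).quasiMeasurePreserving.ae hae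
  have hΓ : ∀ᵐ ω ∂P, ∀ n m : ℤ,
      quantumProcess T.toEquiv γ n m ω = quantumProcess T.toEquiv γ' n m ω := by
    filter_upwards [hae'] with ω hω
    exact fun n m => processAux_congr T.toEquiv hω m _
  -- There are countably many pairs of times, so one fixed pair contracts strictly with positive
  -- probability.
  obtain ⟨n₀, m₀, h0⟩ : ∃ n₀ m₀ : ℤ,
      P {ω | TraceL1.contractionConst (quantumProcess T.toEquiv γ' n₀ m₀ ω) < 1} ≠ 0 := by
    by_contra! h
    refine hSHC.ne' ?_
    have h1 : ∀ᵐ ω ∂P, ∀ n m : ℤ,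
        ¬ TraceL1.contractionConst (quantumProcess T.toEquiv γ' n m ω) < 1 :=
      ae_all_iff.mpr fun n => ae_all_iff.mpr fun m => measure_eq_zero_iff_ae_notMem.mp (h n m)
    refine measure_eq_zero_iff_ae_notMem.mpr ?_
    filter_upwards [h1, hΓ] with ω h2 h3
    rintro ⟨n, m, -, h4⟩
    rw [h3] at h4
    exact h2 n m h4.2.2.2
  obtain ⟨C, hC0, hC1, hfwd, hbwd, X, B, hX, hB, hE⟩ :=
    TraceL1.RandomMap.exists_rank_one_approximation (h := hsep) hτ' hd hγ' hT h0
  refine ⟨C, hC0, hC1, fun m => ?_, fun n => ?_, X, B, hX, hB, fun κ hκ hκ1 k => ?_⟩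
  · filter_upwards [hfwd m, hΓ] with ω h1 h2
    simpa only [h2] using h1
  · filter_upwards [hbwd n, hΓ] with ω h1 h2
    simpa only [h2] using h1
  · obtain ⟨E, hEm, hE0, hE⟩ := hE κ hκ hκ1 k
    refine ⟨E, hEm, hE0, ?_⟩
    filter_upwards [hE, hΓ] with ω h1 h2 n m hkn hmk a
    rw [h2]
    exact h1 n m hkn hmk a
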